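/- **Setting.** Fix an integer $k\ge 2$ and a ground set $N$ of $n$ keys. The sketching randomness $\rho$ and the sketch $S_\rho(U)$ of a set $U\subseteq N$ are of one of two types. * *$k$-mins*: $\rho$ consists of $k$ hash functions $h_1,\dots,h_k$ whose values $h_i(x)$ on the keys are i.i.d. $\mathsf{Exp}[1]$; $S_\rho(U)=(\min_{x\in U}h_i(x))_{i\in[k]}$; the sufficient statistic is $\tau(S)=\|S\|_1$. * *bottom-$k$*: $\rho$ is one hash function $h$ with i.i.d. uniform values on $[0,1]$; $S_\rho(U)$ is the list of the $k$ smallest values of $h$ on $U$; $\tau(S)$ is the $k$-th smallest value (read as $1$ if $|U|<k$). The standard cardinality estimate is $M(S)=(k-1)/\tau(S)$, and $T(S)=1/M(S)$. The sketch $S_\rho(U)$ is *biased up by a factor of $\beta$* if $\tau(S_\rho(U))\le \beta^{-1}k/|U|$. **Attack.** Draw $r$ queries $U_1,\dots,U_r\subseteq N$, each containing each key of $N$ independently with probability $1/2$, independently of $\rho$ (a single batch). The score $A[x]$ of a key $x\in N$ is the average of $T(S_\rho(U_i))$ over the queries $U_i$ that contain $x$ (and $0$ if there is none). Let $U_\alpha\subseteq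 N$ be the set of the $\lceil\alpha n\rceil$ keys with the lowest scores, ties being broken by an arbitrary measurable rule. **Theorem (utility of the attack on the standard estimators).** There are absolute constants $C_n,C_r,c,c_1,c_2>0$ such that, for both types of sketches, all $k\ge 2$, all $0<\alpha\le 1$, all $r\ge C_r\,k/\alpha^2$ (so that $r=O(k/\alpha^2)$ queries suffice) and all $n\ge C_n\,\frac1\alpha\,k\log(kr)$, the following holds. 1. With probability at least $0.99$ over $\rho$ and the queries, the sketch $S_\rho(U_\alpha)$ is biased up by a factor of $c/\alpha$, and $$c_1\,n\ \le\ M(S_\rho(U_\alpha))\ \le\ c_2\,n .$$ 2. $M(S_\rho(U_\alpha))$ is integrable and $c_1\,n\le \mathsf{E}\left[M(S_\rho(U_\alpha))\right]\le c_2\,n$. -/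

import Mathlib

open MeasureTheory ProbabilityTheory

noncomputable section

namespace CardSketch

/-- The two MinHash designs. -/
inductive SketchType
  | kMins
  | bottomK

/-- Number of hash functions: `k` for `k`-mins sketches, one for bottom-`k` sketches. -/
def SketchType.numHashes : SketchType → ℕ → ℕ
  | .kMins, k => k
  | .bottomK, _ => 1

/-- Law of a single hash value: `Exp[1]` for `k`-mins, uniform on `[0,1]` for bottom-`k`. -/
def SketchType.hashLaw : SketchType → Measure ℝ
  | .kMins => expMeasure 1
  | .bottomK => (volume : Measure ℝ).restrict (Set.Icc 0 1)

/-- The sketching randomness `ρ` seen on the ground set `N = Fin n`: the value of every hash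
function on every key. -/
abbrev Hashes (s : SketchType) (k n : ℕ) : Type := Fin (s.numHashes k) → Fin n → ℝ

/-- Smallest value of `h` over the keys of `U` (with the value `0` for the empty set). -/
def minHash {n : ℕ} (h : Fin n → ℝ) (U : Finset (Fin n)) : ℝ :=
  if hU : U.Nonempty then U.inf' hU h else 0

/-- The sketch `S_ρ(U)`. For `k`-mins: the list of the minimum values over `U` of the `k` hash
functions. For bottom-`k`: the sorted list of the `k` smallest hash values of keys of `U` (of all
the hash values if `U` has fewer than `k` keys). -/
def sketch : (s : SketchType) → (k : ℕ) → {n : ℕ} → Hashes s k n → Finset (Fin n) → List ℝ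
  | .kMins, k, _, ρ, U => List.ofFn fun i : Fin k => minHash (ρ i) U
  | .bottomK, k, _, ρ, U => ((U.val.map (ρ (0 : Fin 1))).sort (· ≤ ·)).take k

/-- The sufficient statistic of the cardinality: the `ℓ₁` norm of a `k`-mins sketch, and the `k`-th
smallest value of a bottom-`k` sketch. A bottom-`k` sketch that holds fewer than `k` values gets
the right end `1` of the range of the hash function. -/
def stat : SketchType → ℕ → List ℝ → ℝ
  | .kMins, _, S => (S.map fun x => |x|).sum
  | .bottomK, k, S => S.getD (k - 1) 1

/-- The standard (unbiased) cardinality estimator `M(S)`. -/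
def estimate (s : SketchType) (k : ℕ) (S : List ℝ) : ℝ := ((k : ℝ) - 1) / stat s k S

/-- The sketch `S` of a set of `m` keys is biased up by a factor of `β`. -/
def IsBiasedUp (s : SketchType) (k : ℕ) (S : List ℝ) (m : ℕ) (β : ℝ) : Prop :=
  stat s k S ≤ β⁻¹ * (k : ℝ) / (m : ℝ)

/-- A fair coin. -/
def fairCoin : Measure Bool := bernoulliMeasure true false ⟨1 / 2, by norm_num, by norm_num⟩

/-- Outcomes of a run of the attack: the hash values, and for each of the `r` queries the coin of
each key. -/
abbrev Run (s : SketchType) (k n r : ℕ) : Type := Hashes s k n × (Fin r → Fin n → Bool)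

/-- The law of a run: all hash values are i.i.d. with the hash law, all coins are independent and
fair, and coins are independent of hash values (all queries form a single batch). -/
def runLaw (s : SketchType) (k n r : ℕ) : Measure (Run s k n r) :=
  (Measure.pi fun _ : Fin (s.numHashes k) => Measure.pi fun _ : Fin n => s.hashLaw).prod
    (Measure.pi fun _ : Fin r => Measure.pi fun _ : Fin n => fairCoin)

/-- The `i`-th query: the set of the keys whose coin came up `true`. -/
def query {n r : ℕ} (b : Fin r → Fin n → Bool) (i : Fin r) : Finset (Fin n) :=
  Finset.univ.filter fun x => b i x = true

/-- The score `A[x]` of key `x`: the average of the response `T(S_ρ(U)) = 1 / M(S_ρ(U))` over the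
queries `U` that contain `x` (with the value `0` if there are none). -/
def score (s : SketchType) (k : ℕ) {n r : ℕ} (ω : Run s k n r) (x : Fin n) : ℝ :=
  (∑ i with x ∈ query ω.2 i, (estimate s k (sketch s k ω.1 (query ω.2 i)))⁻¹) /
    ((Finset.univ.filter fun i => x ∈ query ω.2 i).card : ℝ)

/-- `W` is a set of `m` keys of lowest scores (ties are broken arbitrarily). -/
def IsLowest {n : ℕ} (A : Fin n → ℝ) (m : ℕ) (W : Finset (Fin n)) : Prop :=
  W.card = m ∧ ∀ u ∈ W, ∀ v, v ∉ W → A u ≤ A v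

end CardSketch

end

/-!
The estimates are all controlled by the statistic of the set `W` of the lowest keys. It decreases
when keys are added, so the estimate of `W` is at most the estimate of all the keys, which has a mean
of order `n`. This gives integrability and, by Markov's inequality, the upper bounds. For the bias
and the lower bounds it suffices that the statistic of `W` is at most of the order `k / n`, the size
it has for all the keys, outside an unlikely event (`conclusion_of_stat_le`).

Fix the hash values, and truncate the statistic at a level that no query reaches. Then only
`O(k log (k r))` keys, fewer than `α n / 4`, can influence the response. The mean response to a query
that contains a key `x` is lower than the overall mean `μ` by half the influence of `x`, and the
variance of the response is of order `k / n²` (`real_le_variance_le`, `expect_size_le`). By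
Chebyshev's inequality a key without influence rarely has an average response below `μ - δ`
(`freq_sum_nonpos_le`), so keys with an average below `μ - δ` are in `W` (`nonneg_sum_of_notMem`);
and a key of influence well above `δ` rarely fails to be below (`freq_sum_nonneg_le`).

For bottom-`k` sketches, each of the `3 k / 2` lowest keys has an influence of order `1 / n`, as its
presence moves the `k`-th smallest value of a query across the gap below it
(`le_expect_kth_erase_sub`, `real_gap_lt_le`). With `r ≥ C k / α²` queries, fewer than `k / 2` of
these keys are missed, and the `k`-th smallest value of `W` is at most the value of the last of them
(`exists_bad_bottomK`).

For `k`-mins sketches, a single key matters to each hash function: its minimal key, whose influence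
is at least of order `γ / n`, unless six other values are within `γ / n` of the minimum, an event of
probability at most `γ ^ 6` (`jprob_highMin_le`). When the minimal key is missed, the minimum over
`W` still needs a bound, and `W` depends on all the hash values. A second way to catch keys gives it.
Take the keys that matter to one given hash function only, in increasing
order of its values. The pattern of such a key, the set of the queries that contain it, is uniform
and independent of the responses that the queries would get with the key added. With
probability of order `α` it is among the patterns of lowest average response, because by an
inequality of Littlewood–Offord type no single average is taken by many patterns
(`card_avgOn_eq_le`, `le_card_lowPat`); if it is, then the key is in `W` (`mem_of_pat_mem_lowPat`).
So no key with a value at most `s / n` is caught in this way with probability at most `e^{-c α s}`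
(`freq_forall_notMem_le`, `jprob_noLowPat_le`). With `γ ^ 4 = α`, the probability `min (2 γ⁶)
(e^{-c α s})` that both ways fail has a bounded sum over `s` (`le_of_le_pow_six_of_le_exp`,
`sum_jprob_notCaught_le`), so each minimum over `W` is `O(1 / n)` in the mean, and the statistic of
`W` is `O(k / n)` by Markov's inequality (`exists_bad_kMins`).

The inverse of a sum of `k ≥ 2` minima, and the inverse of a `k`-th smallest value, have finite means
because they are bounded by sums over pairs of products of two independent inverse square roots
(`lintegral_estimate_univ_kMins_le`, `lintegral_estimate_univ_bottomK_le`).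
-/

noncomputable section

namespace CardSketch

open Finset
open scoped BigOperators Classical ENNReal

/-! ### Averages over finite uniform spaces -/

/-- The probability of the event `p` under the uniform law on a finite type. -/
def freq {Ω : Type*} [Fintype Ω] (p : Ω → Prop) : ℝ := 𝔼 ω, if p ω then (1 : ℝ) else 0

section Freq

variable {Ω : Type*} [Fintype Ω]

lemma freq_nonneg (p : Ω → Prop) : 0 ≤ freq p :=
  expect_nonneg fun _ _ => by split_ifs <;> norm_num

lemma freq_mono {p q : Ω → Prop} (h : ∀ ω, p ω → q ω) : freq p ≤ freq q := by
  refine expect_le_expect fun ω _ => ?_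
  by_cases hp : p ω
  · simp [hp, h ω hp]
  · simp only [hp, if_false]; split_ifs <;> norm_num

lemma freq_le_one [Nonempty Ω] (p : Ω → Prop) : freq p ≤ 1 := by
  calc freq p ≤ 𝔼 _ω : Ω, (1 : ℝ) :=
        expect_le_expect fun ω _ => by split_ifs <;> norm_num
    _ = 1 := Fintype.expect_const 1

lemma freq_or_le (p q : Ω → Prop) : freq (fun ω => p ω ∨ q ω) ≤ freq p + freq q := by
  unfold freq
  rw [← expect_add_distrib]
  refine expect_le_expect fun ω _ => ?_
  by_cases hp : p ω <;> by_cases hq : q ω <;> simp [hp, hq]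

lemma freq_false : freq (fun _ : Ω => False) = 0 := by simp [freq]

lemma freq_not [Nonempty Ω] (p : Ω → Prop) : freq (fun ω => ¬ p ω) = 1 - freq p := by
  unfold freq
  rw [← Fintype.expect_const (ι := Ω) (1 : ℝ), ← expect_sub_distrib]
  exact expect_congr rfl fun ω _ => by by_cases h : p ω <;> simp [h]

/-- Markov's inequality. -/
lemma freq_lt_le_expect_div {f : Ω → ℝ} (hf : ∀ ω, 0 ≤ f ω) {a : ℝ} (ha : 0 < a) :
    freq (fun ω => a ≤ f ω) ≤ (𝔼 ω, f ω) / a := by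
  unfold freq
  rw [expect_div]
  refine expect_le_expect fun ω _ => ?_
  split_ifs with h
  · rwa [le_div_iff₀ ha, one_mul]
  · exact div_nonneg (hf ω) ha.le

lemma freq_eq_card_div (p : Ω → Prop) :
    freq p = ((univ.filter p).card : ℝ) / Fintype.card Ω := by
  unfold freq
  rw [Fintype.expect_eq_sum_div_card, sum_boole]

end Freq

section Resample

variable {ι : Type*} [Fintype ι] [DecidableEq ι] {P : Type*} [Fintype P] [Nonempty P]

/-- Redrawing one coordinate of a uniform point does not change its law. -/
lemma expect_resample (f : (ι → P) → ℝ) (i : ι) :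
    𝔼 ω, f ω = 𝔼 ω : ι → P, 𝔼 a, f (Function.update ω i a) := by
  have h1 : 𝔼 ω : ι → P, 𝔼 a, f (Function.update ω i a)
      = 𝔼 x : (ι → P) × P, f (Function.update x.1 i x.2) := by
    rw [← univ_product_univ, expect_product]
  have h2 : 𝔼 ω : ι → P, f ω = 𝔼 x : (ι → P) × P, f x.1 := by
    rw [← univ_product_univ, expect_product]
    exact expect_congr rfl fun ω _ => (Fintype.expect_const (f ω)).symm
  rw [h1, h2]
  -- Swapping the coordinate `i` with the fresh value is an involution.
  let e : (ι → P) × P ≃ (ι → P) × P :=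
    { toFun := fun x => (Function.update x.1 i x.2, x.1 i)
      invFun := fun x => (Function.update x.1 i x.2, x.1 i)
      left_inv := fun x => by simp
      right_inv := fun x => by simp }
  exact (Fintype.expect_equiv e _ _ fun x => rfl).symm

lemma expect_eval (f : P → ℝ) (i : ι) : 𝔼 ω : ι → P, f (ω i) = 𝔼 a, f a := by
  rw [expect_resample _ i]
  simp only [Function.update_self]
  exact Fintype.expect_const _

/-- The variance of a sum of i.i.d. terms. -/
lemma expect_sum_sub_sq (f : P → ℝ) :
    𝔼 ω : ι → P, (∑ i, f (ω i) - Fintype.card ι * 𝔼 a, f a) ^ 2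
      = Fintype.card ι * 𝔼 a, (f a - 𝔼 a, f a) ^ 2 := by
  set m := 𝔼 a, f a with hm
  have h0 : 𝔼 a, (f a - m) = 0 := by
    rw [expect_sub_distrib, Fintype.expect_const, hm, sub_self]
  have h1 : ∀ ω : ι → P, (∑ i, f (ω i) - Fintype.card ι * m) ^ 2
      = ∑ i, ∑ j, (f (ω i) - m) * (f (ω j) - m) := fun ω => by
    rw [← sum_mul_sum, ← sq, sum_sub_distrib]; simp
  simp only [h1]
  rw [expect_sum_comm]
  have h2 : ∀ i, 𝔼 ω : ι → P, ∑ j, (f (ω i) - m) * (f (ω j) - m) = 𝔼 a, (f a - m) ^ 2 := by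
    intro i
    rw [expect_sum_comm, sum_eq_single i]
    · simp only [← sq]
      exact expect_eval (fun a => (f a - m) ^ 2) i
    -- A mixed product is centred, as seen by redrawing the coordinate `i`.
    · intro j _ hji
      rw [expect_resample _ i]
      refine expect_eq_zero fun ω _ => ?_
      simp only [Function.update_self, Function.update_of_ne hji]
      rw [← expect_mul, h0, zero_mul]
    · simp
  simp [h2]

/-- Chebyshev's inequality for a sum of i.i.d. terms. -/
lemma freq_abs_sum_sub_le (f : P → ℝ) {a : ℝ} (ha : 0 < a) :
    freq (fun ω : ι → P => a ≤ |∑ i, f (ω i) - Fintype.card ι * 𝔼 x, f x|)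
      ≤ Fintype.card ι * (𝔼 x, (f x - 𝔼 x, f x) ^ 2) / a ^ 2 := by
  rw [← expect_sum_sub_sq]
  refine le_trans (freq_mono ?_) (freq_lt_le_expect_div (fun ω => sq_nonneg _) (by positivity))
  intro ω h
  rw [← sq_abs (_ - _)]
  exact pow_le_pow_left₀ ha.le h 2

/-- The mean minimizes the mean square distance. -/
lemma expect_sub_mean_sq_le (f : P → ℝ) (c : ℝ) :
    𝔼 x, (f x - 𝔼 x, f x) ^ 2 ≤ 𝔼 x, (f x - c) ^ 2 := by
  set m := 𝔼 a, f a with hm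
  have h0 : 𝔼 a, (f a - m) = 0 := by
    rw [expect_sub_distrib, Fintype.expect_const, hm, sub_self]
  have : 𝔼 x, (f x - c) ^ 2 = 𝔼 x, (f x - m) ^ 2 + (m - c) ^ 2 := by
    have : ∀ x, (f x - c) ^ 2 = (f x - m) ^ 2 + (2 * (m - c) * (f x - m) + (m - c) ^ 2) :=
      fun x => by ring
    simp only [this, expect_add_distrib, ← mul_expect, h0, Fintype.expect_const]; ring
  rw [this]; nlinarith [sq_nonneg (m - c)]

end Resample

/-! ### A uniformly random set of keys -/

section RandomSet

variable {n : ℕ}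

/-- The halves of the uniform law on sets that contain `x` and that do not contain `x`. -/
lemma expect_insert_erase (x : Fin n) (f : Finset (Fin n) → ℝ) :
    𝔼 U, f U = (1 / 2) * 𝔼 U : Finset (Fin n), (f (insert x U) + f (U.erase x)) := by
  let e : Finset (Fin n) ≃ Finset (Fin n) :=
    { toFun := fun U => if x ∈ U then U.erase x else insert x U
      invFun := fun U => if x ∈ U then U.erase x else insert x U
      left_inv := fun U => by by_cases h : x ∈ U <;> simp [h]
      right_inv := fun U => by by_cases h : x ∈ U <;> simp [h] }
  have h : 𝔼 U, f U = 𝔼 U, f (e U) := (Fintype.expect_equiv e _ _ fun U => rfl).symm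
  have h2 : 𝔼 U, f U = (1 / 2) * (𝔼 U, f U + 𝔼 U, f (e U)) := by rw [← h]; ring
  rw [h2, ← expect_add_distrib]
  congr 1
  refine expect_congr rfl fun U _ => ?_
  by_cases hx : x ∈ U
  · simp [e, hx]
  · simp [e, hx, add_comm]

lemma expect_mem_mul (x : Fin n) (f : Finset (Fin n) → ℝ) :
    𝔼 U : Finset (Fin n), (if x ∈ U then f U else 0) = (1 / 2) * 𝔼 U, f (insert x U) := by
  rw [expect_insert_erase x]; simp

lemma expect_erase (x : Fin n) (f : Finset (Fin n) → ℝ) :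
    𝔼 U : Finset (Fin n), (if x ∈ U then 0 else f U) = (1 / 2) * 𝔼 U : Finset (Fin n), f (U.erase x) := by
  rw [expect_insert_erase x]; simp

/-- The generating function of the size of a random set of keys. -/
lemma expect_pow_card (z : ℝ) :
    𝔼 U : Finset (Fin n), z ^ U.card = ((1 + z) / 2) ^ n := by
  rw [Fintype.expect_eq_sum_div_card]
  have := Fintype.sum_pow_mul_eq_add_pow (Fin n) z 1
  simp only [one_pow, mul_one, Fintype.card_fin] at this
  rw [this, Fintype.card_finset, Fintype.card_fin, div_pow, add_comm]; norm_num

lemma expect_card (S : Finset (Fin n)) :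
    𝔼 U : Finset (Fin n), ((U ∩ S).card : ℝ) = S.card / 2 := by
  have : ∀ U : Finset (Fin n), ((U ∩ S).card : ℝ) = ∑ x ∈ S, if x ∈ U then (1 : ℝ) else 0 := by
    intro U
    rw [sum_boole]; congr 2; ext; simp [and_comm]
  simp only [this]
  rw [expect_sum_comm]
  simp only [expect_mem_mul _ (fun _ => (1 : ℝ)), Fintype.expect_const]
  simp; ring

/-- Sets of keys as vectors of coins. -/
def setEquiv (n : ℕ) : (Fin n → Bool) ≃ Finset (Fin n) where
  toFun b := univ.filter fun x => b x = true
  invFun U x := decide (x ∈ U)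
  left_inv b := by ext x; simp
  right_inv U := by ext x; simp

/-- The variance of the size of a random set of keys. -/
lemma expect_sub_two_card_sq : 𝔼 U : Finset (Fin n), ((n : ℝ) - 2 * U.card) ^ 2 = (n : ℝ) := by
  have h := expect_sum_sub_sq (ι := Fin n) (P := Bool) (fun b => if b then (2 : ℝ) else 0)
  have h1 : 𝔼 a : Bool, (if a = true then (2 : ℝ) else 0) = 1 := by
    rw [Fintype.expect_eq_sum_div_card]; simp
  have h2 : 𝔼 a : Bool, ((if a = true then (2 : ℝ) else 0) - 1) ^ 2 = 1 := by
    rw [Fintype.expect_eq_sum_div_card]; simp; norm_num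
  rw [h1, h2] at h
  simp only [Fintype.card_fin, mul_one] at h
  refine Eq.trans (Fintype.expect_equiv (setEquiv n) _ _ fun b => ?_).symm h
  simp only [setEquiv, Equiv.coe_fn_mk]
  rw [← sum_filter, sum_const, nsmul_eq_mul]; ring

/-- A Chernoff bound for the size of a random set of keys. -/
lemma freq_card_lt_le : freq (fun U : Finset (Fin n) => (U.card : ℝ) < n / 4)
    ≤ Real.exp (-(n / 8)) := by
  have h1 : freq (fun U : Finset (Fin n) => (U.card : ℝ) < n / 4)
      ≤ 𝔼 U : Finset (Fin n), Real.exp (n / 4) * Real.exp (-1) ^ U.card := by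
    refine expect_le_expect fun U _ => ?_
    rw [← Real.exp_nat_mul, ← Real.exp_add]
    split_ifs with h
    · exact Real.one_le_exp (by linarith)
    · positivity
  refine h1.trans ?_
  rw [← mul_expect, expect_pow_card]
  have h2 : (1 + Real.exp (-1)) / 2 ≤ Real.exp (-(3 / 8)) := by
    -- `(1 + e⁻¹) / 2 = e^{-1/2} cosh (1/2)` and `cosh x ≤ e^{x²/2}`.
    have := Real.cosh_le_exp_half_sq (1 / 2)
    have h3 : (1 + Real.exp (-1)) / 2 = Real.exp (-(1 / 2)) * Real.cosh (1 / 2) := by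
      rw [Real.cosh_eq, mul_div_assoc', mul_add, ← Real.exp_add, ← Real.exp_add]; norm_num
    rw [h3]
    calc _ ≤ Real.exp (-(1 / 2)) * Real.exp ((1 / 2) ^ 2 / 2) := by gcongr
      _ = Real.exp (-(3 / 8)) := by rw [← Real.exp_add]; norm_num
  calc _ ≤ Real.exp (n / 4) * Real.exp (-(3 / 8)) ^ n := by gcongr
    _ = Real.exp (-(n / 8)) := by rw [← Real.exp_nat_mul, ← Real.exp_add]; congr 1; ring

lemma freq_card_lt_le_sq (hn : 0 < n) :
    freq (fun U : Finset (Fin n) => (U.card : ℝ) < n / 4) ≤ 128 / (n : ℝ) ^ 2 := by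
  refine freq_card_lt_le.trans ?_
  have h := Real.quadratic_le_exp_of_nonneg (x := (n : ℝ) / 8) (by positivity)
  have hn' : (0 : ℝ) < n := by exact_mod_cast hn
  rw [Real.exp_neg, inv_le_comm₀ (Real.exp_pos _) (by positivity), inv_div]
  refine le_trans ?_ h
  have : (n : ℝ) ^ 2 / 128 = (n / 8 : ℝ) ^ 2 / 2 := by ring
  rw [this]
  have : (0 : ℝ) ≤ n / 8 := by positivity
  linarith

end RandomSet

/-! ### Query patterns of keys -/

section Pattern

variable {n r : ℕ}

/-- The set of the queries that contain the key `x`. -/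
def pat (q : Fin r → Finset (Fin n)) (x : Fin n) : Finset (Fin r) := univ.filter fun i => x ∈ q i

/-- The queries `q` with the pattern of the key `x` replaced by `P`. -/
def setPat (q : Fin r → Finset (Fin n)) (x : Fin n) (P : Finset (Fin r)) :
    Fin r → Finset (Fin n) :=
  fun i => if i ∈ P then insert x (q i) else (q i).erase x

@[simp] lemma mem_pat {q : Fin r → Finset (Fin n)} {x : Fin n} {i : Fin r} :
    i ∈ pat q x ↔ x ∈ q i := by simp [pat]

lemma mem_setPat {q : Fin r → Finset (Fin n)} {x y : Fin n} {P : Finset (Fin r)} {i : Fin r} :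
    y ∈ setPat q x P i ↔ if y = x then i ∈ P else y ∈ q i := by
  unfold setPat
  by_cases hy : y = x <;> by_cases hi : i ∈ P <;> simp [hy, hi]

@[simp] lemma pat_setPat_self (q : Fin r → Finset (Fin n)) (x : Fin n) (P : Finset (Fin r)) :
    pat (setPat q x P) x = P := by ext i; simp [mem_setPat]

lemma pat_setPat_of_ne (q : Fin r → Finset (Fin n)) {x y : Fin n} (P : Finset (Fin r))
    (h : y ≠ x) : pat (setPat q x P) y = pat q y := by ext i; simp [mem_setPat, h]

/-- A family of queries is the same as a family of patterns. -/
def patEquiv (n r : ℕ) : (Fin r → Finset (Fin n)) ≃ (Fin n → Finset (Fin r)) where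
  toFun q := pat q
  invFun c := pat c
  left_inv q := by ext i x; simp
  right_inv c := by ext x i; simp

/-- Redrawing the pattern of one key does not change the law of the queries. -/
lemma expect_setPat (f : (Fin r → Finset (Fin n)) → ℝ) (x : Fin n) :
    𝔼 q, f q = 𝔼 q : Fin r → Finset (Fin n), 𝔼 P : Finset (Fin r), f (setPat q x P) := by
  have h := expect_resample (fun c : Fin n → Finset (Fin r) => f ((patEquiv n r).symm c)) x
  rw [Fintype.expect_equiv (patEquiv n r) f (fun c => f ((patEquiv n r).symm c))
    (fun q => by rw [Equiv.symm_apply_apply]), h]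
  refine (Fintype.expect_equiv (patEquiv n r) _ _ fun q => ?_).symm
  refine expect_congr rfl fun P _ => ?_
  congr 1
  apply (patEquiv n r).injective
  rw [Equiv.apply_symm_apply]
  ext y i
  by_cases hy : y = x
  · subst hy; simp [patEquiv]
  · simp [patEquiv, mem_setPat, hy]

/-- The pattern of `x` is uniform given the patterns of the other keys, so it rarely falls in a
small set of patterns that they determine. -/
lemma freq_mem_le {x : Fin n} {S : (Fin r → Finset (Fin n)) → Finset (Finset (Fin r))} {ε : ℝ}
    (hS : ∀ q P, S (setPat q x P) = S q) (hc : ∀ q, ((S q).card : ℝ) ≤ ε * 2 ^ r) :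
    freq (fun q : Fin r → Finset (Fin n) => pat q x ∈ S q) ≤ ε := by
  unfold freq
  rw [expect_setPat _ x]
  calc _ ≤ 𝔼 _q : Fin r → Finset (Fin n), ε := ?_
    _ = ε := Fintype.expect_const ε
  refine expect_le_expect fun q _ => ?_
  simp only [pat_setPat_self, hS]
  rw [Fintype.expect_eq_sum_div_card, div_le_iff₀ (by positivity), sum_boole]
  simpa using hc q

/-- Each further key of `X`, in the order of `key`, avoids its set of patterns with conditional
probability at most `1 - p` given the patterns of the previous keys. -/
lemma freq_forall_notMem_le {X : Finset (Fin n)} {key : Fin n → ℝ}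
    {S : Fin n → (Fin r → Finset (Fin n)) → Finset (Finset (Fin r))}
    {E : (Fin r → Finset (Fin n)) → Prop} {p : ℝ} (hp1 : p ≤ 1)
    (hS : ∀ x ∈ X, ∀ z ∈ X, key x ≤ key z → ∀ q P, S x (setPat q z P) = S x q)
    (hE : ∀ z ∈ X, ∀ q P, E (setPat q z P) ↔ E q)
    (hc : ∀ x ∈ X, ∀ q, E q → p * 2 ^ r ≤ ((S x q).card : ℝ)) :
    freq (fun q : Fin r → Finset (Fin n) => E q ∧ ∀ x ∈ X, pat q x ∉ S x q)
      ≤ (1 - p) ^ X.card := by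
  -- The key that comes last is redrawn: none of the sets `S x` depends on its pattern, by `hS`,
  -- and the condition on the previous keys does not depend on it either.
  induction X using Finset.induction_on_max_value key with
  | empty => simpa using freq_le_one _
  | insert a s ha hmax ih =>
    have ih' := ih (fun x hx z hz => hS x (mem_insert_of_mem hx) z (mem_insert_of_mem hz))
      (fun z hz => hE z (mem_insert_of_mem hz)) (fun x hx => hc x (mem_insert_of_mem hx))
    rw [card_insert_of_notMem ha, pow_succ]
    refine le_trans ?_ (mul_le_mul_of_nonneg_right ih' (by linarith))
    unfold freq
    rw [expect_setPat _ a, expect_mul]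
    refine expect_le_expect fun q _ => ?_
    have hne : ∀ x ∈ s, x ≠ a := fun x hx h => ha (h ▸ hx)
    have key1 : ∀ P, ((E (setPat q a P) ∧ ∀ x ∈ insert a s,
        pat (setPat q a P) x ∉ S x (setPat q a P)) ↔
        ((E q ∧ ∀ x ∈ s, pat q x ∉ S x q) ∧ P ∉ S a q)) := by
      intro P
      rw [hE a (mem_insert_self a s), forall_mem_insert, pat_setPat_self,
        hS a (mem_insert_self a s) a (mem_insert_self a s) le_rfl]
      have : (∀ x ∈ s, pat (setPat q a P) x ∉ S x (setPat q a P)) ↔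
          ∀ x ∈ s, pat q x ∉ S x q := by
        refine forall₂_congr fun x hx => ?_
        rw [pat_setPat_of_ne q P (hne x hx),
          hS x (mem_insert_of_mem hx) a (mem_insert_self a s) (hmax x hx)]
      rw [this]; tauto
    simp only [key1]
    by_cases h : E q ∧ ∀ x ∈ s, pat q x ∉ S x q
    · rw [if_pos h, one_mul]
      have h2 : freq (fun P : Finset (Fin r) => P ∈ S a q) ≥ p := by
        rw [freq_eq_card_div, ge_iff_le, le_div_iff₀ (by positivity)]
        simpa using hc a (mem_insert_self a s) q h.1
      have h3 := freq_not (fun P : Finset (Fin r) => P ∈ S a q)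
      have h4 : freq (fun P : Finset (Fin r) =>
          (E q ∧ ∀ x ∈ s, pat q x ∉ S x q) ∧ P ∉ S a q) ≤ freq (fun P => P ∉ S a q) :=
        freq_mono fun P hP => hP.2
      refine le_trans ?_ (h4.trans (by rw [h3]; linarith))
      exact expect_le_expect fun P _ => le_of_eq (by congr)
    · simp [h]

end Pattern

/-! ### Keys with low average response -/

section Average

variable {n r : ℕ}

/-- The average of the responses `v` over the queries in `P` (`0` if there are none). -/
def avgOn (v : Fin r → ℝ) (P : Finset (Fin r)) : ℝ := (∑ i ∈ P, v i) / P.card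

lemma sum_sub_nonpos_of_avgOn_lt {v : Fin r → ℝ} {P : Finset (Fin r)} {a : ℝ}
    (h : avgOn v P < a) : ∑ i ∈ P, (v i - a) ≤ 0 := by
  rcases P.eq_empty_or_nonempty with rfl | hP
  · simp
  · have : (0 : ℝ) < P.card := by exact_mod_cast hP.card_pos
    rw [avgOn, div_lt_iff₀ this] at h
    rw [sum_sub_distrib, sum_const, nsmul_eq_mul]; linarith

lemma sum_sub_nonneg_of_le_avgOn {v : Fin r → ℝ} {P : Finset (Fin r)} {a : ℝ}
    (h : a ≤ avgOn v P) : 0 ≤ ∑ i ∈ P, (v i - a) := by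
  rcases P.eq_empty_or_nonempty with rfl | hP
  · simp
  · have : (0 : ℝ) < P.card := by exact_mod_cast hP.card_pos
    rw [avgOn, le_div_iff₀ this] at h
    rw [sum_sub_distrib, sum_const, nsmul_eq_mul]; linarith

lemma avgOn_mono {v w : Fin r → ℝ} (h : ∀ i, v i ≤ w i) (P : Finset (Fin r)) :
    avgOn v P ≤ avgOn w P :=
  div_le_div_of_nonneg_right (sum_le_sum fun i _ => h i) (by positivity)

lemma avgOn_congr {v w : Fin r → ℝ} {P : Finset (Fin r)} (h : ∀ i ∈ P, v i = w i) :
    avgOn v P = avgOn w P := by rw [avgOn, avgOn, sum_congr rfl h]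

lemma sum_pat (q : Fin r → Finset (Fin n)) (x : Fin n) (f : Finset (Fin n) → ℝ) :
    ∑ i ∈ pat q x, f (q i) = ∑ i, if x ∈ q i then f (q i) else 0 := by
  rw [pat, sum_filter]

/-- The variance of the contribution of one query to `∑ i ∈ pat q x, (t (q i) - (μ - δ))`, where
`μ` is the mean response. -/
lemma expect_sq_ite_le (t : Finset (Fin n) → ℝ) (δ : ℝ) (x : Fin n) :
    𝔼 U, ((if x ∈ U then t U - (𝔼 U, t U - δ) else 0)
        - 𝔼 U, (if x ∈ U then t U - (𝔼 U, t U - δ) else 0)) ^ 2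
      ≤ 𝔼 U, (t U - 𝔼 U, t U) ^ 2 + δ ^ 2 := by
  refine (expect_sub_mean_sq_le _ 0).trans ?_
  set μ := 𝔼 U, t U with hμ
  calc _ ≤ 𝔼 U, (t U - (μ - δ)) ^ 2 := by
        refine expect_le_expect fun U _ => ?_
        split_ifs
        · simp
        · simpa using sq_nonneg _
    _ = 𝔼 U, ((t U - μ) ^ 2 + (2 * δ * (t U - μ) + δ ^ 2)) :=
        expect_congr rfl fun U _ => by ring
    _ = 𝔼 U, (t U - μ) ^ 2 + δ ^ 2 := by
        rw [expect_add_distrib, expect_add_distrib, ← mul_expect, expect_sub_distrib,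
          Fintype.expect_const, Fintype.expect_const, ← hμ]; ring

/-- A key that does not influence the response rarely has an average response below the mean. -/
lemma freq_sum_nonpos_le {t : Finset (Fin n) → ℝ} {x : Fin n}
    (hx : ∀ U, t (insert x U) = t U) {δ : ℝ} (hδ : 0 < δ) (hr : 0 < r) :
    freq (fun q : Fin r → Finset (Fin n) => ∑ i ∈ pat q x, (t (q i) - (𝔼 U, t U - δ)) ≤ 0)
      ≤ 4 * (𝔼 U, (t U - 𝔼 U, t U) ^ 2 + δ ^ 2) / (r * δ ^ 2) := by
  set μ := 𝔼 U, t U with hμ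
  have hr' : (0 : ℝ) < r := by exact_mod_cast hr
  set Y : Finset (Fin n) → ℝ := fun U => if x ∈ U then t U - (μ - δ) else 0 with hY
  -- Without influence, the mean of the response is `μ` given `x ∈ U` as well.
  have hm : 𝔼 U, Y U = δ / 2 := by
    rw [hY, expect_mem_mul x (fun U => t U - (μ - δ))]
    simp only [hx]
    rw [expect_sub_distrib, Fintype.expect_const, ← hμ]; ring
  have hch := freq_abs_sum_sub_le (ι := Fin r) Y (a := r * (δ / 2)) (by positivity)
  refine le_trans (freq_mono ?_) (hch.trans ?_)
  · intro q hq
    have := sum_pat q x (fun U => t U - (μ - δ))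
    rw [this] at hq
    rw [hm, Fintype.card_fin, abs_of_nonpos] <;> · simp only [hY]; nlinarith
  · have := expect_sq_ite_le t δ x
    rw [← hμ] at this
    rw [Fintype.card_fin]
    calc _ ≤ r * (𝔼 U, (t U - μ) ^ 2 + δ ^ 2) / (r * (δ / 2)) ^ 2 := by gcongr
      _ = _ := by field_simp; ring

/-- A key of large influence `Δ` on the response mostly has an average response well below the
mean. -/
lemma freq_sum_nonneg_le {t : Finset (Fin n) → ℝ} {y : Fin n} {δ Δ : ℝ} (hδ : 0 < δ)
    (hΔ : Δ ≤ 𝔼 U : Finset (Fin n), (t (U.erase y) - t (insert y U))) (hδΔ : 4 * δ ≤ Δ)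
    (hr : 0 < r) :
    freq (fun q : Fin r → Finset (Fin n) => 0 ≤ ∑ i ∈ pat q y, (t (q i) - (𝔼 U, t U - δ)))
      ≤ 64 * (𝔼 U, (t U - 𝔼 U, t U) ^ 2 + δ ^ 2) / (r * Δ ^ 2) := by
  set μ := 𝔼 U, t U with hμ
  have hr' : (0 : ℝ) < r := by exact_mod_cast hr
  have hΔ0 : 0 < Δ := by linarith
  set Y : Finset (Fin n) → ℝ := fun U => if y ∈ U then t U - (μ - δ) else 0 with hY
  -- Given `y ∈ U`, the mean of the response is at most `μ - Δ / 2`, which is below `μ - δ` by at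
  -- least `Δ / 4`.
  have hm : 𝔼 U, Y U ≤ -(Δ / 8) := by
    have h1 : μ = (1 / 2) * 𝔼 U : Finset (Fin n), (t (insert y U) + t (U.erase y)) :=
      expect_insert_erase y t
    rw [expect_add_distrib] at h1
    rw [expect_sub_distrib] at hΔ
    rw [hY, expect_mem_mul y (fun U => t U - (μ - δ)), expect_sub_distrib, Fintype.expect_const]
    linarith
  have hch := freq_abs_sum_sub_le (ι := Fin r) Y (a := r * (Δ / 8)) (by positivity)
  refine le_trans (freq_mono ?_) (hch.trans ?_)
  · intro q hq
    have := sum_pat q y (fun U => t U - (μ - δ))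
    rw [this] at hq
    have h2 : (r : ℝ) * 𝔼 U, Y U ≤ r * -(Δ / 8) := by gcongr
    rw [Fintype.card_fin]
    refine le_trans ?_ (le_abs_self _)
    simp only [hY] at *
    linarith
  · have := expect_sq_ite_le t δ y
    rw [← hμ] at this
    rw [Fintype.card_fin]
    calc _ ≤ r * (𝔼 U, (t U - μ) ^ 2 + δ ^ 2) / (r * (Δ / 8)) ^ 2 := by gcongr
      _ = _ := by field_simp; ring

end Average

/-! ### Anti-concentration of averages over random patterns -/

/-- The central binomial coefficient is at most `4 ^ j / √(2 j + 1)`, in a form without the root.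
-/
lemma centralBinom_sq_le (j : ℕ) : (j.centralBinom : ℝ) ^ 2 * (2 * j + 1) ≤ (4 ^ j) ^ 2 := by
  induction j with
  | zero => simp
  | succ j ih =>
    have h : ((j : ℝ) + 1) * (j + 1).centralBinom = 2 * (2 * j + 1) * j.centralBinom := by
      exact_mod_cast Nat.succ_mul_centralBinom_succ j
    have hj : (0 : ℝ) < (j + 1 : ℝ) ^ 2 := by positivity
    refine le_of_mul_le_mul_left ?_ hj
    have e1 : ((j : ℝ) + 1) ^ 2 * (((j + 1).centralBinom : ℝ) ^ 2 * (2 * (j + 1 : ℕ) + 1))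
        = ((j.centralBinom : ℝ) ^ 2 * (2 * j + 1)) * (4 * (2 * j + 1) * (2 * j + 3)) := by
      have : ((j : ℝ) + 1) ^ 2 * (((j + 1).centralBinom : ℝ) ^ 2 * (2 * (j + 1 : ℕ) + 1))
        = (((j : ℝ) + 1) * (j + 1).centralBinom) ^ 2 * (2 * j + 3) := by push_cast; ring
      rw [this, h]; ring
    rw [e1]
    calc _ ≤ ((4 : ℝ) ^ j) ^ 2 * (4 * (2 * j + 1) * (2 * j + 3)) := by gcongr
      _ ≤ ((4 : ℝ) ^ j) ^ 2 * (16 * (j + 1) ^ 2) :=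
          mul_le_mul_of_nonneg_left (by nlinarith) (by positivity)
      _ = _ := by ring

section Atoms

variable {r : ℕ}

lemma sum_sub_eq_zero_of_avgOn_eq {v : Fin r → ℝ} {P : Finset (Fin r)} {s : ℝ}
    (h : avgOn v P = s) : ∑ i ∈ P, (v i - s) = 0 := by
  rcases P.eq_empty_or_nonempty with rfl | hP
  · simp
  · have : (P.card : ℝ) ≠ 0 := by exact_mod_cast hP.card_pos.ne'
    rw [avgOn, div_eq_iff this] at h
    rw [sum_sub_distrib, sum_const, nsmul_eq_mul]; linarith

/-- The Littlewood-Offord bound: among the patterns with given queries outside `J`, those whose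
average is `s` form an antichain, because each query of `J` moves the sum in the same direction. -/
lemma card_avgOn_eq_le_choose {v : Fin r → ℝ} {s σ : ℝ} {J : Finset (Fin r)}
    (hJ : ∀ i ∈ J, 0 < σ * (v i - s)) :
    (univ.filter fun P : Finset (Fin r) => avgOn v P = s).card
      ≤ J.card.choose (J.card / 2) * 2 ^ (r - J.card) := by
  have hcard : ((univ \ J).powerset).card = 2 ^ (r - J.card) := by
    rw [card_powerset, card_sdiff_of_subset (subset_univ J)]; simp
  rw [← hcard]
  refine card_le_mul_card_image_of_maps_to (f := fun P => P \ J) ?_ _ ?_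
  · intro P _
    exact mem_powerset.2 (sdiff_subset_sdiff (subset_univ P) le_rfl)
  -- The patterns with the part `R` outside `J` are compared by their parts inside `J`; these form
  -- an antichain, to which Sperner's theorem applies.
  · intro R _
    set F := (univ.filter fun P : Finset (Fin r) => avgOn v P = s).filter fun P => P \ J = R
    have hF : ∀ P ∈ F, ∑ i ∈ P, (v i - s) = 0 ∧ P \ J = R := fun P hP => by
      rw [mem_filter, mem_filter] at hP
      exact ⟨sum_sub_eq_zero_of_avgOn_eq hP.1.2, hP.2⟩
    have hsub : ∀ P ∈ F, ∀ P' ∈ F, P ∩ J ⊆ P' ∩ J → P = P' := by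
      intro P hP P' hP' hPP
      have hPsub : P ⊆ P' := by
        intro i hi
        by_cases hiJ : i ∈ J
        · exact (mem_inter.1 (hPP (mem_inter.2 ⟨hi, hiJ⟩))).1
        · have : i ∈ P' \ J := by
            rw [(hF P' hP').2, ← (hF P hP).2]; exact mem_sdiff.2 ⟨hi, hiJ⟩
          exact (mem_sdiff.1 this).1
      by_contra hne
      have hne2 : (P' \ P).Nonempty := by
        rw [sdiff_nonempty]; exact fun h => hne (subset_antisymm hPsub h)
      have hd : ∑ i ∈ P' \ P, (v i - s) = 0 := by
        have := sum_sdiff (f := fun i => v i - s) hPsub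
        rw [(hF P hP).1, (hF P' hP').1] at this
        simpa using this
      have hpos : 0 < ∑ i ∈ P' \ P, σ * (v i - s) := by
        refine sum_pos (fun i hi => hJ i ?_) hne2
        rw [mem_sdiff] at hi
        by_contra hiJ
        have : i ∈ P \ J := by
          rw [(hF P hP).2, ← (hF P' hP').2]; exact mem_sdiff.2 ⟨hi.1, hiJ⟩
        exact hi.2 (mem_sdiff.1 this).1
      rw [← mul_sum, hd, mul_zero] at hpos
      exact lt_irrefl _ hpos
    set G : Finset (Finset J) := F.image fun P => P.subtype (· ∈ J) with hG
    have hmem : ∀ P P' : Finset (Fin r), P.subtype (· ∈ J) ⊆ P'.subtype (· ∈ J) →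
        P ∩ J ⊆ P' ∩ J := by
      intro P P' h i hi
      rw [mem_inter] at hi ⊢
      have := @h ⟨i, hi.2⟩ (by simpa using hi.1)
      exact ⟨by simpa using this, hi.2⟩
    have hinj : Set.InjOn (fun P : Finset (Fin r) => P.subtype (· ∈ J)) F := by
      intro P hP P' hP' h
      exact hsub P hP P' hP' (hmem P P' (by simpa using h.le))
    rw [← card_image_of_injOn hinj]
    have hanti : IsAntichain (· ⊆ ·) (G : Set (Finset J)) := by
      intro A hA B hB hAB hle
      rw [hG, mem_coe, mem_image] at hA hB
      obtain ⟨P, hP, rfl⟩ := hA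
      obtain ⟨P', hP', rfl⟩ := hB
      exact hAB (by rw [hsub P hP P' hP' (hmem P P' hle)])
    simpa using hanti.sperner

/-- A value `s` that at most three quarters of the responses take is the average over a proportion
at most `p` of the patterns, once `r ≥ 8 / p²`. -/
lemma card_avgOn_eq_le {v : Fin r → ℝ} {s p : ℝ} (hp : 0 < p) (hr : 8 ≤ p ^ 2 * r)
    (hv : ((univ.filter fun i => v i = s).card : ℝ) ≤ 3 / 4 * r) :
    ((univ.filter fun P : Finset (Fin r) => avgOn v P = s).card : ℝ) ≤ p * 2 ^ r := by
  have hsplit : ((univ.filter fun i => s < v i).card : ℝ) + (univ.filter fun i => v i < s).card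
      ≥ r / 4 := by
    have h1 : (univ : Finset (Fin r)) = (univ.filter fun i => v i = s) ∪
        ((univ.filter fun i => s < v i) ∪ (univ.filter fun i => v i < s)) := by
      ext i; rcases lt_trichotomy (v i) s with h | h | h <;> simp [h]
    have h2 := congrArg card h1
    rw [card_univ, Fintype.card_fin] at h2
    have h3 := card_union_le (univ.filter fun i => v i = s)
      ((univ.filter fun i => s < v i) ∪ (univ.filter fun i => v i < s))
    have h4 := card_union_le (univ.filter fun i => s < v i) (univ.filter fun i => v i < s)
    have h5 : (r : ℝ) ≤ (univ.filter fun i => v i = s).card +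
      ((univ.filter fun i => s < v i).card + (univ.filter fun i => v i < s).card) := by
      exact_mod_cast (h2.le.trans h3).trans (by gcongr)
    linarith
  -- At least a quarter of the responses differ from `s`, so at least an eighth of them lie on one
  -- side of `s`.
  obtain ⟨I, σ, hI, hIc⟩ : ∃ (I : Finset (Fin r)) (σ : ℝ), (∀ i ∈ I, 0 < σ * (v i - s)) ∧
      (r : ℝ) / 8 ≤ I.card := by
    by_cases h : (r : ℝ) / 8 ≤ (univ.filter fun i => s < v i).card
    · exact ⟨_, 1, fun i hi => by simpa using hi, h⟩
    · refine ⟨univ.filter fun i => v i < s, -1, fun i hi => ?_, by linarith⟩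
      have := (mem_filter.1 hi).2; linarith
  -- An even number of queries makes the binomial coefficient of Sperner's theorem a central one.
  obtain ⟨J, hJI, hJc⟩ := exists_subset_card_eq (s := I) (n := 2 * (I.card / 2)) (by omega)
  set j := I.card / 2 with hj
  have h1 := card_avgOn_eq_le_choose (v := v) (s := s) (σ := σ) (J := J)
    fun i hi => hI i (hJI hi)
  rw [hJc, Nat.mul_div_cancel_left j two_pos, ← Nat.centralBinom_eq_two_mul_choose] at h1
  have hJr : 2 * j ≤ r := by
    have := card_le_univ J; rw [hJc] at this; simpa using this
  have h2 : (2 : ℝ) ^ r = 4 ^ j * 2 ^ (r - 2 * j) := by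
    rw [show (4 : ℝ) = 2 ^ 2 by norm_num, ← pow_mul, ← pow_add]; congr 1; omega
  have h3 : (j.centralBinom : ℝ) ≤ p * 4 ^ j := by
    have hc := centralBinom_sq_le j
    have hI2 : (I.card : ℝ) ≤ 2 * j + 1 := by
      have : I.card ≤ 2 * j + 1 := by omega
      exact_mod_cast this
    have h4 : 1 ≤ p ^ 2 * (2 * j + 1) := by
      calc (1 : ℝ) ≤ p ^ 2 * (r / 8) := by linarith
        _ ≤ p ^ 2 * (2 * j + 1) := by gcongr; linarith
    have hpos : (0 : ℝ) < 2 * j + 1 := by positivity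
    refine le_of_sq_le_sq ?_ (by positivity)
    refine le_of_mul_le_mul_right ?_ hpos
    calc _ ≤ ((4 : ℝ) ^ j) ^ 2 * 1 := by rw [mul_one]; exact hc
      _ ≤ ((4 : ℝ) ^ j) ^ 2 * (p ^ 2 * (2 * j + 1)) := by gcongr
      _ = _ := by ring
  calc _ ≤ (j.centralBinom : ℝ) * 2 ^ (r - 2 * j) := by exact_mod_cast h1
    _ ≤ p * 4 ^ j * 2 ^ (r - 2 * j) := by gcongr
    _ = _ := by rw [h2]; ring

/-- The patterns of lowest average: those for which fewer than `θ` patterns have at most the same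
average. -/
def lowPat (θ : ℝ) (v : Fin r → ℝ) : Finset (Finset (Fin r)) :=
  univ.filter fun P => ((univ.filter fun P' => avgOn v P' ≤ avgOn v P).card : ℝ) < θ

lemma card_lowPat_le {θ : ℝ} (hθ : 0 ≤ θ) (v : Fin r → ℝ) : ((lowPat θ v).card : ℝ) ≤ θ := by
  rcases (lowPat θ v).eq_empty_or_nonempty with h | h
  · simpa [h] using hθ
  · obtain ⟨P, hP, hmax⟩ := exists_max_image (lowPat θ v) (avgOn v) h
    refine le_trans ?_ (mem_filter.1 hP).2.le
    exact_mod_cast card_le_card fun P' hP' => by simpa using hmax P' hP'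

/-- Up to the largest atom of the averages, `lowPat θ v` has at least `θ` patterns. -/
lemma le_card_lowPat {θ p : ℝ} {v : Fin r → ℝ} (hθ : θ ≤ 2 ^ r) (hp : 0 ≤ p)
    (ha : ∀ s, ((univ.filter fun P => avgOn v P = s).card : ℝ) ≤ p) :
    θ - p ≤ (lowPat θ v).card := by
  rcases (univ \ lowPat θ v).eq_empty_or_nonempty with h | h
  · have : lowPat θ v = univ := by
      rw [sdiff_eq_empty_iff_subset] at h; exact subset_antisymm (subset_univ _) h
    rw [this, card_univ]; simp; linarith
  · obtain ⟨P, hP, hmin⟩ := exists_min_image (univ \ lowPat θ v) (avgOn v) h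
    have h1 : θ ≤ (univ.filter fun P' => avgOn v P' ≤ avgOn v P).card := by
      simpa [lowPat] using hP
    have h2 : (univ.filter fun P' => avgOn v P' ≤ avgOn v P) ⊆
        lowPat θ v ∪ univ.filter fun P' => avgOn v P' = avgOn v P := by
      intro P' hP'
      rw [mem_filter] at hP'
      rw [mem_union, mem_filter]
      by_cases h : P' ∈ lowPat θ v
      · exact Or.inl h
      · exact Or.inr ⟨mem_univ _, le_antisymm hP'.2 (hmin P' (by simp [h]))⟩
    have h3 : ((univ.filter fun P' => avgOn v P' ≤ avgOn v P).card : ℝ) ≤ (lowPat θ v).card +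
        (univ.filter fun P' => avgOn v P' = avgOn v P).card := by
      exact_mod_cast (card_le_card h2).trans (card_union_le _ _)
    linarith [ha (avgOn v P)]

end Atoms

/-! ### The joint law of the hash values and of the queries -/

/-- The law of the coins of `r` queries. -/
def coinLaw (n r : ℕ) : Measure (Fin r → Fin n → Bool) :=
  Measure.pi fun _ : Fin r => Measure.pi fun _ : Fin n => fairCoin

instance : IsProbabilityMeasure fairCoin := by unfold fairCoin; infer_instance

instance (n r : ℕ) : IsProbabilityMeasure (coinLaw n r) := by unfold coinLaw; infer_instance

lemma fairCoin_singleton (b : Bool) : fairCoin {b} = 2⁻¹ := by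
  have h : fairCoin.real {b} = 2⁻¹ := by
    unfold fairCoin
    rw [bernoulliMeasure_real_apply _ (MeasurableSet.singleton b)]
    cases b
    · simp; norm_num
    · simp
  rw [← ENNReal.ofReal_toReal (measure_ne_top fairCoin {b})]
  change ENNReal.ofReal (fairCoin.real {b}) = _
  rw [h, ENNReal.ofReal_inv_of_pos two_pos]; simp

lemma coinLaw_real_singleton {n r : ℕ} (b : Fin r → Fin n → Bool) :
    (coinLaw n r).real {b} = ((2 : ℝ) ^ (n * r))⁻¹ := by
  have h : coinLaw n r {b} = (2⁻¹ : ℝ≥0∞) ^ (n * r) := by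
    rw [coinLaw, Measure.pi_singleton]
    simp only [Measure.pi_singleton, fairCoin_singleton]
    simp [← pow_mul]
  rw [measureReal_def, h]; simp

/-- The query family of a family of coins, as a bijection. -/
def queryEquiv (n r : ℕ) : (Fin r → Fin n → Bool) ≃ (Fin r → Finset (Fin n)) :=
  Equiv.piCongrRight fun _ => setEquiv n

lemma queryEquiv_apply {n r : ℕ} (b : Fin r → Fin n → Bool) : queryEquiv n r b = query b := by
  ext i x; simp [queryEquiv, query, setEquiv]

section Joint

variable {X : Type*} [MeasurableSpace X] {n r : ℕ}

/-- The probability of an event that depends on the hash values, of law `μ`, and on `r` independent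
uniform queries. -/
def jprob (μ : Measure X) (E : X → (Fin r → Finset (Fin n)) → Prop) : ℝ :=
  𝔼 q : Fin r → Finset (Fin n), μ.real {x | E x q}

variable (μ : Measure X)

/-- The law of the coins gives the same mass to all families of queries. -/
lemma real_le_jprob (E : X → (Fin r → Finset (Fin n)) → Prop) :
    (μ.prod (coinLaw n r)).real {ω | E ω.1 (query ω.2)} ≤ jprob μ E := by
  have h1 : {ω : X × (Fin r → Fin n → Bool) | E ω.1 (query ω.2)} =
      ⋃ b ∈ (univ : Finset (Fin r → Fin n → Bool)), {x | E x (query b)} ×ˢ {b} := by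
    ext ⟨x, b⟩; simp
  rw [h1]
  refine (measureReal_biUnion_finset_le _ _).trans (le_of_eq ?_)
  simp only [measureReal_prod_prod, coinLaw_real_singleton]
  rw [jprob, ← Fintype.expect_equiv (queryEquiv n r) (fun b => μ.real {x | E x (query b)}) _
    (fun b => by rw [queryEquiv_apply]), Fintype.expect_eq_sum_div_card, sum_div]
  simp [div_eq_mul_inv, pow_mul]

variable {μ}

lemma jprob_or_le (E F : X → (Fin r → Finset (Fin n)) → Prop) :
    jprob μ (fun x q => E x q ∨ F x q) ≤ jprob μ E + jprob μ F := by
  unfold jprob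
  rw [← expect_add_distrib]
  exact expect_le_expect fun q _ => measureReal_union_le _ _

lemma jprob_exists_le {ι : Type*} (s : Finset ι)
    (E : ι → X → (Fin r → Finset (Fin n)) → Prop) :
    jprob μ (fun x q => ∃ i ∈ s, E i x q) ≤ ∑ i ∈ s, jprob μ (E i) := by
  unfold jprob
  rw [← expect_sum_comm]
  refine expect_le_expect fun q _ => ?_
  have : {x | ∃ i ∈ s, E i x q} = ⋃ i ∈ s, {x | E i x q} := by ext; simp
  rw [this]
  exact measureReal_biUnion_finset_le _ _

lemma jprob_const (p : X → Prop) :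
    jprob μ (fun x (_ : Fin r → Finset (Fin n)) => p x) = μ.real {x | p x} :=
  Fintype.expect_const _

lemma jprob_exists_query_le (p : X → Finset (Fin n) → Prop) :
    jprob μ (fun x (q : Fin r → Finset (Fin n)) => ∃ i ∈ (univ : Finset (Fin r)), p x (q i))
      ≤ r * 𝔼 U : Finset (Fin n), μ.real {x | p x U} := by
  refine (jprob_exists_le univ fun i x q => p x (q i)).trans (le_of_eq ?_)
  simp only [jprob]
  simp only [expect_eval (fun U : Finset (Fin n) => μ.real {x | p x U})]
  simp

variable [IsProbabilityMeasure μ]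

lemma jprob_mono {E F : X → (Fin r → Finset (Fin n)) → Prop} (h : ∀ x q, E x q → F x q) :
    jprob μ E ≤ jprob μ F :=
  expect_le_expect fun q _ => measureReal_mono fun x hx => h x q hx

/-- The joint probability can be computed by first drawing the hash values. -/
lemma jprob_eq_integral_freq {E : X → (Fin r → Finset (Fin n)) → Prop}
    (hE : ∀ q, MeasurableSet {x | E x q}) : jprob μ E = ∫ x, freq (E x) ∂μ := by
  unfold jprob freq
  simp only [Fintype.expect_eq_sum_div_card]
  rw [integral_div, integral_finsetSum]
  · congr 1
    refine sum_congr rfl fun q _ => ?_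
    rw [← integral_indicator_one (hE q)]
    refine integral_congr_ae (.of_forall fun x => ?_)
    simp only [Set.indicator_apply, Set.mem_ofPred_eq, Pi.one_apply]
  · intro q _
    refine (integrable_const (1 : ℝ)).mono' ?_ ?_
    · exact (Measurable.ite (hE q) measurable_const measurable_const).aestronglyMeasurable
    · exact .of_forall fun x => by split_ifs <;> simp

lemma integrable_freq {E : X → (Fin r → Finset (Fin n)) → Prop}
    (hE : ∀ q, MeasurableSet {x | E x q}) : Integrable (fun x => freq (E x)) μ := by
  unfold freq
  simp only [Fintype.expect_eq_sum_div_card]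
  refine Integrable.div_const (integrable_finsetSum _ fun q _ => ?_) _
  refine (integrable_const (1 : ℝ)).mono' ?_ ?_
  · exact (Measurable.ite (hE q) measurable_const measurable_const).aestronglyMeasurable
  · exact .of_forall fun x => by split_ifs <;> simp

lemma jprob_le_of_freq {E : X → (Fin r → Finset (Fin n)) → Prop}
    (hE : ∀ q, MeasurableSet {x | E x q}) {ε : ℝ} (h : ∀ᵐ x ∂μ, freq (E x) ≤ ε) :
    jprob μ E ≤ ε := by
  rw [jprob_eq_integral_freq hE]
  calc _ ≤ ∫ _x, ε ∂μ := integral_mono_ae (integrable_freq hE) (integrable_const ε) h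
    _ = ε := by simp

/-- Markov's inequality for the number of events that occur. -/
lemma real_le_sum_ite_le {ι : Type*} (s : Finset ι) {p : ι → X → Prop}
    (hp : ∀ i ∈ s, MeasurableSet {x | p i x}) {a : ℝ} (ha : 0 < a) :
    μ.real {x | a ≤ ∑ i ∈ s, if p i x then (1 : ℝ) else 0} ≤ (∑ i ∈ s, μ.real {x | p i x}) / a := by
  have hint : ∀ i ∈ s, Integrable (fun x => if p i x then (1 : ℝ) else 0) μ := fun i hi => by
    refine (integrable_const (1 : ℝ)).mono' ?_ ?_
    · exact (Measurable.ite (hp i hi) measurable_const measurable_const).aestronglyMeasurable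
    · exact .of_forall fun x => by split_ifs <;> simp
  rw [le_div_iff₀ ha, mul_comm]
  have h := mul_meas_ge_le_integral_of_nonneg (μ := μ)
    (f := fun x => ∑ i ∈ s, if p i x then (1 : ℝ) else 0)
    (.of_forall fun x => sum_nonneg fun i _ => by split_ifs <;> norm_num)
    (integrable_finsetSum _ hint) a
  refine h.trans (le_of_eq ?_)
  rw [integral_finsetSum _ hint]
  refine sum_congr rfl fun i hi => ?_
  rw [← integral_indicator_one (hp i hi)]
  refine integral_congr_ae (.of_forall fun x => ?_)
  simp only [Set.indicator_apply, Set.mem_ofPred_eq, Pi.one_apply]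

lemma jprob_le_sum_ite_le {ι : Type*} (s : Finset ι)
    {E : ι → X → (Fin r → Finset (Fin n)) → Prop}
    (hE : ∀ i ∈ s, ∀ q, MeasurableSet {x | E i x q}) {a : ℝ} (ha : 0 < a) :
    jprob μ (fun x q => a ≤ ∑ i ∈ s, if E i x q then (1 : ℝ) else 0)
      ≤ (∑ i ∈ s, jprob μ (E i)) / a := by
  unfold jprob
  rw [← expect_sum_comm, expect_div]
  exact expect_le_expect fun q _ => real_le_sum_ite_le s (fun i hi => hE i hi q) ha

end Joint

/-! ### Redrawing one coordinate of a product measure -/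

section PiResample

variable {ι : Type*} [Fintype ι] [DecidableEq ι] {Y : ι → Type*} [∀ i, MeasurableSpace (Y i)]
  {μ : ∀ i, Measure (Y i)} [∀ i, IsProbabilityMeasure (μ i)]

/-- Redrawing one coordinate of an independent family does not change its law. -/
lemma lintegral_resample {f : (∀ i, Y i) → ℝ≥0∞} (hf : Measurable f) (i : ι) :
    ∫⁻ ω, f ω ∂Measure.pi μ
      = ∫⁻ ω, ∫⁻ a, f (Function.update ω i a) ∂μ i ∂Measure.pi μ := by
  have h : ∀ ω, ∫⁻ a, f (Function.update ω i a) ∂μ i = (∫⋯∫⁻_{i}, f ∂μ) ω := fun ω => by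
    rw [lmarginal_singleton]
  simp only [h]
  refine lintegral_eq_of_lmarginal_eq {i} hf (hf.lmarginal μ) ?_
  ext ω
  rw [lmarginal_singleton (∫⋯∫⁻_{i}, f ∂μ)]
  have : ∀ a, (∫⋯∫⁻_{i}, f ∂μ) (Function.update ω i a) = (∫⋯∫⁻_{i}, f ∂μ) ω := fun a =>
    lmarginal_update_of_mem μ (mem_singleton_self i) f ω a
  simp only [this]
  simp

/-- An event has probability at most `ε` if it has conditional probability at most `ε` given all
coordinates but one. -/
lemma real_le_of_resample {p : (∀ i, Y i) → Prop} (hp : MeasurableSet {ω | p ω}) (i : ι) {ε : ℝ}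
    (h : ∀ ω, (μ i).real {a | p (Function.update ω i a)} ≤ ε) :
    (Measure.pi μ).real {ω | p ω} ≤ ε := by
  have hε : 0 ≤ ε := by
    obtain ⟨ω⟩ : Nonempty (∀ i, Y i) := nonempty_of_isProbabilityMeasure (Measure.pi μ)
    exact measureReal_nonneg.trans (h ω)
  refine ENNReal.toReal_le_of_le_ofReal hε ?_
  rw [← lintegral_indicator_one hp, lintegral_resample (measurable_one.indicator hp) i]
  calc _ ≤ ∫⁻ _ω, ENNReal.ofReal ε ∂Measure.pi μ := ?_
    _ = ENNReal.ofReal ε := by simp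
  refine lintegral_mono fun ω => ?_
  have hm : MeasurableSet {a | p (Function.update ω i a)} :=
    (measurable_update ω (a := i)) hp
  have : ∀ a, ({ω | p ω} : Set (∀ i, Y i)).indicator (1 : (∀ i, Y i) → ℝ≥0∞)
      (Function.update ω i a) = ({a | p (Function.update ω i a)} : Set _).indicator 1 a :=
    fun a => by simp [Set.indicator_apply]
  simp only [this]
  rw [lintegral_indicator_one hm, ← ENNReal.ofReal_toReal (measure_ne_top _ _)]
  exact ENNReal.ofReal_le_ofReal (h ω)

end PiResample

/-! ### The laws of the hash values -/

/-- A law of nonnegative hash values with a density that is at most `1`. -/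
class HashLike (ν : Measure ℝ) : Prop extends IsProbabilityMeasure ν where
  le_volume : ν ≤ volume
  nonneg : ∀ᵐ x ∂ν, 0 ≤ x

section HashLike

variable (ν : Measure ℝ) [HashLike ν]

lemma HashLike.measure_singleton (a : ℝ) : ν {a} = 0 :=
  le_antisymm ((HashLike.le_volume _).trans (by simp)) zero_le

lemma HashLike.ae_pos : ∀ᵐ x ∂ν, 0 < x := by
  have h0 : ∀ᵐ x ∂ν, x ≠ 0 := by
    rw [ae_iff]; simpa using HashLike.measure_singleton ν 0
  filter_upwards [h0, HashLike.nonneg (ν := ν)] with x h1 h2 using lt_of_le_of_ne h2 h1.symm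

lemma HashLike.real_Iic_le {a : ℝ} (ha : 0 ≤ a) : ν.real (Set.Iic a) ≤ a := by
  refine ENNReal.toReal_le_of_le_ofReal ha ?_
  have h : ν (Set.Iic a) = ν (Set.Icc 0 a) := by
    refine measure_congr ?_
    filter_upwards [HashLike.nonneg (ν := ν)] with x hx
    simp only [eq_iff_iff]
    exact ⟨fun h => ⟨hx, h⟩, fun h => h.2⟩
  rw [h]
  refine (HashLike.le_volume _).trans ?_
  simp

end HashLike

instance : HashLike (expMeasure 1) where
  toIsProbabilityMeasure := isProbabilityMeasure_expMeasure one_pos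
  le_volume := by
    have h : expMeasure 1 = volume.withDensity (gammaPDF 1 1) := rfl
    rw [h]
    calc _ ≤ volume.withDensity (1 : ℝ → ℝ≥0∞) := withDensity_mono (.of_forall fun x => ?_)
      _ = volume := withDensity_one
    simp only [gammaPDF, gammaPDFReal, Pi.one_apply]
    refine ENNReal.ofReal_le_one.2 ?_
    split_ifs with hx
    · simp [hx]
    · norm_num
  nonneg := by
    have h := isProbabilityMeasure_expMeasure (r := 1) one_pos
    have h2 := cdf_expMeasure_eq (r := 1) one_pos 0
    rw [cdf_eq_real] at h2
    simp only [le_refl, mul_zero, neg_zero, Real.exp_zero, sub_self, if_true] at h2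
    rw [ae_iff]
    refine measure_mono_null (t := Set.Iic 0) (fun x hx => ?_) ?_
    · simp only [Set.mem_ofPred_eq, not_le] at hx; exact hx.le
    · rwa [measureReal_eq_zero_iff] at h2

lemma expMeasure_real_Ioi {v : ℝ} (hv : 0 ≤ v) :
    (expMeasure 1).real (Set.Ioi v) = Real.exp (-v) := by
  have h := isProbabilityMeasure_expMeasure (r := 1) one_pos
  have h2 := cdf_expMeasure_eq (r := 1) one_pos v
  rw [cdf_eq_real, if_pos hv, one_mul] at h2
  rw [← Set.compl_Iic, probReal_compl_eq_one_sub measurableSet_Iic, h2]; ring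

/-- The uniform law on `[0,1]`. -/
def unifLaw : Measure ℝ := (volume : Measure ℝ).restrict (Set.Icc 0 1)

instance : HashLike unifLaw where
  measure_univ := by simp [unifLaw]
  le_volume := Measure.restrict_le_self
  nonneg := by
    unfold unifLaw
    filter_upwards [ae_restrict_mem measurableSet_Icc] with x hx using hx.1

lemma unifLaw_real_Iic {v : ℝ} (hv : 0 ≤ v) (hv1 : v ≤ 1) : unifLaw.real (Set.Iic v) = v := by
  have : Set.Iic v ∩ Set.Icc 0 1 = Set.Icc 0 v := by
    ext x; simp only [Set.mem_inter_iff, Set.mem_Iic, Set.mem_Icc]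
    exact ⟨fun h => ⟨h.2.1, h.1⟩, fun h => ⟨h.2, h.1, h.2.trans hv1⟩⟩
  rw [unifLaw, measureReal_restrict_apply measurableSet_Iic, this]
  simp [hv]

section Boxes

variable {n : ℕ} (ν : Measure ℝ) [HashLike ν]

/-- Independent hash values of the keys of `s` all lie in the interval of length `ε` above a level
that is determined by the other keys. -/
lemma real_forall_mem_Ico_le {base : (Fin n → ℝ) → ℝ} (hb : Measurable base) {ε : ℝ} (hε : 0 ≤ ε)
    (s : Finset (Fin n)) (hbase : ∀ x ∈ s, ∀ h a, base (Function.update h x a) = base h) :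
    (Measure.pi fun _ : Fin n => ν).real {h | ∀ x ∈ s, h x ∈ Set.Ico (base h) (base h + ε)}
      ≤ ε ^ s.card := by
  suffices H : ∀ s : Finset (Fin n), (∀ x ∈ s, ∀ h a, base (Function.update h x a) = base h) →
      (Measure.pi fun _ : Fin n => ν) {h | ∀ x ∈ s, h x ∈ Set.Ico (base h) (base h + ε)}
        ≤ ENNReal.ofReal (ε ^ s.card) from
    ENNReal.toReal_le_of_le_ofReal (by positivity) (H s hbase)
  clear hbase s
  intro s
  have hmeas : ∀ s : Finset (Fin n),
      MeasurableSet {h : Fin n → ℝ | ∀ x ∈ s, h x ∈ Set.Ico (base h) (base h + ε)} := by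
    intro s
    have : {h : Fin n → ℝ | ∀ x ∈ s, h x ∈ Set.Ico (base h) (base h + ε)} =
        ⋂ x ∈ s, ({h | base h ≤ h x} ∩ {h | h x < base h + ε}) := by ext; simp
    rw [this]
    refine Finset.measurableSet_biInter _ fun x _ => ?_
    exact (measurableSet_le hb (measurable_pi_apply x)).inter
      (measurableSet_lt (measurable_pi_apply x) (hb.add_const ε))
  induction s using Finset.induction_on with
  | empty => intro _; simp
  | insert x s hx ih =>
    intro hbase
    have ih' := ih fun y hy => hbase y (mem_insert_of_mem hy)
    rw [card_insert_of_notMem hx, pow_succ, ENNReal.ofReal_mul (by positivity)]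
    rw [← lintegral_indicator_one (hmeas _), lintegral_resample
      (measurable_one.indicator (hmeas _)) x]
    -- Given the other values, the value of `x` lies in a fixed interval of length `ε`.
    have key : ∀ h : Fin n → ℝ, ∫⁻ a, ({h : Fin n → ℝ | ∀ x_1 ∈ insert x s,
        h x_1 ∈ Set.Ico (base h) (base h + ε)} : Set _).indicator (1 : (Fin n → ℝ) → ℝ≥0∞)
          (Function.update h x a) ∂ν
        ≤ ({h : Fin n → ℝ | ∀ x ∈ s, h x ∈ Set.Ico (base h) (base h + ε)} : Set _).indicator 1 h
          * ENNReal.ofReal ε := by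
      intro h
      by_cases hh : ∀ y ∈ s, h y ∈ Set.Ico (base h) (base h + ε)
      · rw [Set.indicator_of_mem (s := {h : Fin n → ℝ | ∀ x ∈ s, h x ∈ _}) (by exact hh)]
        simp only [Pi.one_apply, one_mul]
        calc _ ≤ ∫⁻ a, (Set.Ico (base h) (base h + ε)).indicator 1 a ∂ν := by
              refine lintegral_mono fun a => ?_
              by_cases ha : a ∈ Set.Ico (base h) (base h + ε)
              · rw [Set.indicator_of_mem ha]
                exact Set.indicator_le_self' (by simp) _
              · rw [Set.indicator_of_notMem (s := {h : Fin n → ℝ | _})]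
                · exact zero_le
                · intro hc
                  have := hc x (mem_insert_self x s)
                  rw [hbase x (mem_insert_self x s), Function.update_self] at this
                  exact ha this
          _ = ν (Set.Ico (base h) (base h + ε)) := lintegral_indicator_one measurableSet_Ico
          _ ≤ ENNReal.ofReal ε := by
              refine (HashLike.le_volume _).trans ?_
              simp
      · refine le_trans (le_of_eq ?_) zero_le
        have : ∀ a, ({h : Fin n → ℝ | ∀ x_1 ∈ insert x s,
            h x_1 ∈ Set.Ico (base h) (base h + ε)} : Set _).indicator (1 : (Fin n → ℝ) → ℝ≥0∞)
              (Function.update h x a) = 0 := by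
          intro a
          refine Set.indicator_of_notMem (fun hc => hh fun y hy => ?_) _
          have h1 := hc y (mem_insert_of_mem hy)
          rwa [hbase x (mem_insert_self x s),
            Function.update_of_ne (ne_of_mem_of_not_mem hy hx)] at h1
        simp only [this, lintegral_zero]
    calc _ ≤ _ := lintegral_mono key
      _ = (Measure.pi fun _ : Fin n => ν) {h | ∀ x ∈ s, h x ∈ Set.Ico (base h) (base h + ε)}
          * ENNReal.ofReal ε := by
        rw [lintegral_mul_const' _ _ (by simp), lintegral_indicator_one (hmeas s)]
      _ ≤ _ := by gcongr

end Boxes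

/-! ### The sufficient statistics -/

section Stat

variable {n : ℕ}

lemma stat_kMins {k : ℕ} (ρ : Fin k → Fin n → ℝ) (U : Finset (Fin n)) :
    stat .kMins k (sketch .kMins k ρ U) = ∑ l, |minHash (ρ l) U| := by
  simp only [stat, sketch]
  rw [List.map_ofFn, List.sum_ofFn]
  rfl

/-- The `j`-th smallest value of `h` on `U`, and `1` if `U` has fewer than `j` keys. -/
def kth (j : ℕ) (h : Fin n → ℝ) (U : Finset (Fin n)) : ℝ :=
  ((U.val.map h).sort (· ≤ ·)).getD (j - 1) 1

lemma stat_bottomK {k : ℕ} (hk : 0 < k) (ρ : Fin 1 → Fin n → ℝ) (U : Finset (Fin n)) :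
    stat .bottomK k (sketch .bottomK k ρ U) = kth k (ρ 0) U := by
  simp only [stat, sketch, kth, List.getD_eq_getElem?_getD]
  rw [List.getElem?_take_of_lt (by omega)]

lemma getD_le_iff {l : List ℝ} (hl : l.Pairwise (· ≤ ·)) (i : ℕ) (v : ℝ) :
    l.getD i 1 ≤ v ↔ i < l.countP (· ≤ v) ∨ (l.length ≤ i ∧ 1 ≤ v) := by
  induction l generalizing i with
  | nil => simp
  | cons a l ih =>
    rw [List.pairwise_cons] at hl
    cases i with
    | zero =>
      by_cases h : a ≤ v
      · simp [h]
      · have : l.countP (· ≤ v) = 0 := by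
          rw [List.countP_eq_zero]
          intro b hb
          simpa using lt_of_lt_of_le (not_le.1 h) (hl.1 b hb)
        simp [h, this]
    | succ i =>
      rw [List.getD_cons_succ, ih hl.2, List.countP_cons, List.length_cons]
      by_cases h : a ≤ v
      · simp [h]
      · have : l.countP (· ≤ v) = 0 := by
          rw [List.countP_eq_zero]
          intro b hb
          simpa using lt_of_lt_of_le (not_le.1 h) (hl.1 b hb)
        simp [h, this]

lemma kth_le_iff {j : ℕ} (hj : 0 < j) (h : Fin n → ℝ) (U : Finset (Fin n)) (v : ℝ) :
    kth j h U ≤ v ↔ j ≤ (U.filter fun x => h x ≤ v).card ∨ (U.card < j ∧ 1 ≤ v) := by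
  have hc : ((U.val.map h).sort (· ≤ ·)).countP (· ≤ v) = (U.filter fun x => h x ≤ v).card := by
    rw [← Multiset.coe_countP, Multiset.sort_eq, Multiset.countP_map]
    simp [Finset.card, Finset.filter]
  have hlen : ((U.val.map h).sort (· ≤ ·)).length = U.card := by
    rw [Multiset.length_sort, Multiset.card_map]; rfl
  rw [kth, getD_le_iff (Multiset.pairwise_sort _ _), hc, hlen]
  have h1 : j - 1 < (U.filter fun x => h x ≤ v).card ↔ j ≤ (U.filter fun x => h x ≤ v).card := by
    omega
  have h2 : U.card ≤ j - 1 ↔ U.card < j := by omega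
  rw [h1, h2]

lemma kth_le_iff_of_lt_one {j : ℕ} (hj : 0 < j) (h : Fin n → ℝ) (U : Finset (Fin n)) {v : ℝ}
    (hv : v < 1) : kth j h U ≤ v ↔ j ≤ (U.filter fun x => h x ≤ v).card := by
  rw [kth_le_iff hj]
  exact ⟨fun h => h.resolve_right fun h => not_le.2 hv h.2, Or.inl⟩

lemma kth_le_one {j : ℕ} (hj : 0 < j) {h : Fin n → ℝ} (h1 : ∀ x, h x ≤ 1)
    (U : Finset (Fin n)) : kth j h U ≤ 1 := by
  rw [kth_le_iff hj]
  by_cases hU : U.card < j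
  · exact Or.inr ⟨hU, le_rfl⟩
  · left; simpa [h1] using hU

lemma kth_pos {j : ℕ} (hj : 0 < j) {h : Fin n → ℝ} (h0 : ∀ x, 0 < h x) (U : Finset (Fin n)) :
    0 < kth j h U := by
  rw [← not_le, kth_le_iff hj]
  rintro (h2 | h2)
  · rw [filter_false_of_mem fun x _ => not_le.2 (h0 x), card_empty] at h2
    omega
  · linarith [h2.2]

lemma kth_anti {j : ℕ} (hj : 0 < j) {h : Fin n → ℝ} (h1 : ∀ x, h x ≤ 1)
    {U V : Finset (Fin n)} (hUV : U ⊆ V) : kth j h V ≤ kth j h U := by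
  have h2 := (kth_le_iff hj h U (kth j h U)).1 le_rfl
  rcases h2 with h2 | h2
  · exact (kth_le_iff hj h V _).2 (Or.inl (h2.trans (card_le_card (filter_subset_filter _ hUV))))
  · exact (kth_le_one hj h1 V).trans h2.2

lemma measurable_card_filter {X : Type*} [MeasurableSpace X] (U : Finset (Fin n))
    {p : Fin n → X → Prop} [∀ ω, DecidablePred fun x => p x ω]
    (hp : ∀ x ∈ U, MeasurableSet {ω | p x ω}) :
    Measurable fun ω => ((U.filter fun x => p x ω).card : ℝ) := by
  have : (fun ω => ((U.filter fun x => p x ω).card : ℝ)) =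
      fun ω => ∑ x ∈ U, if p x ω then (1 : ℝ) else 0 := by
    ext ω
    rw [sum_boole]
  rw [this]
  exact Finset.measurable_sum U fun x hx =>
    Measurable.ite (hp x hx) measurable_const measurable_const

lemma measurable_kth {j : ℕ} (hj : 0 < j) (U : Finset (Fin n)) :
    Measurable fun h : Fin n → ℝ => kth j h U := by
  refine measurable_of_Iic fun v => ?_
  have : (fun h : Fin n → ℝ => kth j h U) ⁻¹' Set.Iic v =
      {h | (j : ℝ) ≤ (U.filter fun x => h x ≤ v).card} ∪ {_h | U.card < j ∧ 1 ≤ v} := by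
    ext h
    simp only [Set.mem_preimage, Set.mem_Iic, kth_le_iff hj, Set.mem_union, Set.mem_ofPred_eq,
      Nat.cast_le]
  rw [this]
  refine MeasurableSet.union (measurableSet_le measurable_const ?_) (MeasurableSet.const _)
  exact measurable_card_filter U fun x _ => measurableSet_le (measurable_pi_apply x)
    measurable_const

lemma minHash_eq_inf' {h : Fin n → ℝ} {U : Finset (Fin n)} (hU : U.Nonempty) :
    minHash h U = U.inf' hU h := by rw [minHash, dif_pos hU]

lemma minHash_le {h : Fin n → ℝ} {U : Finset (Fin n)} {x : Fin n} (hx : x ∈ U) :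
    minHash h U ≤ h x := by
  rw [minHash_eq_inf' ⟨x, hx⟩]; exact inf'_le h hx

lemma minHash_pos {h : Fin n → ℝ} (h0 : ∀ x, 0 < h x) {U : Finset (Fin n)} (hU : U.Nonempty) :
    0 < minHash h U := by
  rw [minHash_eq_inf' hU, lt_inf'_iff]; exact fun x _ => h0 x

lemma minHash_anti {h : Fin n → ℝ} {U V : Finset (Fin n)} (hU : U.Nonempty) (hUV : U ⊆ V) :
    minHash h V ≤ minHash h U := by
  rw [minHash_eq_inf' hU, minHash_eq_inf' (hU.mono hUV)]; exact inf'_mono h hUV hU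

lemma measurable_minHash (U : Finset (Fin n)) :
    Measurable fun h : Fin n → ℝ => minHash h U := by
  by_cases hU : U.Nonempty
  · refine measurable_of_Ici fun v => ?_
    have : (fun h : Fin n → ℝ => minHash h U) ⁻¹' Set.Ici v = ⋂ x ∈ U, {h | v ≤ h x} := by
      ext h; simp [minHash_eq_inf' hU]
    rw [this]
    exact Finset.measurableSet_biInter _ fun x _ =>
      measurableSet_le measurable_const (measurable_pi_apply x)
  · simp [minHash, hU]

end Stat

/-! ### From the statistic of the lowest keys to the estimates -/

/-- A key is among the `m` lowest ones, however ties are broken, if fewer than `m` keys, itself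
included, have at most its score. -/
lemma IsLowest.mem_of_card_lt {n m : ℕ} {A : Fin n → ℝ} {W : Finset (Fin n)}
    (hW : IsLowest A m W) {x : Fin n} (hx : (univ.filter fun z => A z ≤ A x).card < m) :
    x ∈ W := by
  by_contra h
  have : W ⊆ univ.filter fun z => A z ≤ A x := fun z hz => by
    simpa using hW.2 z hz x h
  have := card_le_card this
  rw [hW.1] at this
  omega

/-- The scores are proportional to the averages of the statistic over the patterns. -/
lemma score_eq (s : SketchType) {k n r : ℕ} (ω : Run s k n r) (x : Fin n) :
    score s k ω x = avgOn (fun i => stat s k (sketch s k ω.1 (query ω.2 i)))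
      (pat (query ω.2) x) / ((k : ℝ) - 1) := by
  simp only [score, estimate, inv_div, avgOn, pat, ← sum_div]
  rw [div_right_comm]

lemma isLowest_score_iff (s : SketchType) {k n r : ℕ} (hk : 2 ≤ k) (ω : Run s k n r) (m : ℕ)
    (W : Finset (Fin n)) : IsLowest (score s k ω) m W ↔
      IsLowest (fun x => avgOn (fun i => stat s k (sketch s k ω.1 (query ω.2 i)))
        (pat (query ω.2) x)) m W := by
  have hk' : (0 : ℝ) < (k : ℝ) - 1 := by
    have : (2 : ℝ) ≤ k := by exact_mod_cast hk
    linarith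
  simp only [IsLowest, score_eq, div_le_div_iff_of_pos_right hk']

/-- The law of the hash values. -/
def hashMeasure (s : SketchType) (k n : ℕ) : Measure (Hashes s k n) :=
  Measure.pi fun _ : Fin (s.numHashes k) => Measure.pi fun _ : Fin n => s.hashLaw

instance (s : SketchType) : HashLike s.hashLaw := by
  cases s
  · exact inferInstanceAs (HashLike (expMeasure 1))
  · exact inferInstanceAs (HashLike unifLaw)

instance (s : SketchType) (k n : ℕ) : IsProbabilityMeasure (hashMeasure s k n) := by
  unfold hashMeasure; infer_instance

lemma runLaw_eq (s : SketchType) (k n r : ℕ) :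
    runLaw s k n r = (hashMeasure s k n).prod (coinLaw n r) := rfl

lemma measurable_stat (s : SketchType) {k n : ℕ} (hk : 0 < k) (U : Finset (Fin n)) :
    Measurable fun ρ : Hashes s k n => stat s k (sketch s k ρ U) := by
  cases s
  · have : (fun ρ : Hashes .kMins k n => stat .kMins k (sketch .kMins k ρ U)) =
        fun ρ : Fin k → Fin n → ℝ => ∑ l, |minHash (ρ l) U| := by
      ext ρ; exact stat_kMins ρ U
    rw [this]
    refine Finset.measurable_sum _ fun l _ => ?_
    exact ((measurable_minHash U).comp (measurable_pi_apply l)).abs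
  · have : (fun ρ : Hashes .bottomK k n => stat .bottomK k (sketch .bottomK k ρ U)) =
        fun ρ : Fin 1 → Fin n → ℝ => kth k (ρ 0) U := by
      ext ρ; exact stat_bottomK hk ρ U
    rw [this]
    exact (measurable_kth hk U).comp (measurable_pi_apply 0)

lemma ae_hashes (s : SketchType) (k n : ℕ) {p : ℝ → Prop} (hp : ∀ᵐ x ∂s.hashLaw, p x) :
    ∀ᵐ ρ ∂hashMeasure s k n, ∀ l x, p (ρ l x) := by
  rw [ae_all_iff]; intro l
  rw [ae_all_iff]; intro x
  have h1 : ∀ᵐ h ∂(Measure.pi fun _ : Fin n => s.hashLaw), p (h x) :=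
    (measurePreserving_eval (fun _ : Fin n => s.hashLaw) x).quasiMeasurePreserving.ae hp
  exact (measurePreserving_eval (fun _ : Fin (s.numHashes k) =>
    Measure.pi fun _ : Fin n => s.hashLaw) l).quasiMeasurePreserving.ae h1

/-- Almost surely, the statistic is positive and decreases as the set of keys grows. -/
lemma stat_pos_and_anti (s : SketchType) {k n : ℕ} (hk : 0 < k) :
    ∀ᵐ ρ ∂hashMeasure s k n, ∀ U V : Finset (Fin n), U.Nonempty → U ⊆ V →
      0 < stat s k (sketch s k ρ V) ∧
      stat s k (sketch s k ρ V) ≤ stat s k (sketch s k ρ U) := by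
  cases s
  · filter_upwards [ae_hashes .kMins k n (HashLike.ae_pos _)] with ρ hρ U V hU hUV
    have : Nonempty (Fin k) := ⟨⟨0, hk⟩⟩
    have e := fun U => stat_kMins (k := k) (n := n) ρ U
    rw [e, e]
    refine ⟨sum_pos (fun l _ => abs_pos.2 (minHash_pos (hρ l) (hU.mono hUV)).ne') univ_nonempty,
      sum_le_sum fun l _ => ?_⟩
    rw [abs_of_pos (minHash_pos (hρ l) hU), abs_of_pos (minHash_pos (hρ l) (hU.mono hUV))]
    exact minHash_anti hU hUV
  · have h1 : ∀ᵐ x ∂SketchType.hashLaw .bottomK, 0 < x ∧ x ≤ 1 := by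
      have : ∀ᵐ x ∂unifLaw, x ≤ 1 := by
        unfold unifLaw
        filter_upwards [ae_restrict_mem measurableSet_Icc] with x hx using hx.2
      filter_upwards [HashLike.ae_pos _, this] with x h1 h2 using ⟨h1, h2⟩
    filter_upwards [ae_hashes .bottomK k n h1] with ρ hρ U V hU hUV
    have e := fun U => stat_bottomK (k := k) (n := n) hk ρ U
    rw [e, e]
    exact ⟨kth_pos hk (fun x => (hρ (0 : Fin 1) x).1) V,
      kth_anti hk (fun x => (hρ (0 : Fin 1) x).2) hUV⟩

lemma estimate_le_of_le_stat {s : SketchType} {k : ℕ} (hk : 1 ≤ k) {S S' : List ℝ}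
    (h0 : 0 < stat s k S) (h : stat s k S ≤ stat s k S') : estimate s k S' ≤ estimate s k S := by
  have hk' : (0 : ℝ) ≤ (k : ℝ) - 1 := by
    have : (1 : ℝ) ≤ k := by exact_mod_cast hk
    linarith
  exact div_le_div_of_nonneg_left hk' h0 h

/-- The properties of the estimates on the lowest keys follow from an upper bound `B k / n` on their
statistic, which holds outside an unlikely event `Bad`, and from the expected estimate of all the
keys, which is an upper bound. -/
theorem conclusion_of_stat_le (s : SketchType) {k n r : ℕ} {α B C : ℝ} (hk : 2 ≤ k)
    (hα : 0 < α) (hn : 1 ≤ α * n) (hB : 0 < B) (hC : 0 < C)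
    {Bad : Hashes s k n → (Fin r → Finset (Fin n)) → Prop}
    (hBad : jprob (hashMeasure s k n) Bad ≤ 0.009)
    (hgood : ∀ᵐ ρ ∂hashMeasure s k n, ∀ q W,
      IsLowest (fun x => avgOn (fun i => stat s k (sketch s k ρ (q i))) (pat q x))
        ⌈α * (n : ℝ)⌉₊ W → ¬ Bad ρ q → stat s k (sketch s k ρ W) ≤ B * k / n)
    (hE : ∫⁻ ρ, ENNReal.ofReal (estimate s k (sketch s k ρ univ)) ∂hashMeasure s k n
      ≤ ENNReal.ofReal (C * n))
    (W : Run s k n r → Finset (Fin n)) (hWm : ∀ V, MeasurableSet (W ⁻¹' {V}))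
    (hW : ∀ ω, IsLowest (score s k ω) ⌈α * (n : ℝ)⌉₊ (W ω)) :
    (0.99 : ℝ) ≤ (runLaw s k n r).real
        {ω | IsBiasedUp s k (sketch s k ω.1 (W ω)) (W ω).card ((1 / (2 * B)) / α) ∧
          1 / (4 * B) * (n : ℝ) ≤ estimate s k (sketch s k ω.1 (W ω)) ∧
          estimate s k (sketch s k ω.1 (W ω)) ≤ 1000 * C * (n : ℝ)} ∧
    Integrable (fun ω => estimate s k (sketch s k ω.1 (W ω))) (runLaw s k n r) ∧
    1 / (4 * B) * (n : ℝ) ≤ ∫ ω, estimate s k (sketch s k ω.1 (W ω)) ∂(runLaw s k n r) ∧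
    ∫ ω, estimate s k (sketch s k ω.1 (W ω)) ∂(runLaw s k n r) ≤ 1000 * C * (n : ℝ) := by
  have hk2 : (2 : ℝ) ≤ k := by exact_mod_cast hk
  have hn0 : (0 : ℝ) < n := by
    by_contra h
    have : α * n ≤ 0 := mul_nonpos_of_nonneg_of_nonpos hα.le (not_lt.1 h)
    linarith
  have hcard : ∀ ω, (W ω).card = ⌈α * (n : ℝ)⌉₊ := fun ω => (hW ω).1
  have hne : ∀ ω, (W ω).Nonempty := fun ω => by
    rw [← card_pos, hcard]; exact Nat.ceil_pos.2 (by linarith)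
  set P := runLaw s k n r with hP
  have hPe : P = (hashMeasure s k n).prod (coinLaw n r) := runLaw_eq s k n r
  have : IsProbabilityMeasure P := by rw [hPe]; infer_instance
  set M : Run s k n r → ℝ := fun ω => estimate s k (sketch s k ω.1 (W ω)) with hM
  set N : Run s k n r → ℝ := fun ω => estimate s k (sketch s k ω.1 univ) with hN
  have hest : ∀ U : Finset (Fin n),
      Measurable fun ρ : Hashes s k n => estimate s k (sketch s k ρ U) := fun U =>
    measurable_const.div (measurable_stat s (by omega) U)
  -- `W` takes finitely many values, and `M` is measurable on each of its level sets.
  have hMm : Measurable M := by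
    have : M = fun ω => ∑ V : Finset (Fin n),
        if ω ∈ W ⁻¹' {V} then estimate s k (sketch s k ω.1 V) else 0 := by
      ext ω; simp [hM]
    rw [this]
    exact Finset.measurable_sum _ fun V _ =>
      Measurable.ite (hWm V) ((hest V).comp measurable_fst) measurable_const
  have hNm : Measurable N := (hest univ).comp measurable_fst
  have hpos : ∀ᵐ ω ∂P, 0 < stat s k (sketch s k ω.1 (W ω)) ∧ 0 ≤ M ω ∧ M ω ≤ N ω := by
    rw [hPe]
    filter_upwards [Measure.quasiMeasurePreserving_fst.ae (stat_pos_and_anti s (k := k) (n := n)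
      (by omega))] with ω hω
    have h1 := hω _ _ (hne ω) (Finset.subset_univ (W ω))
    have h2 := (hω _ _ (hne ω) subset_rfl).1
    exact ⟨h2, div_nonneg (by linarith) h2.le, estimate_le_of_le_stat (by omega) h1.1 h1.2⟩
  have hgood' : ∀ᵐ ω ∂P, ¬ Bad ω.1 (query ω.2) →
      stat s k (sketch s k ω.1 (W ω)) ≤ B * k / n := by
    rw [hPe]
    filter_upwards [Measure.quasiMeasurePreserving_fst.ae hgood] with ω hω
    exact hω _ _ ((isLowest_score_iff s hk ω _ _).1 (hW ω))
  have hlN : ∫⁻ ω, ENNReal.ofReal (N ω) ∂P ≤ ENNReal.ofReal (C * n) := by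
    rw [hPe, lintegral_prod _ (hNm.ennreal_ofReal.aemeasurable)]
    simpa [hN] using hE
  have hlM : ∫⁻ ω, ENNReal.ofReal (M ω) ∂P ≤ ENNReal.ofReal (C * n) :=
    (lintegral_mono_ae (by
      filter_upwards [hpos] with ω hω using ENNReal.ofReal_le_ofReal hω.2.2)).trans hlN
  have hMnn : 0 ≤ᵐ[P] M := by filter_upwards [hpos] with ω hω using hω.2.1
  have hint : Integrable M P := by
    refine ⟨hMm.aestronglyMeasurable, ?_⟩
    rw [hasFiniteIntegral_iff_ofReal hMnn]
    exact hlM.trans_lt ENNReal.ofReal_lt_top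
  have hEM : ∫ ω, M ω ∂P ≤ C * n := by
    rw [integral_eq_lintegral_of_nonneg_ae hMnn hMm.aestronglyMeasurable]
    exact ENNReal.toReal_le_of_le_ofReal (by positivity) hlM
  set G : Set (Run s k n r) := {ω | IsBiasedUp s k (sketch s k ω.1 (W ω)) (W ω).card
      ((1 / (2 * B)) / α) ∧ 1 / (2 * B) * (n : ℝ) ≤ M ω ∧ M ω ≤ 1000 * C * (n : ℝ)} with hG
  have hPG : (0.99 : ℝ) ≤ P.real G := by
    have hbad1 : P.real {ω | Bad ω.1 (query ω.2)} ≤ 0.009 := by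
      rw [hPe]; exact (real_le_jprob _ _).trans hBad
    have hbad2 : P.real {ω | 1000 * C * (n : ℝ) ≤ M ω} ≤ 0.001 := by
      have := mul_meas_ge_le_integral_of_nonneg hMnn hint (1000 * C * n)
      have h2 : 1000 * C * n * P.real {ω | 1000 * C * (n : ℝ) ≤ M ω} ≤ 1000 * C * n * 0.001 := by
        linarith
      exact le_of_mul_le_mul_left h2 (by positivity)
    -- Almost every run is good, or lies in `Bad`, or has an estimate of more than `1000` times the
    -- expected estimate of all the keys.
    have hcov : ∀ᵐ ω ∂P, ω ∈ (Set.univ : Set (Run s k n r)) → ω ∈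
        G ∪ ({ω | Bad ω.1 (query ω.2)} ∪ {ω | 1000 * C * (n : ℝ) ≤ M ω}) := by
      filter_upwards [hpos, hgood'] with ω h1 h2 _
      by_cases hb : Bad ω.1 (query ω.2)
      · exact Or.inr (Or.inl hb)
      by_cases hb2 : 1000 * C * (n : ℝ) ≤ M ω
      · exact Or.inr (Or.inr hb2)
      left
      have hst := h2 hb
      -- Rounding up at most doubles `α n ≥ 1`, and `k - 1 ≥ k / 2`.
      have hceil : (⌈α * (n : ℝ)⌉₊ : ℝ) ≤ 2 * (α * n) := by
        have := Nat.ceil_lt_add_one (a := α * (n : ℝ)) (by linarith)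
        linarith
      have hceil0 : (0 : ℝ) < ⌈α * (n : ℝ)⌉₊ := by
        exact_mod_cast Nat.ceil_pos.2 (by linarith : 0 < α * (n : ℝ))
      refine ⟨?_, ?_, (not_le.1 hb2).le⟩
      · rw [IsBiasedUp, hcard]
        refine hst.trans ?_
        calc B * k / n = (1 / (2 * B) / α)⁻¹ * k / (2 * (α * n)) := by field_simp
          _ ≤ _ := by gcongr
      · have h3 : ((k : ℝ) - 1) / (B * k / n) ≤ M ω :=
          div_le_div_of_nonneg_left (by linarith) h1.1 hst
        refine le_trans ?_ h3
        rw [le_div_iff₀ (by positivity)]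
        calc 1 / (2 * B) * (n : ℝ) * (B * k / n) = k / 2 := by field_simp
          _ ≤ (k : ℝ) - 1 := by linarith
    have h1 : (1 : ℝ) ≤ P.real (G ∪ ({ω | Bad ω.1 (query ω.2)} ∪
        {ω | 1000 * C * (n : ℝ) ≤ M ω})) := by
      rw [← probReal_univ (μ := P)]
      exact ENNReal.toReal_mono (measure_ne_top _ _) (measure_mono_ae hcov)
    have h2 := measureReal_union_le (μ := P) G ({ω | Bad ω.1 (query ω.2)} ∪
        {ω | 1000 * C * (n : ℝ) ≤ M ω})
    have h3 := measureReal_union_le (μ := P) {ω | Bad ω.1 (query ω.2)}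
        {ω | 1000 * C * (n : ℝ) ≤ M ω}
    linarith
  have hc : 1 / (4 * B) * (n : ℝ) ≤ 1 / (2 * B) * n := by
    gcongr; norm_num
  refine ⟨hPG.trans (measureReal_mono fun ω hω => ⟨hω.1, hc.trans hω.2.1, hω.2.2⟩), hint, ?_,
    hEM.trans ?_⟩
  -- The estimate is nonnegative, and at least `n / (2 B)` with probability at least `1 / 2`.
  · have h1 := mul_meas_ge_le_integral_of_nonneg hMnn hint (1 / (2 * B) * n)
    refine le_trans ?_ h1
    have h2 : P.real G ≤ P.real {ω | 1 / (2 * B) * (n : ℝ) ≤ M ω} :=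
      measureReal_mono fun ω hω => hω.2.1
    calc 1 / (4 * B) * (n : ℝ) = 1 / (2 * B) * n * 0.5 := by ring
      _ ≤ _ := by gcongr; linarith
  · have : 0 < C * n := by positivity
    linarith

/-! ### The score threshold and the variance of the statistic -/

section Threshold

variable {n r : ℕ}

/-- If few keys have averages below the threshold `a`, then every key whose average is below `a` is
among the lowest keys. In the applications `t` is the statistic `T` truncated, and `L` holds the
keys that can influence `t`. -/
lemma nonneg_sum_of_notMem {T t : Finset (Fin n) → ℝ} {L W : Finset (Fin n)} {α a : ℝ}
    {q : Fin r → Finset (Fin n)} (hαn : 0 < α * n) (hG : ∀ i, T (q i) = t (q i))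
    (hL : (L.card : ℝ) ≤ α * n / 4)
    (hc : ((univ.filter fun x => x ∉ L ∧ ∑ i ∈ pat q x, (t (q i) - a) ≤ 0).card : ℝ)
      < α * n / 2)
    (hW : IsLowest (fun x => avgOn (fun i => T (q i)) (pat q x)) ⌈α * (n : ℝ)⌉₊ W)
    {x : Fin n} (hx : x ∉ W) : 0 ≤ ∑ i ∈ pat q x, (t (q i) - a) := by
  simp only [hG] at hW
  refine sum_sub_nonneg_of_le_avgOn (v := fun i => t (q i)) ?_
  by_contra hlt
  rw [not_le] at hlt
  refine hx (hW.mem_of_card_lt ?_)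
  have h1 : (univ.filter fun z => avgOn (fun i => t (q i)) (pat q z) ≤
      avgOn (fun i => t (q i)) (pat q x)) ⊆
      L ∪ univ.filter fun x => x ∉ L ∧ ∑ i ∈ pat q x, (t (q i) - a) ≤ 0 := by
    intro z hz
    rw [mem_filter] at hz
    rw [mem_union, mem_filter]
    by_cases hzL : z ∈ L
    · exact Or.inl hzL
    · exact Or.inr ⟨mem_univ _, hzL, sum_sub_nonpos_of_avgOn_lt (hz.2.trans_lt hlt)⟩
  have h2 : ((univ.filter fun z => avgOn (fun i => t (q i)) (pat q z) ≤
      avgOn (fun i => t (q i)) (pat q x)).card : ℝ) ≤ L.card +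
      (univ.filter fun x => x ∉ L ∧ ∑ i ∈ pat q x, (t (q i) - a) ≤ 0).card := by
    exact_mod_cast (card_le_card h1).trans (card_union_le _ _)
  have h3 := Nat.le_ceil (α * (n : ℝ))
  have h4 : ((univ.filter fun z => avgOn (fun i => t (q i)) (pat q z) ≤
      avgOn (fun i => t (q i)) (pat q x)).card : ℝ) < ⌈α * (n : ℝ)⌉₊ := by linarith
  exact_mod_cast h4

lemma expect_card_filter {Ω : Type*} [Fintype Ω] (s : Finset (Fin n)) (p : Fin n → Ω → Prop)
    [∀ ω, DecidablePred fun x => p x ω] :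
    𝔼 ω, ((s.filter fun x => p x ω).card : ℝ) = ∑ x ∈ s, freq (p x) := by
  simp only [← sum_boole]
  rw [expect_sum_comm]
  exact sum_congr rfl fun x _ => expect_congr rfl fun ω _ => by congr

lemma freq_card_filter_ge_le {Ω : Type*} [Fintype Ω] (s : Finset (Fin n)) (p : Fin n → Ω → Prop)
    [∀ ω, DecidablePred fun x => p x ω] {ε a : ℝ} (hp : ∀ x ∈ s, freq (p x) ≤ ε) (ha : 0 < a) :
    freq (fun ω => a ≤ ((s.filter fun x => p x ω).card : ℝ)) ≤ s.card * ε / a := by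
  refine (freq_lt_le_expect_div (fun ω => by positivity) ha).trans ?_
  rw [expect_card_filter]
  gcongr
  calc _ ≤ ∑ x ∈ s, ε := sum_le_sum hp
    _ = _ := by simp

/-- Few keys without influence on the response have averages below the mean by `δ`. -/
lemma freq_card_low_ge_le {t : Finset (Fin n) → ℝ} {L : Finset (Fin n)}
    (hL : ∀ x ∉ L, ∀ U, t (insert x U) = t U) {δ a : ℝ} (hδ : 0 < δ) (hr : 0 < r) (ha : 0 < a) :
    freq (fun q : Fin r → Finset (Fin n) => a ≤ ((univ.filter fun x => x ∉ L ∧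
      ∑ i ∈ pat q x, (t (q i) - (𝔼 U, t U - δ)) ≤ 0).card : ℝ))
      ≤ n * (4 * (𝔼 U, (t U - 𝔼 U, t U) ^ 2 + δ ^ 2) / (r * δ ^ 2)) / a := by
  have h := freq_card_filter_ge_le (univ.filter fun x => x ∉ L)
    (fun x (q : Fin r → Finset (Fin n)) => ∑ i ∈ pat q x, (t (q i) - (𝔼 U, t U - δ)) ≤ 0)
    (ε := 4 * (𝔼 U, (t U - 𝔼 U, t U) ^ 2 + δ ^ 2) / (r * δ ^ 2))
    (fun x hx => freq_sum_nonpos_le (hL x (mem_filter.1 hx).2) hδ hr) ha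
  simp only [filter_filter] at h
  refine h.trans ?_
  have hc : ((univ.filter fun x => x ∉ L).card : ℝ) ≤ n := by
    exact_mod_cast (card_le_univ _).trans (by simp)
  have hV : 0 ≤ 𝔼 U, (t U - 𝔼 U, t U) ^ 2 := expect_nonneg fun _ _ => sq_nonneg _
  gcongr

end Threshold

section Variance

variable {X : Type*} [MeasurableSpace X] {μ : Measure X} {n : ℕ}

lemma measurable_expect {ι : Type*} [Fintype ι] {f : ι → X → ℝ} (hf : ∀ i, Measurable (f i)) :
    Measurable fun x => 𝔼 i, f i x := by
  simp only [Fintype.expect_eq_sum_div_card]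
  exact (Finset.measurable_sum _ fun i _ => hf i).div_const _

/-- The variance of the statistic over the queries, for given hash values, is mostly at most of the
order of its mean square distance from a constant. -/
lemma real_le_variance_le {t : X → Finset (Fin n) → ℝ} {a : ℝ} {v : Finset (Fin n) → ℝ}
    (hint : ∀ U, Integrable (fun x => (t x U - a) ^ 2) μ)
    (hv : ∀ U, ∫ x, (t x U - a) ^ 2 ∂μ ≤ v U) [IsProbabilityMeasure μ] {K : ℝ} (hK : 0 < K) :
    μ.real {x | K ≤ 𝔼 U, (t x U - 𝔼 U, t x U) ^ 2} ≤ (𝔼 U, v U) / K := by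
  have h1 : μ.real {x | K ≤ 𝔼 U, (t x U - 𝔼 U, t x U) ^ 2} ≤
      μ.real {x | K ≤ 𝔼 U, (t x U - a) ^ 2} := measureReal_mono fun x hx =>
    le_trans (by simpa using hx) (expect_sub_mean_sq_le (t x) a)
  refine h1.trans ?_
  have hint2 : Integrable (fun x => 𝔼 U, (t x U - a) ^ 2) μ := by
    simp only [Fintype.expect_eq_sum_div_card]
    exact (integrable_finsetSum _ fun U _ => hint U).div_const _
  have h2 := mul_meas_ge_le_integral_of_nonneg (μ := μ)
    (f := fun x => 𝔼 U, (t x U - a) ^ 2)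
    (.of_forall fun x => expect_nonneg fun _ _ => sq_nonneg _) hint2 K
  rw [le_div_iff₀ hK, mul_comm]
  refine h2.trans ?_
  simp only [Fintype.expect_eq_sum_div_card]
  rw [integral_div, integral_finsetSum _ fun U _ => hint U]
  gcongr with U
  exact hv U

/-- The mean square distance of the statistic from `2 k / n`, averaged over the sizes of a query. -/
lemma expect_size_le {k Λ : ℝ} (hk : 1 ≤ k) (hn : k ≤ n) (hΛ : 512 * (k * Λ) ≤ n) (hΛ0 : 0 ≤ Λ)
    {A B : ℝ} (hB : 0 ≤ B) :
    𝔼 U : Finset (Fin n), (A * k / n ^ 2 + B * (k ^ 2 / n ^ 4) * ((n : ℝ) - 2 * U.card) ^ 2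
      + if (U.card : ℝ) < n / 4 then (16 * k * Λ / n) ^ 2 else 0) ≤ (A + B + 1) * k / n ^ 2 := by
  have hn0 : (0 : ℝ) < n := by linarith
  have hn0' : 0 < n := by exact_mod_cast hn0
  rw [expect_add_distrib, expect_add_distrib, Fintype.expect_const, ← mul_expect,
    expect_sub_two_card_sq]
  have h1 : 𝔼 U : Finset (Fin n), (if (U.card : ℝ) < n / 4 then (16 * k * Λ / n) ^ 2 else 0)
      = (16 * k * Λ / n) ^ 2 * freq (fun U : Finset (Fin n) => (U.card : ℝ) < n / 4) := by
    unfold freq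
    rw [mul_expect]
    exact expect_congr rfl fun U _ => by split_ifs <;> simp
  -- The truncation level `16 k Λ / n` is at most a constant, and small queries have a probability
  -- of at most the order of `n⁻²`.
  have h2 : (16 * k * Λ / n) ^ 2 ≤ 1 / 128 := by
    have : 16 * k * Λ / n ≤ 1 / 32 := by
      rw [div_le_iff₀ hn0]; linarith
    have h0 : 0 ≤ 16 * k * Λ / n := by positivity
    nlinarith
  have h3 : (16 * k * Λ / n) ^ 2 * freq (fun U : Finset (Fin n) => (U.card : ℝ) < n / 4)
      ≤ k / n ^ 2 := by
    calc _ ≤ 1 / 128 * (128 / (n : ℝ) ^ 2) := by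
          gcongr
          · exact freq_nonneg _
          · exact freq_card_lt_le_sq hn0'
      _ = 1 / (n : ℝ) ^ 2 := by ring
      _ ≤ _ := by gcongr
  have h4 : B * (k ^ 2 / (n : ℝ) ^ 4) * n ≤ B * (k / n ^ 2) := by
    have : k ^ 2 / (n : ℝ) ^ 4 * n = k / n * (k / n ^ 2) := by field_simp
    rw [mul_assoc, this]
    gcongr
    calc _ ≤ 1 * (k / (n : ℝ) ^ 2) := by
          gcongr; rwa [div_le_one hn0]
      _ = _ := one_mul _
  rw [h1]
  calc _ ≤ A * k / n ^ 2 + B * (k / n ^ 2) + k / n ^ 2 := by gcongr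
    _ = _ := by ring

end Variance

/-- Markov's inequality for the number of keys with a small hash value. -/
lemma real_card_low_ge_le (s : SketchType) (k n : ℕ) {c a : ℝ} (hc : 0 ≤ c) (ha : 0 < a) :
    (hashMeasure s k n).real {ρ | a ≤ ((univ.filter fun x => ∃ l, ρ l x ≤ c).card : ℝ)}
      ≤ s.numHashes k * n * c / a := by
  have hm : ∀ (l : Fin (s.numHashes k)) (x : Fin n),
      MeasurableSet {ρ : Hashes s k n | ρ l x ≤ c} := fun l x =>
    measurableSet_le ((measurable_pi_apply x).comp (measurable_pi_apply l)) measurable_const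
  have h1 := real_le_sum_ite_le (μ := hashMeasure s k n)
    (univ : Finset (Fin (s.numHashes k) × Fin n)) (p := fun i ρ => ρ i.1 i.2 ≤ c)
    (fun i _ => hm i.1 i.2) ha
  refine le_trans (measureReal_mono fun ρ hρ => ?_) (h1.trans ?_)
  · refine le_trans (show a ≤ _ from hρ) ?_
    rw [Finset.sum_boole]
    have hsub : (univ.filter fun x => ∃ l, ρ l x ≤ c) ⊆
        (univ.filter fun i : Fin (s.numHashes k) × Fin n => ρ i.1 i.2 ≤ c).image Prod.snd := by
      intro x hx
      obtain ⟨l, hl⟩ := (mem_filter.1 hx).2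
      exact mem_image.2 ⟨(l, x), by simpa using hl, rfl⟩
    exact_mod_cast (card_le_card hsub).trans card_image_le
  · gcongr
    have h2 : ∀ i : Fin (s.numHashes k) × Fin n,
        (hashMeasure s k n).real {ρ | ρ i.1 i.2 ≤ c} ≤ c := by
      intro i
      refine real_le_of_resample (hm i.1 i.2) i.1 fun ρ => ?_
      simp only [Function.update_self]
      refine real_le_of_resample (p := fun h : Fin n → ℝ => h i.2 ≤ c)
        (measurableSet_le (measurable_pi_apply i.2) measurable_const) i.2 fun h => ?_
      simp only [Function.update_self]
      exact HashLike.real_Iic_le s.hashLaw hc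
    calc _ ≤ ∑ _i : Fin (s.numHashes k) × Fin n, c := sum_le_sum fun i _ => h2 i
      _ = _ := by simp

/-! ### Moments of order statistics of uniform values -/

section LayerCake

variable {X : Type*} [MeasurableSpace X] {μ : Measure X} [IsProbabilityMeasure μ]

/-- The layer cake formula for a bounded random variable, `E[G(f)] = ∫₀ᵇ G'(v) P(f > v) dv`. -/
lemma integral_comp_eq_intervalIntegral {f : X → ℝ} {b : ℝ} (hf : Measurable f)
    (h0 : ∀ᵐ x ∂μ, 0 ≤ f x) (hb : ∀ᵐ x ∂μ, f x ≤ b) {G g : ℝ → ℝ} (hg : Continuous g)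
    (hg0 : ∀ v, 0 ≤ v → 0 ≤ g v) (hG : ∀ v, 0 ≤ v → ∫ t in (0 : ℝ)..v, g t = G v) :
    ∫ x, G (f x) ∂μ = ∫ v in (0 : ℝ)..b, g v * μ.real {x | v < f x} := by
  have hb0 : 0 ≤ b := by
    obtain ⟨x, h1, h2⟩ := (h0.and hb).exists
    exact h1.trans h2
  have hgi : ∀ t > 0, IntervalIntegrable g volume 0 t := fun t _ => hg.intervalIntegrable _ _
  have hg' : ∀ᵐ t ∂volume.restrict (Set.Ioi 0), 0 ≤ g t := by
    filter_upwards [ae_restrict_mem measurableSet_Ioi] with t ht using hg0 t (le_of_lt ht)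
  have key := lintegral_comp_eq_lintegral_meas_lt_mul μ h0 hf.aemeasurable hgi hg'
  have hae : (fun x => ∫ t in (0 : ℝ)..f x, g t) =ᵐ[μ] fun x => G (f x) := by
    filter_upwards [h0] with x hx using hG _ hx
  have hGnn : 0 ≤ᵐ[μ] fun x => ∫ t in (0 : ℝ)..f x, g t := by
    filter_upwards [h0] with x hx
    exact intervalIntegral.integral_nonneg hx fun t ht => hg0 t ht.1
  have hGm : Measurable fun x => ∫ t in (0 : ℝ)..f x, g t :=
    (intervalIntegral.continuous_primitive (fun a b => hg.intervalIntegrable a b) 0).measurable.comp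
      hf
  rw [← integral_congr_ae hae, integral_eq_lintegral_of_nonneg_ae hGnn hGm.aestronglyMeasurable,
    key, intervalIntegral.integral_of_le hb0]
  have hanti : Antitone fun v : ℝ => μ.real {x | v < f x} := fun v w hvw =>
    measureReal_mono fun x hx => lt_of_le_of_lt hvw hx
  rw [integral_eq_lintegral_of_nonneg_ae]
  · congr 1
    rw [← Set.Ioc_union_Ioi_eq_Ioi hb0, lintegral_union measurableSet_Ioi
      (Set.disjoint_left.2 fun x hx hx' => not_lt.2 hx.2 hx')]
    have h1 : ∫⁻ t in Set.Ioi b, μ {a | t < f a} * ENNReal.ofReal (g t) = 0 := by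
      refine (setLIntegral_congr_fun measurableSet_Ioi fun t ht => ?_).trans lintegral_zero
      have : μ {a | t < f a} = 0 := by
        refine measure_mono_null (fun x hx => ?_) (ae_iff.1 hb)
        simp only [Set.mem_ofPred_eq, not_le] at hx ⊢
        exact lt_trans ht hx
      simp only [this, zero_mul]
    rw [h1, add_zero]
    refine setLIntegral_congr_fun measurableSet_Ioc fun t ht => ?_
    rw [ENNReal.ofReal_mul (hg0 t ht.1.le), mul_comm, ofReal_measureReal]
  · filter_upwards [ae_restrict_mem measurableSet_Ioc] with t ht
    exact mul_nonneg (hg0 t ht.1.le) measureReal_nonneg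
  · exact (hg.measurable.mul hanti.measurable).aestronglyMeasurable

lemma integral_eq_intervalIntegral {f : X → ℝ} {b : ℝ} (hf : Measurable f)
    (h0 : ∀ᵐ x ∂μ, 0 ≤ f x) (hb : ∀ᵐ x ∂μ, f x ≤ b) :
    ∫ x, f x ∂μ = ∫ v in (0 : ℝ)..b, μ.real {x | v < f x} := by
  have := integral_comp_eq_intervalIntegral (μ := μ) hf h0 hb (G := id) (g := fun _ => 1)
    continuous_const (fun _ _ => zero_le_one) (fun v _ => by simp)
  simpa using this

lemma integral_sq_eq_intervalIntegral {f : X → ℝ} {b : ℝ} (hf : Measurable f)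
    (h0 : ∀ᵐ x ∂μ, 0 ≤ f x) (hb : ∀ᵐ x ∂μ, f x ≤ b) :
    ∫ x, f x ^ 2 ∂μ = ∫ v in (0 : ℝ)..b, 2 * v * μ.real {x | v < f x} :=
  integral_comp_eq_intervalIntegral (μ := μ) hf h0 hb (G := fun v => v ^ 2) (g := fun v => 2 * v)
    (by fun_prop) (fun _ h => by positivity) (fun v _ => by
      rw [intervalIntegral.integral_const_mul, integral_id]; ring)

end LayerCake

/-- The beta integral with integer exponents, by repeated integration by parts. -/
lemma integral_pow_mul_one_sub_pow (a b : ℕ) :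
    ∫ v in (0 : ℝ)..1, v ^ a * (1 - v) ^ b = 1 / ((a + b + 1) * ((a + b).choose a : ℝ)) := by
  induction b generalizing a with
  | zero => simp
  | succ b ih =>
    have h1 : ∀ v : ℝ, HasDerivAt (fun v : ℝ => v ^ (a + 1) * (1 - v) ^ (b + 1))
        ((a + 1) * (v ^ a * (1 - v) ^ (b + 1)) - (b + 1) * (v ^ (a + 1) * (1 - v) ^ b)) v := by
      intro v
      have h2 : HasDerivAt (fun v : ℝ => v ^ (a + 1)) ((a + 1) * v ^ a) v := by
        simpa using hasDerivAt_pow (a + 1) v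
      have h3 : HasDerivAt (fun v : ℝ => (1 - v) ^ (b + 1)) (-((b + 1) * (1 - v) ^ b)) v := by
        have := ((hasDerivAt_id v).const_sub 1).fun_pow (b + 1)
        simpa using this
      exact (h2.mul h3).congr_deriv (by ring)
    have h4 := intervalIntegral.integral_eq_sub_of_hasDerivAt (fun v _ => h1 v)
      (Continuous.intervalIntegrable (by fun_prop) 0 1)
    rw [intervalIntegral.integral_sub (Continuous.intervalIntegrable (by fun_prop) 0 1)
      (Continuous.intervalIntegrable (by fun_prop) 0 1), intervalIntegral.integral_const_mul,
      intervalIntegral.integral_const_mul, ih (a + 1)] at h4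
    simp only [one_pow, sub_self, ne_eq, Nat.add_eq_zero_iff, one_ne_zero, and_false,
      not_false_eq_true, zero_pow, mul_zero, sub_zero, zero_mul] at h4
    have h5 : ((a + 1 + b).choose (a + 1) : ℝ) * (a + 1) = ((a + (b + 1)).choose a : ℝ) * (b + 1) := by
      have := Nat.choose_succ_right_eq (a + (b + 1)) a
      rw [show a + (b + 1) - a = b + 1 by omega] at this
      rw [show a + 1 + b = a + (b + 1) by ring]
      exact_mod_cast this
    have h6 : (0 : ℝ) < (a + 1 + b).choose (a + 1) := by
      exact_mod_cast Nat.choose_pos (by omega)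
    have h7 : (0 : ℝ) < (a + (b + 1)).choose a := by
      exact_mod_cast Nat.choose_pos (by omega)
    have h8 : ((a : ℝ) + 1) * ∫ v in (0 : ℝ)..1, v ^ a * (1 - v) ^ (b + 1) =
        (b + 1) * (1 / (((a + 1 : ℕ) + b + 1) * ((a + 1 + b).choose (a + 1) : ℝ))) := by
      linarith
    have h9 : (a : ℝ) + 1 ≠ 0 := by positivity
    apply mul_left_cancel₀ h9
    rw [h8]
    push_cast
    field_simp
    linear_combination (-(a + b + 2) : ℝ) * h5

lemma integral_choose_mul_pow {m j : ℕ} (hj : j ≤ m) :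
    ∫ v in (0 : ℝ)..1, (m.choose j : ℝ) * (v ^ j * (1 - v) ^ (m - j)) = 1 / (m + 1) := by
  rw [intervalIntegral.integral_const_mul, integral_pow_mul_one_sub_pow,
    show j + (m - j) = m by omega]
  have h1 : (0 : ℝ) < m.choose j := by exact_mod_cast Nat.choose_pos hj
  rw [← Nat.cast_add, show j + (m - j) = m by omega]
  field_simp

lemma integral_mul_choose_mul_pow {m j : ℕ} (hj : j ≤ m) :
    ∫ v in (0 : ℝ)..1, v * ((m.choose j : ℝ) * (v ^ j * (1 - v) ^ (m - j)))
      = (j + 1) / ((m + 1) * (m + 2)) := by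
  have h0 : ∀ v : ℝ, v * ((m.choose j : ℝ) * (v ^ j * (1 - v) ^ (m - j)))
      = (m.choose j : ℝ) * (v ^ (j + 1) * (1 - v) ^ (m - j)) := fun v => by ring
  simp only [h0]
  rw [intervalIntegral.integral_const_mul, integral_pow_mul_one_sub_pow,
    ← Nat.cast_add, show j + 1 + (m - j) = m + 1 by omega]
  have h1 : (0 : ℝ) < m.choose j := by exact_mod_cast Nat.choose_pos hj
  have h2 : ((m + 1).choose (j + 1) : ℝ) * (j + 1) = (m + 1) * m.choose j := by
    have := Nat.add_one_mul_choose_eq m j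
    exact_mod_cast this.symm
  have h3 : (0 : ℝ) < (m + 1).choose (j + 1) := by exact_mod_cast Nat.choose_pos (by omega)
  push_cast
  field_simp
  linear_combination (-(m + 2) : ℝ) * h2

section Uniform

variable {n : ℕ}

/-- The law of the hash values of a bottom-`k` sketch. -/
abbrev unifRow (n : ℕ) : Measure (Fin n → ℝ) := Measure.pi fun _ : Fin n => unifLaw

lemma unifRow_real_filter_eq {v : ℝ} (hv : 0 ≤ v) (hv1 : v ≤ 1) {U S : Finset (Fin n)}
    (hS : S ⊆ U) : (unifRow n).real {h | (U.filter fun x => h x ≤ v) = S}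
      = v ^ S.card * (1 - v) ^ (U.card - S.card) := by
  have h1 : {h : Fin n → ℝ | (U.filter fun x => h x ≤ v) = S} = Set.pi Set.univ fun x =>
      if x ∈ S then Set.Iic v else if x ∈ U then Set.Ioi v else Set.univ := by
    ext h
    simp only [Set.mem_ofPred_eq, Set.mem_pi, Set.mem_univ, true_implies, Finset.ext_iff,
      mem_filter]
    refine forall_congr' fun x => ?_
    by_cases hxS : x ∈ S
    · simp [hxS, hS hxS]
    · by_cases hxU : x ∈ U <;> simp [hxS, hxU]
  have hIoi : unifLaw.real (Set.Ioi v) = 1 - v := by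
    rw [← Set.compl_Iic, probReal_compl_eq_one_sub measurableSet_Iic, unifLaw_real_Iic hv hv1]
  have h2 : ∀ x, unifLaw.real (if x ∈ S then Set.Iic v else if x ∈ U then Set.Ioi v else Set.univ)
      = (if x ∈ S then v else 1) * (if x ∈ U \ S then 1 - v else 1) := by
    intro x
    by_cases hxS : x ∈ S
    · simp [hxS, unifLaw_real_Iic hv hv1]
    · by_cases hxU : x ∈ U <;> simp [hxS, hxU, hIoi]
  rw [h1, measureReal_def, Measure.pi_pi, ENNReal.toReal_prod]
  change ∏ x, unifLaw.real _ = _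
  simp only [h2]
  rw [prod_mul_distrib, prod_ite_mem, prod_ite_mem, univ_inter, univ_inter, prod_const, prod_const,
    card_sdiff_of_subset hS]

/-- The `k`-th smallest value exceeds `v` if fewer than `k` values are at most `v`; their number
has a binomial law. -/
lemma unifRow_real_lt_kth {k : ℕ} (hk : 0 < k) {U : Finset (Fin n)} {v : ℝ} (hv : 0 ≤ v)
    (hv1 : v < 1) : (unifRow n).real {h | v < kth k h U}
      = ∑ j ∈ range k, (U.card.choose j : ℝ) * (v ^ j * (1 - v) ^ (U.card - j)) := by
  have h1 : {h : Fin n → ℝ | v < kth k h U} =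
      ⋃ S ∈ U.powerset.filter fun S => S.card < k, {h | (U.filter fun x => h x ≤ v) = S} := by
    ext h
    rw [Set.mem_ofPred_eq, ← not_le, kth_le_iff_of_lt_one hk _ _ hv1]
    simp [filter_subset]
  rw [h1, measureReal_biUnion_finset]
  · rw [sum_congr rfl fun S hS => unifRow_real_filter_eq hv hv1.le
      (mem_powerset.1 (mem_filter.1 hS).1), sum_filter]
    rw [sum_powerset_apply_card
      (fun j => if j < k then v ^ j * (1 - v) ^ (U.card - j) else 0)]
    have h2 : ∀ j, (if j < k then v ^ j * (1 - v) ^ (U.card - j) else 0) =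
        if j ∈ range k then v ^ j * (1 - v) ^ (U.card - j) else 0 := by simp
    simp only [nsmul_eq_mul, h2, mul_ite, mul_zero]
    rw [← sum_filter, ← sum_subset (s₁ := (range (U.card + 1)).filter fun j => j ∈ range k)
      (s₂ := range k)]
    · intro j hj; exact (mem_filter.1 hj).2
    · intro j hj hj'
      have : U.card < j := by
        by_contra hc
        exact hj' (mem_filter.2 ⟨mem_range.2 (by omega), hj⟩)
      simp [Nat.choose_eq_zero_of_lt this]
  · intro S _ S' _ hne
    refine Set.disjoint_left.2 fun h hS hS' => hne ?_
    exact (show _ = S from hS).symm.trans hS'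
  · intro S _
    have : {h : Fin n → ℝ | (U.filter fun x => h x ≤ v) = S} =
        ⋂ x, {h | (x ∈ U ∧ h x ≤ v) ↔ x ∈ S} := by
      ext h; simp [Finset.ext_iff]
    rw [this]
    refine MeasurableSet.iInter fun x => ?_
    exact MeasurableSet.iff (MeasurableSet.inter (MeasurableSet.const _)
      (measurableSet_le (measurable_pi_apply x) measurable_const)) (MeasurableSet.const _)

lemma ae_unifRow : ∀ᵐ h ∂unifRow n, ∀ x, 0 < h x ∧ h x ≤ 1 := by
  have h1 : ∀ᵐ x ∂unifLaw, 0 < x ∧ x ≤ 1 := by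
    have : ∀ᵐ x ∂unifLaw, x ≤ 1 := by
      unfold unifLaw
      filter_upwards [ae_restrict_mem measurableSet_Icc] with x hx using hx.2
    filter_upwards [HashLike.ae_pos _, this] with x h1 h2 using ⟨h1, h2⟩
  rw [ae_all_iff]; intro x
  exact (measurePreserving_eval (fun _ : Fin n => unifLaw) x).quasiMeasurePreserving.ae h1

/-- The mean of the `k`-th smallest of `m` uniform values is `k / (m + 1)`. -/
lemma integral_kth {k : ℕ} (hk : 0 < k) {U : Finset (Fin n)} (hU : k ≤ U.card) :
    ∫ h, kth k h U ∂unifRow n = k / (U.card + 1) := by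
  rw [integral_eq_intervalIntegral (measurable_kth hk U) (b := 1)
    (by filter_upwards [ae_unifRow] with h hh using (kth_pos hk (fun x => (hh x).1) U).le)
    (by filter_upwards [ae_unifRow] with h hh using kth_le_one hk (fun x => (hh x).2) U)]
  rw [intervalIntegral.integral_congr_Ioo_of_le zero_le_one (g := fun v => ∑ j ∈ range k,
    (U.card.choose j : ℝ) * (v ^ j * (1 - v) ^ (U.card - j)))
    fun v hv => unifRow_real_lt_kth hk hv.1.le hv.2]
  rw [intervalIntegral.integral_finsetSum fun j _ =>
    Continuous.intervalIntegrable (by fun_prop) 0 1]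
  rw [sum_congr rfl fun j hj => integral_choose_mul_pow
    (show j ≤ U.card by have := mem_range.1 hj; omega)]
  simp [div_eq_mul_inv]

lemma integral_kth_sq {k : ℕ} (hk : 0 < k) {U : Finset (Fin n)} (hU : k ≤ U.card) :
    ∫ h, kth k h U ^ 2 ∂unifRow n = k * (k + 1) / ((U.card + 1) * (U.card + 2)) := by
  rw [integral_sq_eq_intervalIntegral (measurable_kth hk U) (b := 1)
    (by filter_upwards [ae_unifRow] with h hh using (kth_pos hk (fun x => (hh x).1) U).le)
    (by filter_upwards [ae_unifRow] with h hh using kth_le_one hk (fun x => (hh x).2) U)]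
  rw [intervalIntegral.integral_congr_Ioo_of_le zero_le_one (g := fun v => ∑ j ∈ range k,
    2 * (v * ((U.card.choose j : ℝ) * (v ^ j * (1 - v) ^ (U.card - j)))))
    fun v hv => by
      simp only
      rw [unifRow_real_lt_kth hk hv.1.le hv.2, mul_assoc, mul_sum, mul_sum]]
  rw [intervalIntegral.integral_finsetSum fun j _ =>
    Continuous.intervalIntegrable (by fun_prop) 0 1]
  simp only [intervalIntegral.integral_const_mul]
  rw [sum_congr rfl fun j hj => by rw [integral_mul_choose_mul_pow
    (show j ≤ U.card by have := mem_range.1 hj; omega)]]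
  rw [← mul_sum, ← sum_div, sum_add_distrib]
  have h := Finset.sum_range_id_mul_two k
  have h' : (∑ j ∈ range k, (j : ℝ)) * 2 = k * (k - 1) := by
    have h2 : (((∑ j ∈ range k, j) * 2 : ℕ) : ℝ) = ((k * (k - 1) : ℕ) : ℝ) := by rw [h]
    push_cast [Nat.cast_sub hk] at h2
    exact h2
  simp only [sum_const, card_range, nsmul_eq_mul, mul_one]
  rw [mul_div_assoc']
  congr 1
  linarith

end Uniform

/-! ### The inverse square root of a hash value -/

section InvSqrt

/-- `u ↦ u ^ (-1/2)` on `(0, s]`, extended by `0`. -/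
def invSqrtBelow (s u : ℝ) : ℝ := if u ∈ Set.Ioc 0 s then u ^ (-(1 / 2) : ℝ) else 0

lemma invSqrtBelow_nonneg (s u : ℝ) : 0 ≤ invSqrtBelow s u := by
  unfold invSqrtBelow
  split_ifs with h
  · exact Real.rpow_nonneg h.1.le _
  · exact le_rfl

lemma measurable_invSqrtBelow (s : ℝ) : Measurable (invSqrtBelow s) :=
  Measurable.ite measurableSet_Ioc (by fun_prop) measurable_const

/-- A density that is at most `1` is no worse than Lebesgue measure, for which
`∫₀ˢ u^{-1/2} = 2√s`. -/
lemma lintegral_invSqrtBelow_le (ν : Measure ℝ) [HashLike ν] {s : ℝ} (hs : 0 ≤ s) :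
    ∫⁻ u, ENNReal.ofReal (invSqrtBelow s u) ∂ν ≤ ENNReal.ofReal (2 * √s) := by
  have h1 : ∀ u, ENNReal.ofReal (invSqrtBelow s u) =
      (Set.Ioc 0 s).indicator (fun u => ENNReal.ofReal (u ^ (-(1 / 2) : ℝ))) u := fun u => by
    unfold invSqrtBelow
    rw [Set.indicator_apply]
    split_ifs <;> simp
  have hi : IntegrableOn (fun u : ℝ => u ^ (-(1 / 2) : ℝ)) (Set.Ioc 0 s) :=
    (intervalIntegrable_iff_integrableOn_Ioc_of_le hs).1
      (intervalIntegral.intervalIntegrable_rpow' (by norm_num))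
  calc _ ≤ ∫⁻ u, ENNReal.ofReal (invSqrtBelow s u) := lintegral_mono' (HashLike.le_volume) le_rfl
    _ = ∫⁻ u in Set.Ioc 0 s, ENNReal.ofReal (u ^ (-(1 / 2) : ℝ)) := by
      simp only [h1]; rw [lintegral_indicator measurableSet_Ioc]
    _ = ENNReal.ofReal (∫ u in Set.Ioc 0 s, u ^ (-(1 / 2) : ℝ)) := by
      refine (ofReal_integral_eq_lintegral_ofReal hi ?_).symm
      filter_upwards [ae_restrict_mem measurableSet_Ioc] with u hu using Real.rpow_nonneg hu.1.le _
    _ ≤ _ := by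
      rw [← intervalIntegral.integral_of_le hs, integral_rpow (Or.inl (by norm_num)),
        Real.sqrt_eq_rpow]
      refine ENNReal.ofReal_le_ofReal (le_of_eq ?_)
      norm_num
      ring

variable {n : ℕ} (ν : Measure ℝ) [HashLike ν]

lemma lintegral_eval (x : Fin n) {F : ℝ → ℝ≥0∞} (hF : Measurable F) :
    ∫⁻ h : Fin n → ℝ, F (h x) ∂(Measure.pi fun _ => ν) = ∫⁻ u, F u ∂ν :=
  (measurePreserving_eval (fun _ : Fin n => ν) x).lintegral_comp hF

lemma lintegral_mul_eval {x y : Fin n} (hxy : x ≠ y) {F : ℝ → ℝ≥0∞} (hF : Measurable F) :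
    ∫⁻ h : Fin n → ℝ, F (h x) * F (h y) ∂(Measure.pi fun _ => ν) = (∫⁻ u, F u ∂ν) ^ 2 := by
  rw [lintegral_resample (f := fun h : Fin n → ℝ => F (h x) * F (h y))
    ((hF.comp (measurable_pi_apply x)).mul (hF.comp (measurable_pi_apply y))) x]
  simp only [Function.update_self, Function.update_of_ne hxy.symm]
  have : ∀ h : Fin n → ℝ, ∫⁻ a, F a * F (h y) ∂ν = (∫⁻ u, F u ∂ν) * F (h y) := fun h =>
    lintegral_mul_const _ hF
  simp only [this]
  rw [lintegral_const_mul (f := fun h : Fin n → ℝ => F (h y)) _ (hF.comp (measurable_pi_apply y)),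
    lintegral_eval ν y hF, sq]

end InvSqrt

/-! ### Bottom-`k` sketches -/

lemma freq_eq {Ω : Type*} [Fintype Ω] (p : Ω → Prop) [DecidablePred p] :
    freq p = 𝔼 ω, if p ω then (1 : ℝ) else 0 := by
  unfold freq
  exact expect_congr rfl fun ω _ => by by_cases h : p ω <;> simp [h]

section BottomK

variable {n k : ℕ}

lemma exists_eq_kth {j : ℕ} (hj : 0 < j) {h : Fin n → ℝ} {U : Finset (Fin n)}
    (hlt : kth j h U < 1) : ∃ x ∈ U, h x = kth j h U := by
  by_contra hne
  push Not at hne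
  have h1 := (kth_le_iff_of_lt_one hj h U hlt).1 le_rfl
  set F := U.filter fun x => h x ≤ kth j h U with hF
  have hFne : F.Nonempty := card_pos.1 (by omega)
  obtain ⟨z, hz, hmax⟩ := exists_max_image F h hFne
  have hz' := mem_filter.1 hz
  have hzlt : h z < kth j h U := lt_of_le_of_ne hz'.2 (hne z hz'.1)
  refine not_le.2 hzlt ((kth_le_iff_of_lt_one hj h U (hzlt.trans hlt)).2 (h1.trans ?_))
  exact card_le_card fun x hx => mem_filter.2 ⟨(mem_filter.1 hx).1, hmax x hx⟩

lemma kth_congr {j : ℕ} {h h' : Fin n → ℝ} {U : Finset (Fin n)} (hh : ∀ x ∈ U, h x = h' x) :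
    kth j h U = kth j h' U := by
  unfold kth
  rw [Multiset.map_congr rfl hh]

/-- The expected estimate of all the keys is `O(n)`. Below `s = k / n`, the inverse of the `k`-th
smallest value `τ` is at most `(h x)^{-1/2} (h y)^{-1/2}` for each of the `k (k - 1)` pairs of
different keys `x`, `y` with values at most `τ`; the sum over all the pairs has a finite mean, by
independence. -/
lemma lintegral_estimate_bottomK_le (hk : 2 ≤ k) (hn : k ≤ n) :
    ∫⁻ h, ENNReal.ofReal (((k : ℝ) - 1) / kth k h univ) ∂unifRow n
      ≤ ENNReal.ofReal (5 * n) := by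
  have hk2 : (2 : ℝ) ≤ k := by exact_mod_cast hk
  have hn2 : (k : ℝ) ≤ n := by exact_mod_cast hn
  have hn0 : (0 : ℝ) < n := by linarith
  set s : ℝ := k / n with hs
  have hs0 : 0 < s := by positivity
  set F : ℝ → ℝ≥0∞ := fun u => ENNReal.ofReal (invSqrtBelow s u) with hF
  have hFm : Measurable F := (measurable_invSqrtBelow s).ennreal_ofReal
  have hpt : ∀ᵐ h ∂unifRow n, ENNReal.ofReal (((k : ℝ) - 1) / kth k h univ) ≤
      ENNReal.ofReal n + ENNReal.ofReal (1 / k) * ∑ p ∈ univ.offDiag, F (h p.1) * F (h p.2) := by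
    filter_upwards [ae_unifRow] with h hh
    have hτ := kth_pos (j := k) (by omega) (fun x => (hh x).1) univ
    have hτ1 := kth_le_one (j := k) (by omega) (fun x => (hh x).2) univ
    have hsum0 : 0 ≤ ∑ p ∈ (univ : Finset (Fin n)).offDiag, invSqrtBelow s (h p.1) * invSqrtBelow s (h p.2) :=
      sum_nonneg fun p _ => mul_nonneg (invSqrtBelow_nonneg _ _) (invSqrtBelow_nonneg _ _)
    have hconv : ∑ p ∈ (univ : Finset (Fin n)).offDiag, F (h p.1) * F (h p.2) =
        ENNReal.ofReal (∑ p ∈ (univ : Finset (Fin n)).offDiag, invSqrtBelow s (h p.1) * invSqrtBelow s (h p.2)) := by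
      rw [ENNReal.ofReal_sum_of_nonneg fun p _ => mul_nonneg (invSqrtBelow_nonneg _ _)
        (invSqrtBelow_nonneg _ _)]
      exact sum_congr rfl fun p _ => (ENNReal.ofReal_mul (invSqrtBelow_nonneg _ _)).symm
    rw [hconv, ← ENNReal.ofReal_mul (by positivity), ← ENNReal.ofReal_add hn0.le (by positivity)]
    refine ENNReal.ofReal_le_ofReal ?_
    by_cases hcase : kth k h univ ≤ s
    · have h1 : k ≤ (univ.filter fun x => h x ≤ kth k h univ).card := by
        rcases (kth_le_iff (by omega) h univ (kth k h univ)).1 le_rfl with h2 | h2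
        · exact h2
        · simp at h2; omega
      obtain ⟨A, hA, hAk⟩ := exists_subset_card_eq h1
      set τ := kth k h univ with hτdef
      have hterm : ∀ x ∈ A, τ ^ (-(1 / 2) : ℝ) ≤ invSqrtBelow s (h x) := fun x hx => by
        have hx' := (mem_filter.1 (hA hx)).2
        rw [invSqrtBelow, if_pos ⟨(hh x).1, hx'.trans hcase⟩]
        exact Real.rpow_le_rpow_of_nonpos (hh x).1 hx' (by norm_num)
      have hsq : τ ^ (-(1 / 2) : ℝ) * τ ^ (-(1 / 2) : ℝ) = τ⁻¹ := by
        rw [← Real.rpow_add hτ]; norm_num [Real.rpow_neg_one]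
      have h3 : (k : ℝ) * (k - 1) * τ⁻¹ ≤
          ∑ p ∈ (univ : Finset (Fin n)).offDiag, invSqrtBelow s (h p.1) * invSqrtBelow s (h p.2) := by
        calc (k : ℝ) * (k - 1) * τ⁻¹ = ∑ p ∈ A.offDiag, τ⁻¹ := by
              rw [sum_const, offDiag_card, hAk, nsmul_eq_mul,
                Nat.cast_sub (Nat.le_mul_self k)]
              push_cast; ring
          _ ≤ ∑ p ∈ A.offDiag, invSqrtBelow s (h p.1) * invSqrtBelow s (h p.2) := by
              refine sum_le_sum fun p hp => ?_
              rw [mem_offDiag] at hp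
              rw [← hsq]
              exact mul_le_mul (hterm _ hp.1) (hterm _ hp.2.1) (Real.rpow_nonneg hτ.le _)
                (invSqrtBelow_nonneg _ _)
          _ ≤ _ := sum_le_sum_of_subset_of_nonneg (offDiag_mono (subset_univ A)) fun p _ _ =>
              mul_nonneg (invSqrtBelow_nonneg _ _) (invSqrtBelow_nonneg _ _)
      have h4 : ((k : ℝ) - 1) / τ = 1 / k * ((k : ℝ) * (k - 1) * τ⁻¹) := by
        field_simp
      rw [h4]
      have := mul_le_mul_of_nonneg_left h3 (by positivity : (0 : ℝ) ≤ 1 / k)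
      linarith
    · rw [not_le] at hcase
      have : ((k : ℝ) - 1) / kth k h univ ≤ n := by
        rw [div_le_iff₀ hτ]
        have h2 : (n : ℝ) * s ≤ n * kth k h univ := by gcongr
        have h3 : (n : ℝ) * s = k := by rw [hs]; field_simp
        linarith
      have h0 : 0 ≤ 1 / (k : ℝ) * ∑ p ∈ (univ : Finset (Fin n)).offDiag, invSqrtBelow s (h p.1) * invSqrtBelow s (h p.2) := by
        positivity
      linarith
  have hm : ∀ p : Fin n × Fin n, Measurable fun h : Fin n → ℝ => F (h p.1) * F (h p.2) := fun p =>
    (hFm.comp (measurable_pi_apply p.1)).mul (hFm.comp (measurable_pi_apply p.2))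
  calc _ ≤ _ := lintegral_mono_ae hpt
    _ = ENNReal.ofReal n + ENNReal.ofReal (1 / k) *
        ∑ p ∈ (univ : Finset (Fin n)).offDiag, (∫⁻ u, F u ∂unifLaw) ^ 2 := by
      rw [lintegral_add_left measurable_const, lintegral_const_mul _
        (Finset.measurable_sum _ fun p _ => hm p), lintegral_finsetSum _ fun p _ => hm p]
      simp only [lintegral_const, measure_univ, mul_one]
      congr 2
      exact sum_congr rfl fun p hp => lintegral_mul_eval unifLaw (mem_offDiag.1 hp).2.2 hFm
    _ ≤ ENNReal.ofReal n + ENNReal.ofReal (1 / k) *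
        ∑ p ∈ (univ : Finset (Fin n)).offDiag, ENNReal.ofReal (2 * √s) ^ 2 := by
      gcongr
      exact lintegral_invSqrtBelow_le _ hs0.le
    _ ≤ ENNReal.ofReal n + ENNReal.ofReal (1 / k) * (ENNReal.ofReal (n * n) * ENNReal.ofReal (4 * s)) := by
      rw [sum_const, nsmul_eq_mul]
      gcongr
      · rw [offDiag_card, card_univ, Fintype.card_fin, ← Nat.cast_mul, ENNReal.ofReal_natCast]
        exact_mod_cast Nat.sub_le _ _
      · rw [← ENNReal.ofReal_pow (by positivity), mul_pow, Real.sq_sqrt hs0.le]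
        norm_num
    _ = ENNReal.ofReal (5 * n) := by
      rw [← ENNReal.ofReal_mul (by positivity), ← ENNReal.ofReal_mul (by positivity),
        ← ENNReal.ofReal_add (by positivity) (by positivity), hs]
      congr 1
      field_simp
      norm_num

/-- The mean square distance of the truncated statistic of `U` from `2 k / n`, the typical value
for a query. It consists of a term of order `k / n²` for the fluctuation of the hash values, of a
term for the deviation of the size of `U` from `n / 2`, and of a trivial bound for small sets `U`.
-/
lemma integral_min_kth_sub_sq_le (hk : 1 ≤ k) {Λ : ℝ} (hΛ1 : 1 ≤ Λ) (hΛ : 512 * (k * Λ) ≤ n)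
    (U : Finset (Fin n)) :
    ∫ h, (min (16 * k * Λ / n) (kth k h U) - 2 * k / n) ^ 2 ∂unifRow n
      ≤ 144 * k / n ^ 2 + 32 * ((k : ℝ) ^ 2 / n ^ 4) * ((n : ℝ) - 2 * U.card) ^ 2
      + if (U.card : ℝ) < n / 4 then (16 * k * Λ / n) ^ 2 else 0 := by
  have hk1 : (1 : ℝ) ≤ k := by exact_mod_cast hk
  have hkΛ : (k : ℝ) ≤ k * Λ := le_mul_of_one_le_right (by positivity) hΛ1
  have hn0 : (0 : ℝ) < n := by linarith
  set c : ℝ := 16 * k * Λ / n with hc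
  set a : ℝ := 2 * k / n with ha
  have hac : a ≤ c := by
    rw [ha, hc, div_le_div_iff_of_pos_right hn0]; linarith
  have ha0 : 0 < a := by positivity
  have hX : 0 ≤ 144 * k / (n : ℝ) ^ 2 + 32 * ((k : ℝ) ^ 2 / n ^ 4) * ((n : ℝ) - 2 * U.card) ^ 2 := by
    positivity
  have hmk := measurable_kth (n := n) (j := k) (by omega) U
  have hbd : ∀ f : (Fin n → ℝ) → ℝ, Measurable f → ∀ C, (∀ᵐ h ∂unifRow n, |f h| ≤ C) →
      Integrable f (unifRow n) := fun f hf C hC =>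
    (integrable_const C).mono' hf.aestronglyMeasurable (by simpa using hC)
  have hpos : ∀ᵐ h ∂unifRow n, 0 < kth k h U ∧ kth k h U ≤ 1 := by
    filter_upwards [ae_unifRow] with h hh
    exact ⟨kth_pos (by omega) (fun x => (hh x).1) U, kth_le_one (by omega) (fun x => (hh x).2) U⟩
  by_cases hU : (U.card : ℝ) < n / 4
  · rw [if_pos hU]
    have h1 : ∀ᵐ h ∂unifRow n, (min c (kth k h U) - a) ^ 2 ≤ c ^ 2 := by
      filter_upwards [hpos] with h hh
      refine sq_le_sq.2 ?_
      rw [abs_of_pos (ha0.trans_le hac), abs_le]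
      have h1 : min c (kth k h U) ≤ c := min_le_left _ _
      have h2 : 0 ≤ min c (kth k h U) := le_min (ha0.le.trans hac) hh.1.le
      constructor <;> linarith
    have h2 : ∫ h, (min c (kth k h U) - a) ^ 2 ∂unifRow n ≤ ∫ _h, c ^ 2 ∂unifRow n := by
      refine integral_mono_ae (hbd _ ((measurable_const.min hmk).sub_const _ |>.pow_const 2) (c ^ 2) ?_)
        (integrable_const _) h1
      filter_upwards [h1] with h hh
      rwa [abs_of_nonneg (sq_nonneg _)]
    simp at h2
    linarith
  · rw [if_neg hU, add_zero]
    rw [not_lt] at hU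
    have hkU : k ≤ U.card := by
      have : (k : ℝ) ≤ U.card := by linarith
      exact_mod_cast this
    have hi1 : Integrable (fun h => kth k h U) (unifRow n) := hbd _ hmk 1 (by
      filter_upwards [hpos] with h hh
      rw [abs_of_pos hh.1]; exact hh.2)
    have hi2 : Integrable (fun h => kth k h U ^ 2) (unifRow n) := hbd _ (hmk.pow_const 2) 1 (by
      filter_upwards [hpos] with h hh
      rw [abs_of_pos (pow_pos hh.1 2)]; exact pow_le_one₀ hh.1.le hh.2)
    have hexp : ∀ h : Fin n → ℝ, (kth k h U - a) ^ 2 = kth k h U ^ 2 - 2 * a * kth k h U + a ^ 2 :=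
      fun h => by ring
    have hi3 : Integrable (fun h => (kth k h U - a) ^ 2) (unifRow n) := by
      simp only [hexp]
      exact (hi2.sub (hi1.const_mul _)).add (integrable_const _)
    have h1 : ∀ h : Fin n → ℝ, (min c (kth k h U) - a) ^ 2 ≤ (kth k h U - a) ^ 2 := by
      intro h
      rcases le_total (kth k h U) c with h1 | h1
      · rw [min_eq_right h1]
      · rw [min_eq_left h1]
        exact pow_le_pow_left₀ (by linarith) (by linarith) 2
    have hi4 : Integrable (fun h => (min c (kth k h U) - a) ^ 2) (unifRow n) :=
      hi3.mono' ((measurable_const.min hmk).sub_const _ |>.pow_const 2).aestronglyMeasurable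
        (.of_forall fun h => by rw [Real.norm_of_nonneg (sq_nonneg _)]; exact h1 h)
    refine (integral_mono hi4 hi3 h1).trans ?_
    simp only [hexp]
    rw [integral_add (f := fun h => kth k h U ^ 2 - 2 * a * kth k h U) (hi2.sub (hi1.const_mul _))
      (integrable_const _), integral_sub hi2 (hi1.const_mul _), integral_const_mul, integral_kth (by omega) hkU,
      integral_kth_sq (by omega) hkU]
    simp only [integral_const, probReal_univ, one_smul]
    -- The variance of the `k`-th of `m` uniform values, and the squared distance of their mean
    -- `k / (m + 1)` from `2 k / n`.
    set m : ℝ := (U.card : ℝ) with hm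
    have hm0 : 0 < m := by linarith
    have e1 : (k : ℝ) * (k + 1) / ((m + 1) * (m + 2)) - 2 * a * (k / (m + 1)) + a ^ 2
        = k * (m + 1 - k) / ((m + 1) ^ 2 * (m + 2)) + k ^ 2 * (n - 2 * m - 2) ^ 2 / (n ^ 2 * (m + 1) ^ 2) := by
      rw [ha]; field_simp; ring
    rw [e1]
    have e2 : (k : ℝ) * (m + 1 - k) / ((m + 1) ^ 2 * (m + 2)) ≤ 16 * k / n ^ 2 := by
      calc _ ≤ (k : ℝ) * (m + 2) / ((n / 4) ^ 2 * (m + 2)) := by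
            gcongr <;> linarith
        _ = _ := by field_simp; norm_num
    have e3 : (k : ℝ) ^ 2 * (n - 2 * m - 2) ^ 2 / (n ^ 2 * (m + 1) ^ 2) ≤
        k ^ 2 * (2 * (n - 2 * m) ^ 2 + 8) / (n ^ 2 * (n / 4) ^ 2) := by
      gcongr
      · nlinarith [sq_nonneg ((n : ℝ) - 2 * m + 2)]
      · linarith
    have e4 : (k : ℝ) ^ 2 * (2 * (n - 2 * m) ^ 2 + 8) / (n ^ 2 * (n / 4) ^ 2)
        = 32 * (k ^ 2 / n ^ 4) * (n - 2 * m) ^ 2 + 128 * (k / n ^ 2) * (k / n ^ 2) := by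
      field_simp; ring
    have e5 : 128 * ((k : ℝ) / n ^ 2) * (k / n ^ 2) ≤ 128 * (k / n ^ 2) * 1 := by
      gcongr
      rw [div_le_one (by positivity)]
      nlinarith
    have e6 : 144 * (k : ℝ) / n ^ 2 = 16 * k / n ^ 2 + 128 * (k / n ^ 2) * 1 := by ring
    linarith

/-- A query rarely has fewer than `k` keys of hash value at most `c`. -/
lemma expect_real_lt_kth_le (hk : 0 < k) {c : ℝ} (hc : 0 ≤ c) (hc1 : c < 1) :
    𝔼 U : Finset (Fin n), (unifRow n).real {h | c < kth k h U}
      ≤ 2 ^ k * Real.exp (-(n * c / 4)) := by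
  calc _ ≤ 𝔼 U : Finset (Fin n), 2 ^ k * (1 - c / 2) ^ U.card := by
        refine expect_le_expect fun U _ => ?_
        rw [unifRow_real_lt_kth hk hc hc1]
        -- Replacing `c ^ j` by `2 ^ k (c / 2) ^ j` makes room in the binomial theorem.
        have h1 : ∀ j ∈ range k, (U.card.choose j : ℝ) * (c ^ j * (1 - c) ^ (U.card - j)) ≤
            2 ^ k * ((c / 2) ^ j * (1 - c) ^ (U.card - j) * (U.card.choose j : ℝ)) := by
          intro j hj
          have h2 : c ^ j = 2 ^ j * (c / 2) ^ j := by rw [← mul_pow]; congr 1; ring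
          rw [h2]
          have h3 : (2 : ℝ) ^ j ≤ 2 ^ k := pow_le_pow_right₀ (by norm_num) (mem_range.1 hj).le
          have h4 : 0 ≤ (c / 2) ^ j * (1 - c) ^ (U.card - j) * (U.card.choose j : ℝ) := by
            have : 0 ≤ 1 - c := by linarith
            positivity
          calc _ = 2 ^ j * ((c / 2) ^ j * (1 - c) ^ (U.card - j) * (U.card.choose j : ℝ)) := by ring
            _ ≤ _ := by gcongr
        refine (sum_le_sum h1).trans ?_
        rw [← mul_sum]
        gcongr
        have h5 : (1 - c / 2) ^ U.card = (c / 2 + (1 - c)) ^ U.card := by congr 1; ring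
        rw [h5, add_pow]
        have hnn : ∀ j, 0 ≤ (c / 2) ^ j * (1 - c) ^ (U.card - j) * (U.card.choose j : ℝ) := fun j => by
          have : 0 ≤ 1 - c := by linarith
          positivity
        calc _ ≤ ∑ j ∈ range (max k (U.card + 1)),
              (c / 2) ^ j * (1 - c) ^ (U.card - j) * (U.card.choose j : ℝ) :=
              sum_le_sum_of_subset_of_nonneg (range_mono (le_max_left _ _)) fun j _ _ => hnn j
          _ = _ := by
              refine (sum_subset (range_mono (le_max_right _ _)) fun j _ hj => ?_).symm
              rw [Nat.choose_eq_zero_of_lt (by simpa using hj)]; simp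
    _ = 2 ^ k * (1 - c / 4) ^ n := by
        rw [← mul_expect, expect_pow_card]; congr 2; ring
    _ ≤ 2 ^ k * Real.exp (-(n * c / 4)) := by
        gcongr
        rw [show -(n * c / 4 : ℝ) = n * (-(c / 4)) by ring, Real.exp_nat_mul]
        have := Real.add_one_le_exp (-(c / 4))
        exact pow_le_pow_left₀ (by linarith) (by linarith) n

/-- The gap below the `k`-th smallest value is rarely short. -/
lemma real_gap_lt_le (hk : 2 ≤ k) (U : Finset (Fin n)) {c ε : ℝ} (hc : c < 1) (hε : 0 ≤ ε) :
    (unifRow n).real {h | kth k h U ≤ c ∧ kth k h U - kth (k - 1) h U < ε} ≤ n * ε := by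
  -- If `x` is the key with the `k`-th value, its value lies in the interval of length `ε` above
  -- the `(k - 1)`-th value of the other keys, which is independent of it.
  have h1 : ∀ᵐ h ∂unifRow n, h ∈ {h | kth k h U ≤ c ∧ kth k h U - kth (k - 1) h U < ε} →
      h ∈ ⋃ x ∈ U, {h : Fin n → ℝ | ∀ y ∈ ({x} : Finset (Fin n)), h y ∈
        Set.Ico (kth (k - 1) h (U.erase x)) (kth (k - 1) h (U.erase x) + ε)} := by
    filter_upwards [ae_unifRow] with h hh hmem
    obtain ⟨hkc, hgap⟩ := hmem
    obtain ⟨x, hxU, hx⟩ := exists_eq_kth (by omega) (hkc.trans_lt hc)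
    refine Set.mem_biUnion hxU fun y hy => ?_
    rw [mem_singleton.1 hy, hx]
    constructor
    · rw [kth_le_iff_of_lt_one (by omega) _ _ (hkc.trans_lt hc)]
      have h2 := (kth_le_iff_of_lt_one (by omega) h U (hkc.trans_lt hc)).1 le_rfl
      have h3 : ((U.erase x).filter fun z => h z ≤ kth k h U) =
          (U.filter fun z => h z ≤ kth k h U).erase x := by ext z; simp [and_assoc]
      rw [h3, card_erase_of_mem (mem_filter.2 ⟨hxU, hx.le⟩)]
      omega
    · have := kth_anti (j := k - 1) (by omega) (fun x => (hh x).2) (erase_subset x U)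
      linarith
  have h2 : (unifRow n).real {h | kth k h U ≤ c ∧ kth k h U - kth (k - 1) h U < ε} ≤
      (unifRow n).real (⋃ x ∈ U, {h : Fin n → ℝ | ∀ y ∈ ({x} : Finset (Fin n)), h y ∈
        Set.Ico (kth (k - 1) h (U.erase x)) (kth (k - 1) h (U.erase x) + ε)}) :=
    ENNReal.toReal_mono (measure_ne_top _ _) (measure_mono_ae h1)
  refine h2.trans ((measureReal_biUnion_finset_le _ _).trans ?_)
  calc _ ≤ ∑ x ∈ U, ε := by
        refine sum_le_sum fun x _ => ?_
        have := real_forall_mem_Ico_le unifLaw (measurable_kth (j := k - 1) (by omega) (U.erase x))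
          hε {x} (fun y hy h a => by
            rw [mem_singleton.1 hy]
            exact kth_congr fun z hz => Function.update_of_ne (ne_of_mem_erase hz) _ _)
        simpa using this
    _ = U.card * ε := by simp
    _ ≤ n * ε := by
        gcongr
        exact_mod_cast (card_le_univ U).trans (by simp)

lemma exists_isLowest (h : Fin n → ℝ) {m : ℕ} (hm : m ≤ n) : ∃ F, IsLowest h m F := by
  induction m with
  | zero => exact ⟨∅, by simp, by simp⟩
  | succ m ih =>
    obtain ⟨F, hF1, hF2⟩ := ih (by omega)
    have hne : Fᶜ.Nonempty := by
      rw [← card_pos, card_compl, hF1, Fintype.card_fin]; omega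
    obtain ⟨x, hx, hmin⟩ := exists_min_image Fᶜ h hne
    have hxF := mem_compl.1 hx
    refine ⟨insert x F, by rw [card_insert_of_notMem hxF, hF1], fun u hu v hv => ?_⟩
    rw [mem_insert, not_or] at hv
    rcases mem_insert.1 hu with rfl | hu
    · exact hmin v (mem_compl.2 hv.2)
    · exact hF2 u hu v hv.2

/-- Removing one of the lowest keys from a random query raises the truncated statistic by the gap
below the `k`-th value with constant probability. -/
lemma le_expect_kth_erase_sub (hk : 2 ≤ k) {h : Fin n → ℝ} (h1 : ∀ x, h x ≤ 1) {c ε : ℝ}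
    (hε : 0 < ε)
    (hE : freq (fun U : Finset (Fin n) => ¬ (kth k h U ≤ c ∧ ε ≤ kth k h U - kth (k - 1) h U)) <
      1 / 16)
    {F : Finset (Fin n)} {f : ℕ} (hF : IsLowest h f F) (hf : 2 * f ≤ 3 * k - 1) {y : Fin n}
    (hy : y ∈ F) :
    ε / 8 ≤ 𝔼 U : Finset (Fin n), (min c (kth k h (U.erase y)) - min c (kth k h (insert y U))) := by
  set E : Finset (Fin n) → Prop :=
    fun U => kth k h U ≤ c ∧ ε ≤ kth k h U - kth (k - 1) h U with hEdef
  have hk2 : (2 : ℝ) ≤ k := by exact_mod_cast hk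
  have hk0 : 0 < k := by omega
  have hk1 : 0 < k - 1 := by omega
  -- At most `k - 2` other keys of `F` are in the query with probability at least `1 / 4`, by
  -- Markov's inequality, as their mean number is at most `3 (k - 1) / 4`.
  have hfew : freq (fun U : Finset (Fin n) => ((k : ℝ) - 1) ≤ ((U ∩ F.erase y).card : ℝ)) ≤ 3 / 4 := by
    refine (freq_lt_le_expect_div (fun U => by positivity) (by linarith)).trans ?_
    rw [expect_card, div_le_iff₀ (by linarith), card_erase_of_mem hy, hF.1]
    have hf1 : 1 ≤ f := by rw [← hF.1]; exact card_pos.2 ⟨y, hy⟩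
    rw [Nat.cast_sub hf1]
    have : (2 * f : ℝ) ≤ 3 * k - 1 := by
      have := Nat.cast_le (α := ℝ).2 hf
      rw [Nat.cast_sub (by omega)] at this
      exact_mod_cast this
    push_cast
    linarith
  -- Removing `y` from the query at most doubles the probability of an event.
  have hbad : freq (fun U : Finset (Fin n) => ¬ E (U.erase y)) ≤ 1 / 8 := by
    have h2 := expect_erase y (fun U => if ¬ E U then (1 : ℝ) else 0)
    have h3 : 𝔼 U : Finset (Fin n), (if y ∈ U then 0 else (if ¬ E U then (1 : ℝ) else 0)) ≤
        freq (fun U => ¬ E U) := by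
      rw [freq_eq]
      refine expect_le_expect fun U _ => ?_
      by_cases hyU : y ∈ U
      · rw [if_pos hyU]; split_ifs <;> norm_num
      · rw [if_neg hyU]
    have h4 : freq (fun U : Finset (Fin n) => ¬ E (U.erase y)) =
        𝔼 U : Finset (Fin n), (if ¬ E (U.erase y) then (1 : ℝ) else 0) := freq_eq _
    rw [h4]
    linarith
  have hgood : freq (fun U : Finset (Fin n) => ¬ (((k : ℝ) - 1) ≤ ((U ∩ F.erase y).card : ℝ) ∨
      ¬ E (U.erase y))) ≥ 1 / 8 := by
    rw [freq_not]
    have := freq_or_le (fun U : Finset (Fin n) => ((k : ℝ) - 1) ≤ ((U ∩ F.erase y).card : ℝ))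
      (fun U => ¬ E (U.erase y))
    linarith
  -- On both good events the value of `y` is at most the `(k - 1)`-th value of `U.erase y`, so that
  -- inserting `y` moves the `k`-th value down to this value, across the gap.
  have hpt : ∀ U : Finset (Fin n), ε * (if ¬ (((k : ℝ) - 1) ≤ ((U ∩ F.erase y).card : ℝ) ∨
      ¬ E (U.erase y)) then (1 : ℝ) else 0) ≤
      min c (kth k h (U.erase y)) - min c (kth k h (insert y U)) := by
    intro U
    by_cases hU : ¬ (((k : ℝ) - 1) ≤ ((U ∩ F.erase y).card : ℝ) ∨ ¬ E (U.erase y))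
    · rw [if_pos hU, mul_one]
      rw [not_or, not_not, not_le] at hU
      obtain ⟨hU1, hU2, hU3⟩ := hU
      set V := U.erase y with hV
      have hv1 : kth (k - 1) h V < 1 := by
        have := kth_le_one (j := k) hk0 h1 V
        linarith
      have hyv : h y ≤ kth (k - 1) h V := by
        by_contra hlt
        rw [not_le] at hlt
        have h2 := (kth_le_iff_of_lt_one hk1 h V hv1).1 le_rfl
        have h3 : (V.filter fun x => h x ≤ kth (k - 1) h V) ⊆ U ∩ F.erase y := by
          intro x hx
          rw [mem_filter, hV, mem_erase] at hx
          rw [mem_inter, mem_erase]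
          refine ⟨hx.1.2, hx.1.1, ?_⟩
          by_contra hxF
          have := hF.2 y hy x hxF
          linarith [hx.2]
        have h4 := h2.trans (card_le_card h3)
        have h5 : ((k - 1 : ℕ) : ℝ) ≤ (U ∩ F.erase y).card := by exact_mod_cast h4
        rw [Nat.cast_sub (by omega)] at h5
        push_cast at h5
        linarith
      have hins : kth k h (insert y U) ≤ kth (k - 1) h V := by
        rw [kth_le_iff_of_lt_one hk0 _ _ hv1]
        have h2 := (kth_le_iff_of_lt_one hk1 h V hv1).1 le_rfl
        have h3 : insert y (V.filter fun x => h x ≤ kth (k - 1) h V) ⊆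
            (insert y U).filter fun x => h x ≤ kth (k - 1) h V := by
          intro x hx
          rw [mem_filter, mem_insert]
          rcases mem_insert.1 hx with rfl | hx
          · exact ⟨Or.inl rfl, hyv⟩
          · rw [mem_filter] at hx
            exact ⟨Or.inr (mem_of_mem_erase hx.1), hx.2⟩
        have h4 := card_le_card h3
        rw [card_insert_of_notMem (by simp [hV])] at h4
        omega
      rw [min_eq_right hU2, min_eq_right (by linarith)]
      linarith
    · rw [if_neg hU, mul_zero, sub_nonneg]
      exact min_le_min_left _ (kth_anti hk0 h1
        ((erase_subset _ _).trans (subset_insert _ _)))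
  calc ε / 8 ≤ ε * freq (fun U : Finset (Fin n) => ¬ (((k : ℝ) - 1) ≤ ((U ∩ F.erase y).card : ℝ) ∨
      ¬ E (U.erase y))) := by
        rw [div_eq_mul_inv]; gcongr; linarith
    _ = _ := by rw [freq_eq, mul_expect]
    _ ≤ _ := expect_le_expect fun U _ => hpt U

end BottomK

/-- Markov's inequality for the frequency of a random event. -/
lemma real_le_freq_le {X Ω : Type*} [MeasurableSpace X] [Fintype Ω] [Nonempty Ω] {μ : Measure X}
    [IsProbabilityMeasure μ] {E : X → Ω → Prop} (hE : ∀ ω, MeasurableSet {x | E x ω}) {a : ℝ}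
    (ha : 0 < a) : μ.real {x | a ≤ freq (E x)} ≤ (𝔼 ω, μ.real {x | E x ω}) / a := by
  have hc : (0 : ℝ) < Fintype.card Ω := by exact_mod_cast Fintype.card_pos
  have h := real_le_sum_ite_le (μ := μ) univ (p := fun ω x => E x ω) (fun ω _ => hE ω)
    (mul_pos ha hc)
  rw [Fintype.expect_eq_sum_div_card, div_div, mul_comm (Fintype.card Ω : ℝ) a]
  refine le_trans (measureReal_mono fun x hx => ?_) h
  have h2 : a ≤ freq (E x) := hx
  rw [freq, Fintype.expect_eq_sum_div_card, le_div_iff₀ hc] at h2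
  exact h2.trans (le_of_eq (sum_congr rfl fun ω _ => by congr))

/-! ### The attack on bottom-`k` sketches -/

section BottomKAttack

variable {n k r : ℕ}

lemma measurePreserving_bottomK (k n : ℕ) : MeasurePreserving
    (MeasurableEquiv.funUnique (Fin 1) (Fin n → ℝ)) (hashMeasure .bottomK k n) (unifRow n) :=
  measurePreserving_funUnique (unifRow n) (Fin 1)

lemma real_bottomK (p : (Fin n → ℝ) → Prop) :
    (hashMeasure .bottomK k n).real {ρ | p (ρ (0 : Fin 1))} = (unifRow n).real {h | p h} := by
  rw [measureReal_def, measureReal_def]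
  congr 1
  exact (measurePreserving_bottomK k n).measure_preimage_equiv {h | p h}

/-- The bound `2 ^ k e^{-n c / 4}` of `expect_real_lt_kth_le` at the level `c = 16 k log X / n`. -/
lemma two_pow_mul_exp_le {X : ℝ} (hX : 2 ≤ X) (hk : 1 ≤ k) :
    (2 : ℝ) ^ k * Real.exp (-(4 * k * Real.log X)) ≤ 2 / X ^ 4 := by
  have hX0 : 0 < X := by linarith
  have h1 : Real.exp (-(4 * k * Real.log X)) = (1 / X ^ 4) ^ k := by
    rw [show -(4 * k * Real.log X) = k * (-(4 : ℕ) * Real.log X) by push_cast; ring,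
      Real.exp_nat_mul, neg_mul, Real.exp_neg, Real.exp_nat_mul, Real.exp_log hX0, one_div]
  rw [h1, ← mul_pow, mul_one_div]
  refine pow_le_of_le_one (by positivity) ?_ (by omega)
  rw [div_le_one (by positivity)]
  calc (2 : ℝ) ≤ X := hX
    _ ≤ X ^ 4 := le_self_pow₀ (by linarith) (by norm_num)

lemma measurableSet_isLowest (f : ℕ) (F : Finset (Fin n)) :
    MeasurableSet {h : Fin n → ℝ | IsLowest h f F} := by
  have e : {h : Fin n → ℝ | IsLowest h f F} =
      {_h | F.card = f} ∩ ⋂ u ∈ F, ⋂ v ∈ Fᶜ, {h | h u ≤ h v} := by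
    ext h; simp [IsLowest]
  rw [e]
  exact (MeasurableSet.const _).inter (Finset.measurableSet_biInter _ fun u _ =>
    Finset.measurableSet_biInter _ fun v _ =>
      measurableSet_le (measurable_pi_apply u) (measurable_pi_apply v))

/-- A set that has `k` of the `f` lowest keys has its `k`-th value below the `f`-th overall value.
-/
lemma kth_le_of_isLowest {h : Fin n → ℝ} {f : ℕ} {F W : Finset (Fin n)} (hF : IsLowest h f F)
    (hf : 0 < f) (hk : 0 < k) (hlt : kth f h univ < 1) (hW : k ≤ (F ∩ W).card) :
    kth k h W ≤ kth f h univ := by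
  have h1 := (kth_le_iff_of_lt_one hf h univ hlt).1 le_rfl
  have h2 : ∀ y ∈ F, h y ≤ kth f h univ := by
    intro y hy
    by_contra hlt'
    rw [not_le] at hlt'
    have h3 : (univ.filter fun x => h x ≤ kth f h univ) ⊆ F.erase y := by
      intro x hx
      have hx' := (mem_filter.1 hx).2
      refine mem_erase.2 ⟨fun he => ?_, ?_⟩
      · rw [he] at hx'; linarith
      · by_contra hxF
        linarith [hF.2 y hy x hxF]
    have h4 := h1.trans (card_le_card h3)
    rw [card_erase_of_mem hy, hF.1] at h4
    omega
  rw [kth_le_iff_of_lt_one hk _ _ hlt]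
  refine hW.trans (card_le_card fun x hx => ?_)
  rw [mem_inter] at hx
  exact mem_filter.2 ⟨hx.2, h2 x hx.1⟩

set_option maxHeartbeats 800000 in
/-- The attack on bottom-`k` sketches: outside an unlikely event, the lowest keys have statistic at
most of the order `k / n`. -/
theorem exists_bad_bottomK {α : ℝ} (hk : 2 ≤ k) (hα : 0 < α) (hα1 : α ≤ 1)
    (hr : 10 ^ 22 * (k : ℝ) / α ^ 2 ≤ r)
    (hn : 10 ^ 8 * ((k : ℝ) * Real.log (k * r) / α) ≤ n) :
    ∃ Bad : Hashes .bottomK k n → (Fin r → Finset (Fin n)) → Prop,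
      jprob (hashMeasure .bottomK k n) Bad ≤ 0.009 ∧
      ∀ᵐ ρ ∂hashMeasure .bottomK k n, ∀ q W,
        IsLowest (fun x => avgOn (fun i => stat .bottomK k (sketch .bottomK k ρ (q i))) (pat q x))
          ⌈α * (n : ℝ)⌉₊ W → ¬ Bad ρ q → stat .bottomK k (sketch .bottomK k ρ W) ≤ 2000 * k / n := by
  have hk2 : (2 : ℝ) ≤ k := by exact_mod_cast hk
  have hk0 : 0 < k := by omega
  have hr1 : 10 ^ 22 * (k : ℝ) ≤ α ^ 2 * r := by
    rwa [div_le_iff₀ (by positivity), mul_comm (r : ℝ)] at hr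
  have hα2 : α ^ 2 ≤ α := by nlinarith
  have hrα : 10 ^ 22 * (k : ℝ) ≤ α * r := hr1.trans (by gcongr)
  have hr2 : 10 ^ 22 * (k : ℝ) ≤ r := hrα.trans (by nlinarith [(Nat.cast_nonneg r : (0 : ℝ) ≤ r)])
  have hr0 : (0 : ℝ) < r := by linarith
  have hr0' : 0 < r := by exact_mod_cast hr0
  set X : ℝ := k * r with hX
  have hXr : (r : ℝ) ≤ X := by rw [hX]; nlinarith
  set Λ := Real.log X with hΛdef
  have hΛ1 : 1 ≤ Λ := by
    rw [hΛdef, Real.le_log_iff_exp_le (by linarith)]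
    linarith [Real.exp_one_lt_d9]
  have hnα : 10 ^ 8 * (k * Λ) ≤ α * n := by
    rw [mul_div_assoc', div_le_iff₀ hα, mul_comm (n : ℝ)] at hn; exact hn
  have hkΛ : (k : ℝ) ≤ k * Λ := le_mul_of_one_le_right (by positivity) hΛ1
  have hαn : α * n ≤ n := by nlinarith [(Nat.cast_nonneg n : (0 : ℝ) ≤ n)]
  have hn1 : 10 ^ 8 * (k * Λ) ≤ n := hnα.trans hαn
  have hn0 : (0 : ℝ) < n := by linarith
  have hkn' : 2 * k ≤ n := by
    have : (2 * k : ℝ) ≤ n := by linarith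
    exact_mod_cast this
  have hαn0 : 0 < α * n := by linarith
  -- The `k`-th value is truncated at a level that all the queries respect, at the price of a
  -- logarithm in the number of keys with influence.
  set c : ℝ := 16 * k * Λ / n with hc
  have hc0 : 0 < c := by positivity
  have hc1 : c < 1 := by rw [hc, div_lt_one hn0]; linarith
  set t : (Fin n → ℝ) → Finset (Fin n) → ℝ := fun h U => min c (kth k h U) with ht
  have htm : ∀ U, Measurable fun h => t h U := fun U => measurable_const.min (measurable_kth hk0 U)
  set V : (Fin n → ℝ) → ℝ := fun h => 𝔼 U, (t h U - 𝔼 U, t h U) ^ 2 with hV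
  have hVm : Measurable V :=
    measurable_expect fun U => ((htm U).sub (measurable_expect htm)).pow_const 2
  -- `K` bounds the variance of the response over the queries. The gap `ε` below the `k`-th value
  -- is short with probability at most `n ε`; the lowest keys have influence `ε / 8 = 4 δ`.
  set K : ℝ := 2 * 10 ^ 5 * k / n ^ 2 with hK
  have hK0 : 0 < K := by positivity
  set ε : ℝ := 1 / (20000 * n) with hε
  have hε0 : 0 < ε := by positivity
  set δ : ℝ := ε / 32 with hδ
  have hδ0 : 0 < δ := by positivity
  have hKδ : K + δ ^ 2 ≤ 10 ^ 17 * k * δ ^ 2 := by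
    have h1 : K = 81920000000000000 * k * δ ^ 2 := by
      rw [hK, hδ, hε]; field_simp; norm_num
    have h2 : δ ^ 2 ≤ k * δ ^ 2 := le_mul_of_one_le_left (by positivity) (by linarith)
    rw [h1]; nlinarith
  -- A random query has about half of the `f ≈ 3 k / 2` lowest keys, thus mostly fewer than `k`,
  -- and `k` of them are still in `W` when fewer than `k / 2` are missed.
  obtain ⟨f, hf1, hf2⟩ : ∃ f, 2 * f ≤ 3 * k - 1 ∧ 3 * k - 2 ≤ 2 * f := ⟨3 * (k - 1) / 2 + 1, by omega, by omega⟩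
  have hf0 : 0 < f := by omega
  have hfk : (f : ℝ) ≤ 3 / 2 * k := by
    have : (2 * f : ℝ) ≤ 3 * k := by exact_mod_cast (by omega : 2 * f ≤ 3 * k)
    linarith
  set NoGap : (Fin n → ℝ) → Finset (Fin n) → Prop :=
    fun h U => ¬ (kth k h U ≤ c ∧ ε ≤ kth k h U - kth (k - 1) h U) with hNoGap
  have hNoGapm : ∀ U, MeasurableSet {h | NoGap h U} := fun U =>
    ((measurableSet_le (measurable_kth hk0 U) measurable_const).inter
      (measurableSet_le measurable_const ((measurable_kth hk0 U).sub
        (measurable_kth (j := k - 1) (by omega) U)))).compl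
  have hfreqm : Measurable fun h => freq (NoGap h) :=
    measurable_expect fun U => Measurable.ite (hNoGapm U) measurable_const measurable_const
  have hsum : ∀ (q : Fin r → Finset (Fin n)) (x : Fin n), Measurable fun h : Fin n → ℝ =>
      ∑ i ∈ pat q x, (t h (q i) - (𝔼 U, t h U - δ)) := fun q x =>
    Finset.measurable_sum _ fun i _ => (htm _).sub ((measurable_expect htm).sub_const _)
  set L : (Fin n → ℝ) → Finset (Fin n) := fun h => univ.filter fun x => h x ≤ c with hL
  -- The unlikely events: a large variance; short gaps; many keys with influence; a truncated
  -- query; a large `f`-th value; many keys of low score without influence; many of the lowest keys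
  -- missed.
  set BVar : (Fin n → ℝ) → (Fin r → Finset (Fin n)) → Prop := fun h _ => K ≤ V h
  set BGap : (Fin n → ℝ) → (Fin r → Finset (Fin n)) → Prop := fun h _ => 1 / 16 ≤ freq (NoGap h)
  set BLow : (Fin n → ℝ) → (Fin r → Finset (Fin n)) → Prop := fun h _ => α * n / 4 ≤ (L h).card
  set BTrunc : (Fin n → ℝ) → (Fin r → Finset (Fin n)) → Prop :=
    fun h q => ∃ i ∈ univ, c < kth k h (q i)
  set BKth : (Fin n → ℝ) → (Fin r → Finset (Fin n)) → Prop :=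
    fun h _ => 2000 * k / n ≤ kth f h univ
  set BScore : (Fin n → ℝ) → (Fin r → Finset (Fin n)) → Prop := fun h q => V h < K ∧
    α * n / 2 ≤ ((univ.filter fun x => x ∉ L h ∧
      ∑ i ∈ pat q x, (t h (q i) - (𝔼 U, t h U - δ)) ≤ 0).card : ℝ)
  set BMiss : (Fin n → ℝ) → (Fin r → Finset (Fin n)) → Prop := fun h q =>
    V h < K ∧ freq (NoGap h) < 1 / 16 ∧ ∀ F, IsLowest h f F →
      (k : ℝ) / 2 ≤ ((F.filter fun y => 0 ≤ ∑ i ∈ pat q y, (t h (q i) - (𝔼 U, t h U - δ))).card : ℝ)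
  have hBVar : jprob (unifRow n) BVar ≤ 177 / (2 * 10 ^ 5) := by
    rw [jprob_const]
    refine (real_le_variance_le (t := t) (a := 2 * k / n) (v := fun U =>
      144 * k / (n : ℝ) ^ 2 + 32 * ((k : ℝ) ^ 2 / n ^ 4) * ((n : ℝ) - 2 * U.card) ^ 2
      + if (U.card : ℝ) < n / 4 then (16 * k * Λ / n) ^ 2 else 0) (fun U => ?_)
      (fun U => integral_min_kth_sub_sq_le (by omega) hΛ1 (by linarith) U) hK0).trans ?_
    · refine (integrable_const (1 : ℝ)).mono' (((htm U).sub_const _).pow_const 2).aestronglyMeasurable ?_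
      filter_upwards [ae_unifRow] with h hh
      have h1 : 0 < kth k h U := kth_pos hk0 (fun x => (hh x).1) U
      have h2 : t h U ≤ c := min_le_left _ _
      have h3 : 0 < t h U := lt_min hc0 h1
      have h4 : 0 < 2 * k / (n : ℝ) := by positivity
      have h5 : 2 * k / (n : ℝ) < 1 := by rw [div_lt_one hn0]; linarith
      rw [Real.norm_of_nonneg (sq_nonneg _), sq_le_one_iff_abs_le_one, abs_le]
      constructor <;> linarith
    · have := expect_size_le (n := n) (k := k) (Λ := Λ) (by linarith) (by linarith) (by linarith)
        (by linarith) (A := 144) (B := 32) (by norm_num)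
      rw [div_le_iff₀ hK0]
      refine this.trans (le_of_eq ?_)
      rw [hK]; field_simp; norm_num
  have htail : (2 : ℝ) ^ k * Real.exp (-(n * c / 4)) ≤ 2 / X ^ 4 := by
    have : (n * c / 4 : ℝ) = 4 * k * Λ := by
      rw [hc]; field_simp; norm_num
    rw [this, hΛdef]
    exact two_pow_mul_exp_le (by linarith) (by omega)
  have hX4 : 2 / X ^ 4 ≤ 1 / (10 ^ 6 * r) := by
    rw [div_le_div_iff₀ (by positivity) (by positivity)]
    have h1 : X ^ 2 ≤ X ^ 4 := pow_le_pow_right₀ (by linarith) (by norm_num)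
    nlinarith
  have hX4' : 1 / (10 ^ 6 * (r : ℝ)) ≤ 1 / 10 ^ 6 := by
    gcongr
    linarith
  have hE := expect_real_lt_kth_le (n := n) hk0 hc0.le hc1
  have hBGap : jprob (unifRow n) BGap ≤ 16 * (1 / 10 ^ 6 + 1 / 20000) := by
    rw [jprob_const]
    refine (real_le_freq_le hNoGapm (by norm_num)).trans ?_
    have h1 : ∀ U : Finset (Fin n), (unifRow n).real {h | NoGap h U} ≤
        (unifRow n).real {h | c < kth k h U} + 1 / 20000 := by
      intro U
      have h2 : n * ε = 1 / 20000 := by rw [hε]; field_simp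
      rw [← h2]
      refine (measureReal_mono fun h hh => ?_).trans ((measureReal_union_le _ _).trans
        (add_le_add_right (real_gap_lt_le hk U hc1 hε0.le) _))
      by_cases hcase : kth k h U ≤ c
      · exact Or.inr ⟨hcase, by
          have : NoGap h U := hh
          simp only [hNoGap, not_and, not_le] at this
          exact this hcase⟩
      · exact Or.inl (not_le.1 hcase)
    have h3 := expect_le_expect (s := (univ : Finset (Finset (Fin n)))) fun U _ => h1 U
    rw [expect_add_distrib, Fintype.expect_const] at h3
    linarith
  have hBLow : jprob (unifRow n) BLow ≤ 64 / 10 ^ 8 := by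
    rw [jprob_const, ← real_bottomK (k := k)]
    have h := real_card_low_ge_le .bottomK k n hc0.le (a := α * n / 4) (by positivity)
    simp only [SketchType.numHashes] at h
    refine le_trans (le_of_eq ?_) (h.trans ?_)
    · congr 1
      ext ρ
      simp only [Set.mem_ofPred_eq, hL, Fin.exists_fin_one]
    · rw [div_le_iff₀ (by positivity), hc]
      push_cast
      rw [one_mul, mul_div_cancel₀ _ hn0.ne']
      linarith
  have hBTrunc : jprob (unifRow n) BTrunc ≤ 1 / 10 ^ 6 := by
    refine (jprob_exists_query_le fun h U => c < kth k h U).trans ?_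
    calc _ ≤ (r : ℝ) * (1 / (10 ^ 6 * r)) := by
          gcongr; exact hE.trans (htail.trans hX4)
      _ = _ := by field_simp
  have hBKth : jprob (unifRow n) BKth ≤ 3 / 4000 := by
    rw [jprob_const]
    have hi : Integrable (fun h => kth f h univ) (unifRow n) := by
      refine (integrable_const (1 : ℝ)).mono' (measurable_kth hf0 univ).aestronglyMeasurable ?_
      filter_upwards [ae_unifRow] with h hh
      rw [Real.norm_of_nonneg (kth_pos hf0 (fun x => (hh x).1) univ).le]
      exact kth_le_one hf0 (fun x => (hh x).2) univ
    have h1 := mul_meas_ge_le_integral_of_nonneg (μ := unifRow n) (f := fun h => kth f h univ)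
      (by filter_upwards [ae_unifRow] with h hh using (kth_pos hf0 (fun x => (hh x).1) univ).le)
      hi (2000 * k / n)
    rw [integral_kth hf0 (by rw [card_univ, Fintype.card_fin]; omega), card_univ,
      Fintype.card_fin] at h1
    have h2 : (f : ℝ) / (n + 1) ≤ 3 / 2 * k / n := by gcongr; linarith
    have h3 : 2000 * (k : ℝ) / n * (3 / 4000) = 3 / 2 * k / n := by ring
    exact le_of_mul_le_mul_left (h1.trans (h2.trans h3.symm.le)) (by positivity)
  have hBScore : jprob (unifRow n) BScore ≤ 1 / 10 ^ 4 := by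
    refine jprob_le_of_freq (fun q => ?_) (.of_forall fun h => ?_)
    · have e : {h | BScore h q} = {h | V h < K} ∩ {h | α * n / 2 ≤ ((univ.filter fun x => x ∉ L h ∧
          ∑ i ∈ pat q x, (t h (q i) - (𝔼 U, t h U - δ)) ≤ 0).card : ℝ)} := rfl
      rw [e]
      refine (measurableSet_lt hVm measurable_const).inter (measurableSet_le measurable_const ?_)
      refine measurable_card_filter univ fun x _ => ?_
      have e2 : {h | x ∉ L h ∧ ∑ i ∈ pat q x, (t h (q i) - (𝔼 U, t h U - δ)) ≤ 0} =
          {h | h x ≤ c}ᶜ ∩ {h | ∑ i ∈ pat q x, (t h (q i) - (𝔼 U, t h U - δ)) ≤ 0} := by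
        ext h; simp [hL]
      rw [e2]
      exact (measurableSet_le (measurable_pi_apply x) measurable_const).compl.inter
        (measurableSet_le (hsum q x) measurable_const)
    · by_cases hVK : V h < K
      · refine (freq_mono fun q hq => hq.2).trans
          ((freq_card_low_ge_le (t := t h) (L := L h) (fun x hx U => ?_) hδ0 hr0' (by positivity)).trans ?_)
        · have hx' : c < h x := by simpa [hL] using hx
          simp only [ht]
          -- The value of `x` is above the level `c`, below which `t` only sees the other keys.
          have hiff : ∀ v < c, kth k h (insert x U) ≤ v ↔ kth k h U ≤ v := by
            intro v hv
            rw [kth_le_iff_of_lt_one hk0 _ _ (hv.trans hc1), kth_le_iff_of_lt_one hk0 _ _ (hv.trans hc1),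
              filter_insert, if_neg (by linarith)]
          rcases lt_or_ge (kth k h U) c with h1 | h1
          · have h2 := (hiff _ h1).2 le_rfl
            have h3 := (hiff _ (h2.trans_lt h1)).1 le_rfl
            rw [le_antisymm h2 h3]
          · have h2 : c ≤ kth k h (insert x U) := by
              by_contra h3
              rw [not_le] at h3
              linarith [(hiff _ h3).1 le_rfl]
            rw [min_eq_left h1, min_eq_left h2]
        · have h1 : 4 * (V h + δ ^ 2) / (r * δ ^ 2) ≤ 4 * (10 ^ 17 * k * δ ^ 2) / (r * δ ^ 2) := by
            gcongr
            exact (add_le_add_left hVK.le _).trans hKδ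
          have h2 : 4 * (10 ^ 17 * k * δ ^ 2) / (r * δ ^ 2) = 4 * 10 ^ 17 * k / r := by
            field_simp
          rw [h2] at h1
          calc _ ≤ (n : ℝ) * (4 * 10 ^ 17 * k / r) / (α * n / 2) := by gcongr
            _ = 8 * 10 ^ 17 * k / (α * r) := by field_simp; norm_num
            _ ≤ _ := by rw [div_le_iff₀ (by positivity)]; linarith
      · refine le_trans (freq_mono (q := fun _ => False) fun q hq => hVK hq.1) ?_
        rw [freq_false]; norm_num
  have hBMiss : jprob (unifRow n) BMiss ≤ 1 / 10 ^ 3 := by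
    refine jprob_le_of_freq (fun q => ?_) ?_
    · have e : {h | BMiss h q} = {h | V h < K} ∩ ({h | freq (NoGap h) < 1 / 16} ∩ ⋂ F,
          ({h | IsLowest h f F}ᶜ ∪ {h | (k : ℝ) / 2 ≤ ((F.filter fun y =>
            0 ≤ ∑ i ∈ pat q y, (t h (q i) - (𝔼 U, t h U - δ))).card : ℝ)})) := by
        ext h
        simp only [BMiss, Set.mem_ofPred_eq, Set.mem_inter_iff, Set.mem_iInter, Set.mem_union,
          Set.mem_compl_iff, imp_iff_not_or]
      rw [e]
      refine (measurableSet_lt hVm measurable_const).inter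
        ((measurableSet_lt hfreqm measurable_const).inter (MeasurableSet.iInter fun F =>
          (measurableSet_isLowest f F).compl.union (measurableSet_le measurable_const ?_)))
      exact measurable_card_filter F fun x _ => measurableSet_le measurable_const (hsum q x)
    · filter_upwards [ae_unifRow] with h hh
      by_cases hgood : V h < K ∧ freq (NoGap h) < 1 / 16
      -- Each of the `f` lowest keys is missed with probability of order `k / r`.
      · obtain ⟨F, hF⟩ := exists_isLowest h (show f ≤ n by omega)
        refine (freq_mono fun q hq => hq.2.2 F hF).trans ?_
        refine (freq_card_filter_ge_le F (fun y q => 0 ≤ ∑ i ∈ pat q y, (t h (q i) - (𝔼 U, t h U - δ)))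
          (ε := 64 * (V h + δ ^ 2) / (r * (ε / 8) ^ 2)) (fun y hy => ?_) (by positivity)).trans ?_
        · refine freq_sum_nonneg_le hδ0 (le_expect_kth_erase_sub hk (fun x => (hh x).2) hε0
            hgood.2 hF hf1 hy) (by rw [hδ]; linarith) hr0'
        · rw [hF.1]
          have h0 : ε / 8 = 4 * δ := by rw [hδ]; ring
          rw [h0]
          have h1 : 64 * (V h + δ ^ 2) / (r * (4 * δ) ^ 2) ≤
              64 * (10 ^ 17 * k * δ ^ 2) / (r * (4 * δ) ^ 2) := by
            gcongr
            exact (add_le_add_left hgood.1.le _).trans hKδ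
          have h2 : 64 * (10 ^ 17 * k * δ ^ 2) / (r * (4 * δ) ^ 2) = 4 * 10 ^ 17 * k / r := by
            field_simp; norm_num
          rw [h2] at h1
          calc _ ≤ 3 / 2 * (k : ℝ) * (4 * 10 ^ 17 * k / r) / (k / 2) := by gcongr
            _ = 12 * 10 ^ 17 * k / r := by field_simp; norm_num
            _ ≤ _ := by rw [div_le_iff₀ hr0]; linarith
      · refine le_trans (freq_mono (q := fun _ => False) fun q hq => hgood ⟨hq.1, hq.2.1⟩) ?_
        rw [freq_false]; norm_num
  set Bad : (Fin n → ℝ) → (Fin r → Finset (Fin n)) → Prop := fun h q =>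
    BVar h q ∨ BGap h q ∨ BLow h q ∨ BTrunc h q ∨ BKth h q ∨ BScore h q ∨ BMiss h q with hBad
  refine ⟨fun ρ q => Bad (ρ (0 : Fin 1)) q, ?_, ?_⟩
  · have h1 : jprob (hashMeasure .bottomK k n) (fun ρ q => Bad (ρ (0 : Fin 1)) q) =
        jprob (unifRow n) Bad :=
      expect_congr rfl fun q _ => real_bottomK fun h => Bad h q
    rw [h1]
    refine (jprob_or_le _ _).trans ?_
    have h2 := jprob_or_le (μ := unifRow n) BGap (fun h q => BLow h q ∨ BTrunc h q ∨ BKth h q ∨ BScore h q ∨ BMiss h q)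
    have h3 := jprob_or_le (μ := unifRow n) BLow (fun h q => BTrunc h q ∨ BKth h q ∨ BScore h q ∨ BMiss h q)
    have h4 := jprob_or_le (μ := unifRow n) BTrunc (fun h q => BKth h q ∨ BScore h q ∨ BMiss h q)
    have h5 := jprob_or_le (μ := unifRow n) BKth (fun h q => BScore h q ∨ BMiss h q)
    have h6 := jprob_or_le (μ := unifRow n) BScore BMiss
    linarith
  · have hae : ∀ᵐ ρ ∂hashMeasure .bottomK k n, ∀ x, 0 < ρ (0 : Fin 1) x ∧ ρ (0 : Fin 1) x ≤ 1 :=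
      (measurePreserving_bottomK k n).quasiMeasurePreserving.ae ae_unifRow
    filter_upwards [hae] with ρ hh q W hW hnot
    have hst : ∀ U, stat .bottomK k (sketch .bottomK k ρ U) = kth k (ρ (0 : Fin 1)) U := fun U =>
      stat_bottomK hk0 ρ U
    simp only [hst] at hW ⊢
    set h := ρ (0 : Fin 1)
    simp only [hBad, not_or] at hnot
    obtain ⟨nVar, nGap, nLow, nTrunc, nKth, nScore, nMiss⟩ := hnot
    have nVar : V h < K := not_le.1 nVar
    have nGap : freq (NoGap h) < 1 / 16 := not_le.1 nGap
    have nLow : ((L h).card : ℝ) < α * n / 4 := not_le.1 nLow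
    have nKth : kth f h univ < 2000 * k / n := not_le.1 nKth
    have hnn : ∀ x ∉ W, 0 ≤ ∑ i ∈ pat q x, (t h (q i) - (𝔼 U, t h U - δ)) := by
      intro x hx
      refine nonneg_sum_of_notMem (T := kth k h) (t := t h) hαn0 (fun i => ?_) nLow.le ?_ hW hx
      · exact (min_eq_right (not_lt.1 fun hlt => nTrunc ⟨i, mem_univ i, hlt⟩)).symm
      · exact not_le.1 fun hle => nScore ⟨nVar, hle⟩
    have nMiss' : ∃ F, IsLowest h f F ∧ ((F.filter fun y =>
        0 ≤ ∑ i ∈ pat q y, (t h (q i) - (𝔼 U, t h U - δ))).card : ℝ) < k / 2 := by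
      by_contra hcon
      push Not at hcon
      exact nMiss ⟨nVar, nGap, hcon⟩
    obtain ⟨F, hF, hFc⟩ := nMiss'
    have hmiss : (F \ W).card ≤ (F.filter fun y =>
        0 ≤ ∑ i ∈ pat q y, (t h (q i) - (𝔼 U, t h U - δ))).card :=
      card_le_card fun y hy => by
        rw [mem_sdiff] at hy
        exact mem_filter.2 ⟨hy.1, hnn y hy.2⟩
    have hmiss2 : 2 * (F \ W).card < k := by
      have h1 : ((F \ W).card : ℝ) < k / 2 := lt_of_le_of_lt (by exact_mod_cast hmiss) hFc
      have h2 : (2 * (F \ W).card : ℝ) < k := by linarith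
      exact_mod_cast h2
    have hsplit := card_sdiff_add_card_inter F W
    rw [hF.1] at hsplit
    refine (kth_le_of_isLowest hF hf0 hk0 (nKth.trans ?_) (by omega)).trans nKth.le
    rw [div_lt_one hn0]; linarith

/-- The expected estimate of all the keys by a bottom-`k` sketch is `O(n)`. -/
lemma lintegral_estimate_univ_bottomK_le (hk : 2 ≤ k) (hn : k ≤ n) :
    ∫⁻ ρ, ENNReal.ofReal (estimate .bottomK k (sketch .bottomK k ρ univ))
      ∂hashMeasure .bottomK k n ≤ ENNReal.ofReal (5 * n) := by
  have h1 : ∀ ρ : Hashes .bottomK k n, ENNReal.ofReal (estimate .bottomK k (sketch .bottomK k ρ univ)) =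
      ENNReal.ofReal (((k : ℝ) - 1) / kth k (ρ (0 : Fin 1)) univ) := fun ρ => by
    exact congrArg (fun s => ENNReal.ofReal (((k : ℝ) - 1) / s)) (stat_bottomK (by omega) ρ univ)
  simp only [h1]
  refine le_trans (le_of_eq ?_) (lintegral_estimate_bottomK_le hk hn)
  exact (measurePreserving_bottomK k n).lintegral_comp
    (f := fun h => ENNReal.ofReal (((k : ℝ) - 1) / kth k h univ))
    (measurable_const.div (measurable_kth (by omega) univ)).ennreal_ofReal

end BottomKAttack

/-! ### Truncated minima of exponential values -/

section TruncMin

variable {n : ℕ} {c : ℝ} {h : Fin n → ℝ} {U V : Finset (Fin n)}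

/-- The smallest value of `h` on `U`, truncated at `c`. -/
def truncMin (c : ℝ) (h : Fin n → ℝ) (U : Finset (Fin n)) : ℝ := U.fold min c h

lemma lt_truncMin_iff {v : ℝ} : v < truncMin c h U ↔ v < c ∧ ∀ x ∈ U, v < h x := lt_fold_min v

lemma le_truncMin_iff {v : ℝ} : v ≤ truncMin c h U ↔ v ≤ c ∧ ∀ x ∈ U, v ≤ h x := le_fold_min v

lemma truncMin_le_iff {v : ℝ} : truncMin c h U ≤ v ↔ c ≤ v ∨ ∃ x ∈ U, h x ≤ v := fold_min_le v

lemma truncMin_le : truncMin c h U ≤ c := truncMin_le_iff.2 (Or.inl le_rfl)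

lemma truncMin_le_of_mem {x : Fin n} (hx : x ∈ U) : truncMin c h U ≤ h x :=
  truncMin_le_iff.2 (Or.inr ⟨x, hx, le_rfl⟩)

lemma truncMin_pos (hc : 0 < c) (h0 : ∀ x, 0 < h x) : 0 < truncMin c h U :=
  lt_truncMin_iff.2 ⟨hc, fun x _ => h0 x⟩

lemma truncMin_anti (hUV : U ⊆ V) : truncMin c h V ≤ truncMin c h U :=
  le_truncMin_iff.2 ⟨truncMin_le, fun _ hx => truncMin_le_of_mem (hUV hx)⟩

lemma truncMin_insert_of_le {x : Fin n} (hx : truncMin c h U ≤ h x) :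
    truncMin c h (insert x U) = truncMin c h U := by
  refine le_antisymm (truncMin_anti (subset_insert _ _)) (le_truncMin_iff.2 ⟨truncMin_le, ?_⟩)
  intro y hy
  rcases mem_insert.1 hy with rfl | hy
  · exact hx
  · exact truncMin_le_of_mem hy

lemma truncMin_eq_minHash (hU : ∃ x ∈ U, h x ≤ c) : truncMin c h U = minHash h U := by
  obtain ⟨x, hxU, hx⟩ := hU
  have hne : U.Nonempty := ⟨x, hxU⟩
  rw [minHash_eq_inf' hne]
  refine le_antisymm (le_inf' hne h fun y hy => truncMin_le_of_mem hy)
    (le_truncMin_iff.2 ⟨(inf'_le h hxU).trans hx, fun y hy => inf'_le h hy⟩)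

lemma truncMin_congr {h' : Fin n → ℝ} (hh : ∀ x ∈ U, h x = h' x) :
    truncMin c h U = truncMin c h' U := fold_congr hh

lemma measurable_truncMin (c : ℝ) (U : Finset (Fin n)) :
    Measurable fun h : Fin n → ℝ => truncMin c h U := by
  refine measurable_of_Ici fun v => ?_
  have : (fun h : Fin n → ℝ => truncMin c h U) ⁻¹' Set.Ici v =
      {_h | v ≤ c} ∩ ⋂ x ∈ U, {h | v ≤ h x} := by
    ext h; simp [le_truncMin_iff]
  rw [this]
  exact (MeasurableSet.const _).inter (Finset.measurableSet_biInter _ fun x _ =>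
    measurableSet_le measurable_const (measurable_pi_apply x))

/-- The law of one hash function of a `k`-mins sketch. -/
abbrev expRow (n : ℕ) : Measure (Fin n → ℝ) := Measure.pi fun _ : Fin n => expMeasure 1

instance : IsProbabilityMeasure (expMeasure 1) := HashLike.toIsProbabilityMeasure

lemma expRow_real_forall_lt (U : Finset (Fin n)) {v : ℝ} (hv : 0 ≤ v) :
    (expRow n).real {h | ∀ x ∈ U, v < h x} = Real.exp (-(U.card * v)) := by
  have h1 : {h : Fin n → ℝ | ∀ x ∈ U, v < h x} =
      Set.pi Set.univ fun x => if x ∈ U then Set.Ioi v else Set.univ := by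
    ext h
    simp only [Set.mem_ofPred_eq, Set.mem_pi, Set.mem_univ, true_implies]
    refine forall_congr' fun x => ?_
    by_cases hx : x ∈ U <;> simp [hx]
  have h2 : ∀ x, (expMeasure 1).real (if x ∈ U then Set.Ioi v else Set.univ)
      = if x ∈ U then Real.exp (-v) else 1 := by
    intro x
    by_cases hx : x ∈ U
    · simp [hx, expMeasure_real_Ioi hv]
    · simp [hx]
  rw [h1, measureReal_def, Measure.pi_pi, ENNReal.toReal_prod]
  change ∏ x, (expMeasure 1).real _ = _
  simp only [h2]
  rw [prod_ite_mem, univ_inter, prod_const, ← Real.exp_nat_mul]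
  congr 1; ring

lemma ae_expRow : ∀ᵐ h ∂expRow n, ∀ x, 0 < h x := by
  rw [ae_all_iff]; intro x
  exact (measurePreserving_eval (fun _ : Fin n => expMeasure 1) x).quasiMeasurePreserving.ae
    (HashLike.ae_pos (expMeasure 1))

lemma expRow_real_lt_truncMin {v : ℝ} (hv : 0 ≤ v) (hvc : v < c) :
    (expRow n).real {h | v < truncMin c h U} = Real.exp (-(U.card * v)) := by
  rw [← expRow_real_forall_lt U hv]
  congr 1
  ext h
  simp [lt_truncMin_iff, hvc]

/-- The mean of the smallest of `m` exponential values, truncated at `c`, is `(1 - e^{-mc}) / m`.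
-/
lemma integral_truncMin (hc : 0 < c) (hU : 0 < U.card) :
    ∫ h, truncMin c h U ∂expRow n = (1 - Real.exp (-(U.card * c))) / U.card := by
  have hm : (0 : ℝ) < U.card := by exact_mod_cast hU
  rw [integral_eq_intervalIntegral (measurable_truncMin c U) (b := c)
    (by filter_upwards [ae_expRow] with h hh using (truncMin_pos hc hh).le)
    (.of_forall fun h => truncMin_le)]
  rw [intervalIntegral.integral_congr_Ioo_of_le hc.le
    (g := fun v => Real.exp (-(U.card * v)))
    fun v hv => expRow_real_lt_truncMin hv.1.le hv.2]
  have hd : ∀ v : ℝ, HasDerivAt (fun v : ℝ => -Real.exp (-(U.card * v)) / U.card)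
      (Real.exp (-(U.card * v))) v := by
    intro v
    have h1 : HasDerivAt (fun v : ℝ => -(U.card * v)) (-(U.card * 1) : ℝ) v :=
      ((hasDerivAt_id v).const_mul _).neg
    exact (h1.exp.neg.div_const _).congr_deriv (by field_simp)
  rw [intervalIntegral.integral_eq_sub_of_hasDerivAt (fun v _ => hd v)
    (Continuous.intervalIntegrable (by fun_prop) 0 c)]
  simp
  ring

lemma integral_truncMin_sq_le (hc : 0 < c) (hU : 0 < U.card) :
    ∫ h, truncMin c h U ^ 2 ∂expRow n ≤ 2 / (U.card : ℝ) ^ 2 := by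
  have hm : (0 : ℝ) < U.card := by exact_mod_cast hU
  rw [integral_sq_eq_intervalIntegral (measurable_truncMin c U) (b := c)
    (by filter_upwards [ae_expRow] with h hh using (truncMin_pos hc hh).le)
    (.of_forall fun h => truncMin_le)]
  rw [intervalIntegral.integral_congr_Ioo_of_le hc.le
    (g := fun v => 2 * v * Real.exp (-(U.card * v)))
    fun v hv => by simp only; rw [expRow_real_lt_truncMin hv.1.le hv.2]]
  have hd : ∀ v : ℝ, HasDerivAt
      (fun v : ℝ => -(2 * v / U.card + 2 / U.card ^ 2) * Real.exp (-(U.card * v)))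
      (2 * v * Real.exp (-(U.card * v))) v := by
    intro v
    have h1 : HasDerivAt (fun v : ℝ => -(U.card * v)) (-(U.card * 1) : ℝ) v :=
      ((hasDerivAt_id v).const_mul _).neg
    have h2 : HasDerivAt (fun v : ℝ => -(2 * v / U.card + 2 / U.card ^ 2)) (-(2 * 1 / U.card) : ℝ) v :=
      ((((hasDerivAt_id v).const_mul 2).div_const _).add_const _).neg
    refine (h2.mul h1.exp).congr_deriv ?_
    field_simp
    ring
  rw [intervalIntegral.integral_eq_sub_of_hasDerivAt (fun v _ => hd v)
    (Continuous.intervalIntegrable (by fun_prop) 0 c)]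
  have : 0 ≤ (2 * c / U.card + 2 / (U.card : ℝ) ^ 2) * Real.exp (-(U.card * c)) := by positivity
  simp
  linarith

end TruncMin

/-! ### The truncated statistic of `k`-mins sketches -/

section TruncStat

variable {n k : ℕ} {c : ℝ}

/-- The law of the hash functions of a `k`-mins sketch. -/
abbrev expRows (k n : ℕ) : Measure (Fin k → Fin n → ℝ) := Measure.pi fun _ : Fin k => expRow n

/-- The statistic of a `k`-mins sketch, with each of its minima truncated at `c`. -/
def truncStat (c : ℝ) (ρ : Fin k → Fin n → ℝ) (U : Finset (Fin n)) : ℝ :=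
  ∑ l, truncMin c (ρ l) U

lemma measurable_truncStat (c : ℝ) (U : Finset (Fin n)) :
    Measurable fun ρ : Fin k → Fin n → ℝ => truncStat c ρ U :=
  Finset.measurable_sum _ fun l _ => (measurable_truncMin c U).comp (measurable_pi_apply l)

lemma expRows_real_row (l : Fin k) {p : (Fin n → ℝ) → Prop} (hp : MeasurableSet {h | p h}) :
    (expRows k n).real {ρ | p (ρ l)} = (expRow n).real {h | p h} := by
  rw [measureReal_def, measureReal_def]
  congr 1
  exact (measurePreserving_eval (fun _ : Fin k => expRow n) l).measure_preimage
    hp.nullMeasurableSet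

lemma ae_expRows : ∀ᵐ ρ ∂expRows k n, ∀ l x, 0 < ρ l x := by
  rw [ae_all_iff]; intro l
  exact (measurePreserving_eval (fun _ : Fin k => expRow n) l).quasiMeasurePreserving.ae ae_expRow

lemma truncStat_anti {ρ : Fin k → Fin n → ℝ} {U V : Finset (Fin n)} (hUV : U ⊆ V) :
    truncStat c ρ V ≤ truncStat c ρ U := sum_le_sum fun _ _ => truncMin_anti hUV

lemma truncStat_le {ρ : Fin k → Fin n → ℝ} {U : Finset (Fin n)} : truncStat c ρ U ≤ k * c := by
  calc _ ≤ ∑ _l : Fin k, c := sum_le_sum fun _ _ => truncMin_le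
    _ = k * c := by simp

lemma truncStat_nonneg (hc : 0 < c) {ρ : Fin k → Fin n → ℝ} (h0 : ∀ l x, 0 < ρ l x)
    {U : Finset (Fin n)} : 0 ≤ truncStat c ρ U :=
  sum_nonneg fun l _ => (truncMin_pos hc (h0 l)).le

/-- The variances of the independent minima add up. -/
lemma integral_truncStat_sub_sq (hc : 0 < c) (U : Finset (Fin n)) (a : ℝ) :
    ∫ ρ, (truncStat c ρ U - a) ^ 2 ∂expRows k n =
      k * (∫ h, truncMin c h U ^ 2 ∂expRow n - (∫ h, truncMin c h U ∂expRow n) ^ 2)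
        + (k * ∫ h, truncMin c h U ∂expRow n - a) ^ 2 := by
  have hb : ∀ᵐ h ∂expRow n, ‖truncMin c h U‖ ≤ c := by
    filter_upwards [ae_expRow] with h hh
    rw [Real.norm_of_nonneg (truncMin_pos hc hh).le]
    exact truncMin_le
  have hLp : MemLp (fun h => truncMin c h U) 2 (expRow n) :=
    MemLp.of_bound (measurable_truncMin c U).aestronglyMeasurable c hb
  have hb2 : ∀ᵐ ρ ∂expRows k n, ‖truncStat c ρ U‖ ≤ k * c := by
    filter_upwards [ae_expRows] with ρ hρ
    rw [Real.norm_of_nonneg (truncStat_nonneg hc hρ)]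
    exact truncStat_le
  have hLp2 : MemLp (fun ρ => truncStat c ρ U) 2 (expRows k n) :=
    MemLp.of_bound (measurable_truncStat c U).aestronglyMeasurable _ hb2
  have hvar := variance_sum_pi (μ := fun _ : Fin k => expRow n)
    (X := fun _ h => truncMin c h U) fun _ => hLp
  have hfun : (∑ i : Fin k, fun ω : Fin k → Fin n → ℝ => truncMin c (ω i) U) =
      fun ρ => truncStat c ρ U := by
    ext ρ; simp [truncStat]
  rw [hfun, variance_eq_sub hLp2] at hvar
  simp only [variance_eq_sub hLp, sum_const, card_univ, Fintype.card_fin, nsmul_eq_mul,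
    Pi.pow_apply] at hvar
  have hmean : ∫ ρ, truncStat c ρ U ∂expRows k n = k * ∫ h, truncMin c h U ∂expRow n := by
    unfold truncStat
    rw [integral_finsetSum]
    · simp only [integral_comp_eval (μ := fun _ : Fin k => expRow n)
        (measurable_truncMin c U).aestronglyMeasurable]
      simp
    · intro l _
      exact (measurePreserving_eval (fun _ : Fin k => expRow n) l).integrable_comp_of_integrable
        (hLp.integrable (by norm_num))
  have hi := hLp2.integrable (by norm_num)
  have hi2 := hLp2.integrable_sq
  have hexp : ∀ ρ : Fin k → Fin n → ℝ, (truncStat c ρ U - a) ^ 2 =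
      truncStat c ρ U ^ 2 - 2 * a * truncStat c ρ U + a ^ 2 := fun ρ => by ring
  simp only [hexp]
  rw [integral_add (f := fun ρ => truncStat c ρ U ^ 2 - 2 * a * truncStat c ρ U)
    (hi2.sub (hi.const_mul _)) (integrable_const _), integral_sub hi2 (hi.const_mul _),
    integral_const_mul]
  rw [hmean] at hvar ⊢
  simp only [integral_const, probReal_univ, one_smul]
  linarith

/-- The mean square distance of the truncated statistic of `U` from `2 k / n`, the typical value
for a query. It consists of a term of order `k / n²` for the fluctuation of the hash values, of a
term for the deviation of the size of `U` from `n / 2`, and of a trivial bound for small sets `U`.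
-/
lemma integral_truncStat_sub_sq_le (hk : 1 ≤ k) {Λ : ℝ} (hΛ1 : 1 ≤ Λ) (hkΛ : Real.log k ≤ Λ)
    (hΛ : 512 * (k * Λ) ≤ n) (U : Finset (Fin n)) :
    ∫ ρ, (truncStat (16 * Λ / n) ρ U - 2 * k / n) ^ 2 ∂expRows k n
      ≤ 64 * k / n ^ 2 + 32 * ((k : ℝ) ^ 2 / n ^ 4) * ((n : ℝ) - 2 * U.card) ^ 2
      + if (U.card : ℝ) < n / 4 then (16 * k * Λ / n) ^ 2 else 0 := by
  have hk1 : (1 : ℝ) ≤ k := by exact_mod_cast hk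
  have hkΛ' : (k : ℝ) ≤ k * Λ := le_mul_of_one_le_right (by positivity) hΛ1
  have hn0 : (0 : ℝ) < n := by linarith
  set c : ℝ := 16 * Λ / n with hc
  have hc0 : 0 < c := by positivity
  have hkc : 16 * k * Λ / n = k * c := by rw [hc]; ring
  set a : ℝ := 2 * k / n with ha
  have hac : a ≤ k * c := by
    rw [← hkc, ha, div_le_div_iff_of_pos_right hn0]; linarith
  have ha0 : 0 < a := by positivity
  have hX : 0 ≤ 64 * k / (n : ℝ) ^ 2 + 32 * ((k : ℝ) ^ 2 / n ^ 4) * ((n : ℝ) - 2 * U.card) ^ 2 := by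
    positivity
  by_cases hU : (U.card : ℝ) < n / 4
  · rw [if_pos hU, hkc]
    have h1 : ∀ᵐ ρ ∂expRows k n, (truncStat c ρ U - a) ^ 2 ≤ (k * c) ^ 2 := by
      filter_upwards [ae_expRows] with ρ hρ
      refine sq_le_sq.2 ?_
      rw [abs_of_pos (ha0.trans_le hac), abs_le]
      have h1 : truncStat c ρ U ≤ k * c := truncStat_le
      have h2 : 0 ≤ truncStat c ρ U := truncStat_nonneg hc0 hρ
      constructor <;> linarith
    have h2 : ∫ ρ, (truncStat c ρ U - a) ^ 2 ∂expRows k n ≤ ∫ _ρ, (k * c) ^ 2 ∂expRows k n := by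
      refine integral_mono_ae ((integrable_const ((k * c) ^ 2)).mono'
        (((measurable_truncStat c U).sub_const _).pow_const 2).aestronglyMeasurable ?_)
        (integrable_const _) h1
      filter_upwards [h1] with h hh
      rwa [Real.norm_of_nonneg (sq_nonneg _)]
    simp at h2
    linarith
  · rw [if_neg hU, add_zero]
    rw [not_lt] at hU
    have hm0 : (0 : ℝ) < U.card := by linarith
    have hm0' : 0 < U.card := by exact_mod_cast hm0
    rw [integral_truncStat_sub_sq hc0]
    have hsq := integral_truncMin_sq_le (n := n) (U := U) hc0 hm0'
    rw [integral_truncMin hc0 hm0']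
    set m : ℝ := (U.card : ℝ) with hm
    set e := Real.exp (-(m * c)) with he
    -- The truncation lowers each mean by a factor `1 - e`. With `m c ≥ 2 Λ ≥ 2 log k`, the total
    -- effect on the statistic is negligible.
    have he1 : k ^ 2 * e ^ 2 ≤ k := by
      have h1 : 2 * Λ ≤ m * c := by
        rw [hc, mul_div_assoc', le_div_iff₀ hn0]
        nlinarith
      have h2 : e ^ 2 ≤ 1 / k := by
        rw [he, ← Real.exp_nat_mul, one_div, ← Real.exp_log (by linarith : (0 : ℝ) < k),
          ← Real.exp_neg, Real.exp_le_exp]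
        push_cast
        linarith
      calc (k : ℝ) ^ 2 * e ^ 2 ≤ (k : ℝ) ^ 2 * (1 / k) := by gcongr
        _ = (k : ℝ) := by field_simp
    have e2 : (k : ℝ) * (∫ h, truncMin c h U ^ 2 ∂expRow n - ((1 - e) / m) ^ 2) ≤ 32 * k / n ^ 2 := by
      calc _ ≤ (k : ℝ) * (2 / m ^ 2) := by
            gcongr; linarith [sq_nonneg ((1 - e) / m)]
        _ ≤ k * (2 / (n / 4) ^ 2) := by gcongr
        _ = _ := by field_simp; norm_num
    have e3 : (k * ((1 - e) / m) - a) ^ 2 = (k * (n - 2 * m) / (n * m) - k * e / m) ^ 2 := by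
      rw [ha]; congr 1; field_simp; ring
    have e4 : (k * (n - 2 * m) / (n * m) - k * e / m) ^ 2 ≤
        2 * (k * (n - 2 * m) / (n * m)) ^ 2 + 2 * (k * e / m) ^ 2 := by
      nlinarith [sq_nonneg (k * (n - 2 * m) / (n * m) + k * e / m)]
    have e5 : 2 * (k * (n - 2 * m) / (n * m)) ^ 2 ≤ 32 * ((k : ℝ) ^ 2 / n ^ 4) * (n - 2 * m) ^ 2 := by
      calc _ = 2 * (k ^ 2 * (n - 2 * m) ^ 2) / (n ^ 2 * m ^ 2) := by field_simp
        _ ≤ 2 * (k ^ 2 * (n - 2 * m) ^ 2) / (n ^ 2 * (n / 4) ^ 2) := by gcongr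
        _ = _ := by field_simp; ring
    have e6 : 2 * (k * e / m) ^ 2 ≤ 32 * k / n ^ 2 := by
      calc _ = 2 * (k ^ 2 * e ^ 2) / m ^ 2 := by field_simp
        _ ≤ 2 * k / (n / 4) ^ 2 := by gcongr
        _ = _ := by field_simp; norm_num
    have e7 : 64 * (k : ℝ) / n ^ 2 = 32 * k / n ^ 2 + 32 * k / n ^ 2 := by ring
    rw [e3]
    linarith

/-- A query rarely misses all the keys of hash value at most `c`. -/
lemma expect_real_exists_forall_lt_le (hc : 0 ≤ c) (hc1 : c ≤ 1) :
    𝔼 U : Finset (Fin n), (expRows k n).real {ρ | ∃ l, ∀ x ∈ U, c < ρ l x}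
      ≤ k * Real.exp (-(n * c / 4)) := by
  have h1 : ∀ U : Finset (Fin n), (expRows k n).real {ρ | ∃ l, ∀ x ∈ U, c < ρ l x} ≤
      k * Real.exp (-c) ^ U.card := by
    intro U
    have hset : {ρ : Fin k → Fin n → ℝ | ∃ l, ∀ x ∈ U, c < ρ l x} =
        ⋃ l ∈ (univ : Finset (Fin k)), {ρ | ∀ x ∈ U, c < ρ l x} := by ext; simp
    have hm : MeasurableSet {h : Fin n → ℝ | ∀ x ∈ U, c < h x} := by
      have : {h : Fin n → ℝ | ∀ x ∈ U, c < h x} = ⋂ x ∈ U, {h | c < h x} := by ext; simp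
      rw [this]
      exact Finset.measurableSet_biInter _ fun x _ =>
        measurableSet_lt measurable_const (measurable_pi_apply x)
    rw [hset]
    refine (measureReal_biUnion_finset_le _ _).trans (le_of_eq ?_)
    rw [sum_congr rfl fun l _ => expRows_real_row l (p := fun h => ∀ x ∈ U, c < h x) hm]
    rw [expRow_real_forall_lt U hc, ← Real.exp_nat_mul]
    simp
  calc _ ≤ 𝔼 U : Finset (Fin n), k * Real.exp (-c) ^ U.card := expect_le_expect fun U _ => h1 U
    _ = k * ((1 + Real.exp (-c)) / 2) ^ n := by rw [← mul_expect, expect_pow_card]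
    _ ≤ k * Real.exp (-(n * c / 4)) := by
      gcongr
      rw [show -(n * c / 4 : ℝ) = n * (-(c / 4)) by ring, Real.exp_nat_mul]
      refine pow_le_pow_left₀ (by positivity) ?_ n
      have h2 := Real.add_one_le_exp (-(c / 4))
      have h3 : Real.exp (-c) ≤ 1 - c / 2 := by
        have h4 := Real.add_one_le_exp c
        rw [Real.exp_neg, inv_le_comm₀ (Real.exp_pos c) (by linarith)]
        refine le_trans ?_ h4
        rw [inv_le_iff_one_le_mul₀ (by linarith)]
        nlinarith
      linarith

end TruncStat

section KMins

variable {n k : ℕ} {c : ℝ}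

/-- Two different minima of a `k`-mins sketch are used to bound the inverse of their sum, as the
inverse of a single minimum is not integrable. -/
lemma div_sum_le_sum_offDiag (hk : 2 ≤ k) {m : Fin k → ℝ} (hm : ∀ l, 0 < m l) :
    ((k : ℝ) - 1) / ∑ l, m l ≤ 1 / (k : ℝ) ^ 2 *
      ∑ p ∈ (univ : Finset (Fin k)).offDiag, m p.1 ^ (-(1 / 2) : ℝ) * m p.2 ^ (-(1 / 2) : ℝ) := by
  have hk2 : (2 : ℝ) ≤ k := by exact_mod_cast hk
  have hcard : ((univ : Finset (Fin k)).offDiag.card : ℝ) = k * (k - 1) := by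
    rw [offDiag_card, card_univ, Fintype.card_fin, Nat.cast_sub (Nat.le_mul_self k)]
    push_cast; ring
  have : Nonempty (Fin k) := ⟨⟨0, by omega⟩⟩
  have hS : 0 < ∑ l, m l := sum_pos (fun l _ => hm l) univ_nonempty
  have hsum : ∑ p ∈ (univ : Finset (Fin k)).offDiag, (m p.1 + m p.2) = 2 * (k - 1) * ∑ l, m l := by
    have h1 : ∑ p ∈ (univ : Finset (Fin k)).offDiag, (m p.1 + m p.2) +
        ∑ p ∈ (univ : Finset (Fin k)).diag, (m p.1 + m p.2) =
        ∑ p ∈ (univ : Finset (Fin k)) ×ˢ univ, (m p.1 + m p.2) := by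
      rw [← diag_union_offDiag, sum_union (disjoint_diag_offDiag _), add_comm]
    rw [sum_diag, sum_product] at h1
    simp only [sum_add_distrib, sum_const, card_univ, Fintype.card_fin, nsmul_eq_mul,
      ← mul_sum] at h1
    rw [sum_add_distrib]
    linarith
  have hsed := sq_sum_div_le_sum_sq_div (univ : Finset (Fin k)).offDiag (fun _ => (1 : ℝ))
    (g := fun p => m p.1 + m p.2) fun p _ => add_pos (hm _) (hm _)
  rw [hsum, sum_const, nsmul_eq_mul, mul_one, hcard] at hsed
  have hk1 : (0 : ℝ) < k - 1 := by linarith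
  have e1 : ((k : ℝ) - 1) / ∑ l, m l = 2 / k ^ 2 * ((k * (k - 1)) ^ 2 / (2 * (k - 1) * ∑ l, m l)) := by
    field_simp
  -- `2 √(x y) ≤ x + y`.
  have hpair : ∀ p ∈ (univ : Finset (Fin k)).offDiag, (1 : ℝ) ^ 2 / (m p.1 + m p.2) ≤
      1 / 2 * (m p.1 ^ (-(1 / 2) : ℝ) * m p.2 ^ (-(1 / 2) : ℝ)) := by
    intro p _
    have h1 := hm p.1
    have h2 := hm p.2
    rw [Real.rpow_neg h1.le, Real.rpow_neg h2.le, ← Real.sqrt_eq_rpow, ← Real.sqrt_eq_rpow]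
    have s1 := Real.sqrt_pos.2 h1
    have s2 := Real.sqrt_pos.2 h2
    rw [one_pow, ← mul_inv, ← div_eq_mul_inv, div_div, div_le_div_iff_of_pos_left one_pos
      (by positivity) (by positivity)]
    nlinarith [sq_nonneg (√(m p.1) - √(m p.2)), Real.sq_sqrt h1.le, Real.sq_sqrt h2.le]
  rw [e1]
  calc _ ≤ 2 / (k : ℝ) ^ 2 * ∑ p ∈ (univ : Finset (Fin k)).offDiag,
        1 / 2 * (m p.1 ^ (-(1 / 2) : ℝ) * m p.2 ^ (-(1 / 2) : ℝ)) := by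
        gcongr
        exact hsed.trans (sum_le_sum hpair)
    _ = _ := by rw [← mul_sum]; ring

/-- The inverse square root of the minimum is at most `√n` when the minimum exceeds `1 / n`, and
otherwise at most the sum over the keys with small values. -/
lemma lintegral_minHash_rpow_le (hn : 0 < n) :
    ∫⁻ h, ENNReal.ofReal (minHash h univ ^ (-(1 / 2) : ℝ)) ∂expRow n
      ≤ ENNReal.ofReal (3 * √n) := by
  have hn0 : (0 : ℝ) < n := by exact_mod_cast hn
  have hne : (univ : Finset (Fin n)).Nonempty := ⟨⟨0, hn⟩, mem_univ _⟩
  set s : ℝ := 1 / n with hs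
  have hs0 : 0 < s := by positivity
  have hsq : s ^ (-(1 / 2) : ℝ) = √n := by
    rw [hs, one_div, Real.inv_rpow hn0.le, ← Real.rpow_neg hn0.le, neg_neg, Real.sqrt_eq_rpow]
  have hpt : ∀ᵐ h ∂expRow n, ENNReal.ofReal (minHash h univ ^ (-(1 / 2) : ℝ)) ≤
      ENNReal.ofReal (√n) + ∑ x, ENNReal.ofReal (invSqrtBelow s (h x)) := by
    filter_upwards [ae_expRow] with h hh
    obtain ⟨x, -, hx⟩ := exists_mem_eq_inf' hne h
    rw [← minHash_eq_inf' hne] at hx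
    rw [hx]
    by_cases hxs : h x ≤ s
    · refine le_trans ?_ le_add_self
      refine le_trans ?_ (single_le_sum (f := fun x => ENNReal.ofReal (invSqrtBelow s (h x)))
        (fun _ _ => zero_le) (mem_univ x))
      simp only [invSqrtBelow, if_pos (show h x ∈ Set.Ioc 0 s from ⟨hh x, hxs⟩)]
      exact le_rfl
    · refine le_trans ?_ le_self_add
      refine ENNReal.ofReal_le_ofReal ?_
      rw [← hsq]
      exact Real.rpow_le_rpow_of_nonpos hs0 (not_le.1 hxs).le (by norm_num)
  refine (lintegral_mono_ae hpt).trans ?_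
  have hm : Measurable fun u => ENNReal.ofReal (invSqrtBelow s u) :=
    (measurable_invSqrtBelow s).ennreal_ofReal
  rw [lintegral_add_left measurable_const, lintegral_finsetSum
    (f := fun x (h : Fin n → ℝ) => ENNReal.ofReal (invSqrtBelow s (h x))) _ fun x _ =>
    hm.comp (measurable_pi_apply x)]
  simp only [lintegral_const, measure_univ, mul_one, lintegral_eval (expMeasure 1) _ hm]
  calc _ ≤ ENNReal.ofReal (√n) + ∑ _x : Fin n, ENNReal.ofReal (2 * √s) := by
        gcongr
        exact lintegral_invSqrtBelow_le _ hs0.le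
    _ = ENNReal.ofReal (3 * √n) := by
        rw [sum_const, card_univ, Fintype.card_fin, nsmul_eq_mul, ← ENNReal.ofReal_natCast,
          ← ENNReal.ofReal_mul (by positivity), ← ENNReal.ofReal_add (by positivity) (by positivity)]
        congr 1
        rw [hs, one_div, Real.sqrt_inv]
        have h1 : (n : ℝ) = √n * √n := (Real.mul_self_sqrt hn0.le).symm
        have h2 : 0 < √(n : ℝ) := Real.sqrt_pos.2 hn0
        have h3 : (n : ℝ) * (2 * (√(n : ℝ))⁻¹) = 2 * √n := by
          nth_rewrite 1 [h1]
          field_simp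
        rw [h3]; ring

lemma lintegral_mul_rows {l l' : Fin k} (hl : l ≠ l') {F : (Fin n → ℝ) → ℝ≥0∞}
    (hF : Measurable F) :
    ∫⁻ ρ, F (ρ l) * F (ρ l') ∂expRows k n = (∫⁻ h, F h ∂expRow n) ^ 2 := by
  rw [lintegral_resample (f := fun ρ : Fin k → Fin n → ℝ => F (ρ l) * F (ρ l'))
    ((hF.comp (measurable_pi_apply l)).mul (hF.comp (measurable_pi_apply l'))) l]
  simp only [Function.update_self, Function.update_of_ne hl.symm]
  have : ∀ ρ : Fin k → Fin n → ℝ, ∫⁻ a, F a * F (ρ l') ∂expRow n =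
      (∫⁻ u, F u ∂expRow n) * F (ρ l') := fun ρ => lintegral_mul_const _ hF
  simp only [this]
  rw [lintegral_const_mul (f := fun ρ : Fin k → Fin n → ℝ => F (ρ l')) _
    (hF.comp (measurable_pi_apply l')),
    (measurePreserving_eval (fun _ : Fin k => expRow n) l').lintegral_comp hF, sq]

lemma lintegral_div_sum_minHash_le (hk : 2 ≤ k) (hn : 0 < n) :
    ∫⁻ ρ : Fin k → Fin n → ℝ, ENNReal.ofReal (((k : ℝ) - 1) / ∑ l, minHash (ρ l) univ)
      ∂expRows k n ≤ ENNReal.ofReal (9 * n) := by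
  have hk2 : (2 : ℝ) ≤ k := by exact_mod_cast hk
  have hne : (univ : Finset (Fin n)).Nonempty := ⟨⟨0, hn⟩, mem_univ _⟩
  set F : (Fin n → ℝ) → ℝ≥0∞ := fun h => ENNReal.ofReal (minHash h univ ^ (-(1 / 2) : ℝ)) with hF
  have hFm : Measurable F := ((measurable_minHash univ).pow_const _).ennreal_ofReal
  have hpt : ∀ᵐ ρ ∂expRows k n, ENNReal.ofReal (((k : ℝ) - 1) / ∑ l, minHash (ρ l) univ) ≤
      ENNReal.ofReal (1 / (k : ℝ) ^ 2) *
        ∑ p ∈ (univ : Finset (Fin k)).offDiag, F (ρ p.1) * F (ρ p.2) := by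
    filter_upwards [ae_expRows] with ρ hρ
    have hpos : ∀ l, 0 < minHash (ρ l) univ := fun l => minHash_pos (hρ l) hne
    have hnn : ∀ l, 0 ≤ minHash (ρ l) univ ^ (-(1 / 2) : ℝ) := fun l => Real.rpow_nonneg (hpos l).le _
    have h1 := div_sum_le_sum_offDiag hk (m := fun l => minHash (ρ l) univ) hpos
    refine (ENNReal.ofReal_le_ofReal h1).trans (le_of_eq ?_)
    rw [ENNReal.ofReal_mul (by positivity), ENNReal.ofReal_sum_of_nonneg fun p _ =>
      mul_nonneg (hnn _) (hnn _)]
    congr 1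
    exact sum_congr rfl fun p _ => ENNReal.ofReal_mul (hnn _)
  refine (lintegral_mono_ae hpt).trans ?_
  have hm : ∀ p : Fin k × Fin k, Measurable fun ρ : Fin k → Fin n → ℝ => F (ρ p.1) * F (ρ p.2) :=
    fun p => (hFm.comp (measurable_pi_apply p.1)).mul (hFm.comp (measurable_pi_apply p.2))
  rw [lintegral_const_mul _ (Finset.measurable_sum _ fun p _ => hm p),
    lintegral_finsetSum _ fun p _ => hm p,
    sum_congr rfl fun p hp => lintegral_mul_rows (mem_offDiag.1 hp).2.2 hFm, sum_const,
    nsmul_eq_mul]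
  calc _ ≤ ENNReal.ofReal (1 / (k : ℝ) ^ 2) *
        (ENNReal.ofReal ((k : ℝ) ^ 2) * ENNReal.ofReal (3 * √n) ^ 2) := by
        gcongr
        · rw [offDiag_card, card_univ, Fintype.card_fin, ← Nat.cast_pow, ENNReal.ofReal_natCast, sq]
          exact_mod_cast Nat.sub_le _ _
        · exact lintegral_minHash_rpow_le hn
    _ = ENNReal.ofReal (9 * n) := by
        rw [← ENNReal.ofReal_pow (by positivity), ← ENNReal.ofReal_mul (by positivity),
          ← ENNReal.ofReal_mul (by positivity), mul_pow, Real.sq_sqrt (by positivity)]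
        congr 1
        field_simp
        norm_num

/-- The expected estimate of all the keys by a `k`-mins sketch is `O(n)`. -/
lemma lintegral_estimate_univ_kMins_le (hk : 2 ≤ k) (hn : 0 < n) :
    ∫⁻ ρ, ENNReal.ofReal (estimate .kMins k (sketch .kMins k ρ univ))
      ∂hashMeasure .kMins k n ≤ ENNReal.ofReal (9 * n) := by
  refine le_trans (le_of_eq (lintegral_congr_ae ?_)) (lintegral_div_sum_minHash_le hk hn)
  filter_upwards [ae_expRows (k := k) (n := n)] with ρ hρ
  have h1 : ∑ l, |minHash (ρ l) univ| = ∑ l, minHash (ρ l) univ :=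
    sum_congr rfl fun l _ => abs_of_pos (minHash_pos (hρ l) ⟨⟨0, hn⟩, mem_univ _⟩)
  exact congrArg (fun s => ENNReal.ofReal (((k : ℝ) - 1) / s)) ((stat_kMins ρ univ).trans h1)

/-! ### Influence of a minimal key -/

lemma minHash_congr {h h' : Fin n → ℝ} {U : Finset (Fin n)} (hh : ∀ x ∈ U, h x = h' x) :
    minHash h U = minHash h' U := by
  unfold minHash
  split_ifs with hU
  · exact inf'_congr hU rfl hh
  · rfl

/-- Six values close to the smallest value are unlikely. -/
lemma real_six_near_min_le {η : ℝ} (hη : 0 ≤ η) :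
    (expRow n).real {h | ∃ y, (∀ x, h y ≤ h x) ∧
      6 ≤ (univ.filter fun x => x ≠ y ∧ h x < h y + η).card} ≤ (n * η) ^ 6 := by
  have hsub : {h : Fin n → ℝ | ∃ y, (∀ x, h y ≤ h x) ∧
      6 ≤ (univ.filter fun x => x ≠ y ∧ h x < h y + η).card} ⊆
      ⋃ S ∈ powersetCard 6 univ, {h : Fin n → ℝ | ∀ x ∈ S, h x ∈
        Set.Ico (minHash h Sᶜ) (minHash h Sᶜ + η)} := by
    rintro h ⟨y, hy, hcard⟩
    -- The minimum is determined by the keys outside the six.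
    obtain ⟨S, hS, hS6⟩ := exists_subset_card_eq hcard
    refine Set.mem_biUnion (mem_powersetCard.2 ⟨subset_univ S, hS6⟩) fun x hx => ?_
    have hyS : y ∈ Sᶜ := mem_compl.2 fun hyS => (mem_filter.1 (hS hyS)).2.1 rfl
    have hmin : minHash h Sᶜ = h y := by
      refine le_antisymm (minHash_le hyS) ?_
      rw [minHash_eq_inf' ⟨y, hyS⟩]
      exact le_inf' _ _ fun z _ => hy z
    rw [hmin]
    exact ⟨hy x, (mem_filter.1 (hS hx)).2.2⟩
  refine (measureReal_mono hsub (measure_ne_top _ _)).trans ((measureReal_biUnion_finset_le _ _).trans ?_)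
  calc _ ≤ ∑ S ∈ powersetCard 6 (univ : Finset (Fin n)), η ^ 6 := by
        refine sum_le_sum fun S hS => ?_
        have h := real_forall_mem_Ico_le (expMeasure 1) (measurable_minHash Sᶜ) hη S
          (fun x hx h a => minHash_congr fun z hz => Function.update_of_ne
            (by rintro rfl; exact (mem_compl.1 hz) hx) _ _)
        rwa [(mem_powersetCard.1 hS).2] at h
    _ = (n.choose 6 : ℝ) * η ^ 6 := by simp
    _ ≤ (n : ℝ) ^ 6 * η ^ 6 := by
        gcongr
        exact_mod_cast Nat.choose_le_pow n 6
    _ = (n * η) ^ 6 := by ring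

lemma le_freq_disjoint (S : Finset (Fin n)) :
    (1 / 2 : ℝ) ^ S.card ≤ freq (fun U : Finset (Fin n) => Disjoint U S) := by
  induction S using Finset.induction_on with
  | empty => simp [freq]
  | insert a S ha ih =>
    have h1 : freq (fun U : Finset (Fin n) => Disjoint U (insert a S)) =
        𝔼 U : Finset (Fin n), (if a ∈ U then 0 else if Disjoint U S then (1 : ℝ) else 0) := by
      rw [freq_eq]
      refine expect_congr rfl fun U _ => ?_
      simp only [disjoint_insert_right]
      by_cases h : a ∈ U <;> simp [h]
    rw [h1, expect_erase a (fun U => if Disjoint U S then (1 : ℝ) else 0),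
      card_insert_of_notMem ha, pow_succ, mul_comm]
    have h2 : ∀ U : Finset (Fin n), Disjoint (U.erase a) S ↔ Disjoint U S := fun U => by
      rw [disjoint_erase_comm, erase_eq_of_notMem ha]
    simp only [h2]
    rw [← freq_eq]
    gcongr

/-- Removing a minimal key of one hash function from a random query raises the truncated statistic
by `η` with constant probability, if few other values are within `η` of the minimum. -/
lemma le_expect_truncStat_erase_sub {ρ : Fin k → Fin n → ℝ} {l : Fin k} {y : Fin n} {η : ℝ}
    (hη : 0 ≤ η) (hc : ρ l y + η ≤ c)
    (hnear : (univ.filter fun x => x ≠ y ∧ ρ l x < ρ l y + η).card < 6) :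
    η / 32 ≤ 𝔼 U : Finset (Fin n), (truncStat c ρ (U.erase y) - truncStat c ρ (insert y U)) := by
  set S := univ.filter fun x => x ≠ y ∧ ρ l x < ρ l y + η with hS
  have hpt : ∀ U : Finset (Fin n), η * (if Disjoint U S then (1 : ℝ) else 0) ≤
      truncStat c ρ (U.erase y) - truncStat c ρ (insert y U) := by
    intro U
    have hmono : ∀ l', 0 ≤ truncMin c (ρ l') (U.erase y) - truncMin c (ρ l') (insert y U) :=
      fun l' => sub_nonneg.2 (truncMin_anti ((erase_subset _ _).trans (subset_insert _ _)))
    have hle : truncMin c (ρ l) (U.erase y) - truncMin c (ρ l) (insert y U) ≤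
        truncStat c ρ (U.erase y) - truncStat c ρ (insert y U) := by
      unfold truncStat
      rw [← sum_sub_distrib]
      exact single_le_sum (f := fun l => truncMin c (ρ l) (U.erase y) - truncMin c (ρ l) (insert y U))
        (fun l' _ => hmono l') (mem_univ l)
    refine le_trans ?_ hle
    split_ifs with hd
    · have h1 : truncMin c (ρ l) (insert y U) ≤ ρ l y := truncMin_le_of_mem (mem_insert_self y U)
      have h2 : ρ l y + η ≤ truncMin c (ρ l) (U.erase y) := by
        refine le_truncMin_iff.2 ⟨hc, fun x hx => ?_⟩
        rw [mem_erase] at hx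
        by_contra hlt
        exact disjoint_left.1 hd hx.2 (mem_filter.2 ⟨mem_univ x, hx.1, not_le.1 hlt⟩)
      linarith
    · simpa using hmono l
  calc η / 32 = η * (1 / 2) ^ 5 := by ring
    _ ≤ η * freq (fun U : Finset (Fin n) => Disjoint U S) := by
        gcongr
        refine le_trans (pow_le_pow_of_le_one (by norm_num) (by norm_num) ?_) (le_freq_disjoint S)
        omega
    _ = _ := by rw [freq_eq, mul_expect]
    _ ≤ _ := expect_le_expect fun U _ => hpt U

/-- Almost surely, the statistic tells the sets that contain a minimal key from those that do
not. -/
lemma ae_truncStat_ne (c : ℝ) : ∀ᵐ ρ ∂expRows k n, ∀ (U V : Finset (Fin n)) (l : Fin k) (w : Fin n),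
    w ∈ U → w ∉ V → (∀ x, ρ l w ≤ ρ l x) → ρ l w ≤ c → truncStat c ρ U ≠ truncStat c ρ V := by
  rw [ae_all_iff]; intro U
  rw [ae_all_iff]; intro V
  rw [ae_all_iff]; intro l
  rw [ae_all_iff]; intro w
  by_cases hwU : w ∈ U
  swap; · exact .of_forall fun ρ h => absurd h hwU
  by_cases hwV : w ∈ V
  · exact .of_forall fun ρ _ h => absurd hwV h
  have hrow : ∀ ρ : Fin k → Fin n → ℝ, ∀ V, truncStat c ρ V =
      truncMin c (ρ l) V + ∑ l' ∈ univ.erase l, truncMin c (ρ l') V := fun ρ V =>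
    (add_sum_erase univ (fun l => truncMin c (ρ l) V) (mem_univ l)).symm
  set p : (Fin k → Fin n → ℝ) → Prop := fun ρ =>
    ρ l w + ∑ l' ∈ univ.erase l, truncMin c (ρ l') U = truncStat c ρ V with hp
  have hsumm : Measurable fun ρ : Fin k → Fin n → ℝ => ∑ l' ∈ univ.erase l, truncMin c (ρ l') U :=
    Finset.measurable_sum _ fun l' _ => (measurable_truncMin c U).comp (measurable_pi_apply l')
  have hmw : Measurable fun ρ : Fin k → Fin n → ℝ => ρ l w :=
    (measurable_pi_apply w).comp (measurable_pi_apply l)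
  have hpm : MeasurableSet {ρ | p ρ} :=
    measurableSet_eq_fun (hmw.add hsumm) (measurable_truncStat c V)
  -- Given all the other values, only one value of `ρ l w` makes the two statistics equal.
  have h0 : (expRows k n).real {ρ | p ρ} ≤ 0 := by
    refine real_le_of_resample hpm l fun ρ => ?_
    have e1 : ∀ h, p (Function.update ρ l h) ↔ h w + ∑ l' ∈ univ.erase l, truncMin c (ρ l') U =
        truncMin c h V + ∑ l' ∈ univ.erase l, truncMin c (ρ l') V := by
      intro h
      have e2 : ∀ V, ∑ l' ∈ univ.erase l, truncMin c (Function.update ρ l h l') V =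
          ∑ l' ∈ univ.erase l, truncMin c (ρ l') V := fun V =>
        sum_congr rfl fun l' hl' => by rw [Function.update_of_ne (ne_of_mem_erase hl')]
      simp only [hp, hrow _ V, Function.update_self, e2]
    simp only [e1]
    refine real_le_of_resample (measurableSet_eq_fun ((measurable_pi_apply w).add_const _)
      ((measurable_truncMin c V).add_const _)) w fun h => ?_
    have e3 : ∀ a, truncMin c (Function.update h w a) V = truncMin c h V := fun a =>
      truncMin_congr fun x hx => Function.update_of_ne (by rintro rfl; exact hwV hx) _ _
    simp only [Function.update_self, e3]
    refine le_of_eq ((measureReal_eq_zero_iff).2 (measure_mono_null (fun a ha => ?_)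
      (HashLike.measure_singleton (expMeasure 1) (truncMin c h V +
        ∑ l' ∈ univ.erase l, truncMin c (ρ l') V - ∑ l' ∈ univ.erase l, truncMin c (ρ l') U))))
    rw [Set.mem_singleton_iff]
    have ha' : a + _ = _ := ha
    linarith
  have h1 : ∀ᵐ ρ ∂expRows k n, ¬ p ρ := by
    rw [ae_iff]
    simp only [not_not]
    exact (measureReal_eq_zero_iff).1 (le_antisymm h0 measureReal_nonneg)
  filter_upwards [h1] with ρ hρ _ _ hmin hwc heq
  refine hρ ?_
  simp only [hp]
  rw [← heq, hrow ρ U]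
  congr 1
  exact le_antisymm (le_truncMin_iff.2 ⟨hwc, fun x _ => hmin x⟩) (truncMin_le_of_mem hwU)

end KMins

/-! ### Keys whose pattern is exceptionally low -/

section LowPatterns

variable {n r : ℕ}

lemma apply_setPat_of_insert {β : Type*} {t : Finset (Fin n) → β} {z : Fin n}
    (h : ∀ U, t (insert z U) = t U) (q : Fin r → Finset (Fin n)) (P : Finset (Fin r)) (i : Fin r) :
    t (setPat q z P i) = t (q i) := by
  unfold setPat
  split_ifs
  · exact h _
  · rw [← h ((q i).erase z), ← h (q i)]
    congr 1
    ext y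
    by_cases hy : y = z <;> simp [hy]

/-- Few keys without influence have patterns that are exceptionally low for the responses. -/
lemma freq_card_pat_mem_lowPat_ge_le {t : Finset (Fin n) → ℝ} {L : Finset (Fin n)}
    (hL : ∀ x ∉ L, ∀ U, t (insert x U) = t U) {ε a : ℝ} (hε : 0 ≤ ε) (ha : 0 < a) :
    freq (fun q : Fin r → Finset (Fin n) => a ≤ ((univ.filter fun x => x ∉ L ∧
      pat q x ∈ lowPat (ε * 2 ^ r) fun i => t (q i)).card : ℝ)) ≤ n * ε / a := by
  have h := freq_card_filter_ge_le (univ.filter fun x => x ∉ L)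
    (fun x (q : Fin r → Finset (Fin n)) => pat q x ∈ lowPat (ε * 2 ^ r) fun i => t (q i))
    (ε := ε) (fun x hx => freq_mem_le (S := fun q => lowPat (ε * 2 ^ r) fun i => t (q i))
      (fun q P => by simp only [apply_setPat_of_insert (hL x (mem_filter.1 hx).2)])
      (fun q => card_lowPat_le (by positivity) _)) ha
  simp only [filter_filter] at h
  refine h.trans ?_
  gcongr
  exact_mod_cast (card_le_univ _).trans (by simp)

/-- A key is among the lowest ones if its pattern is exceptionally low for the responses to the
queries with this key added, as these do not exceed the actual responses, and agree with them on the
queries that contain the key. -/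
lemma mem_of_pat_mem_lowPat {T t : Finset (Fin n) → ℝ} {L W : Finset (Fin n)} {α θ : ℝ}
    {q : Fin r → Finset (Fin n)} (hαn : 0 < α * n) (hG : ∀ i, T (q i) = t (q i)) {x : Fin n}
    (hanti : ∀ U, t (insert x U) ≤ t U) (hL : (L.card : ℝ) ≤ α * n / 4)
    (hc : ((univ.filter fun z => z ∉ L ∧ pat q z ∈ lowPat θ fun i => t (q i)).card : ℝ)
      < α * n / 2)
    (hW : IsLowest (fun x => avgOn (fun i => T (q i)) (pat q x)) ⌈α * (n : ℝ)⌉₊ W)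
    (hx : pat q x ∈ lowPat θ fun i => t (insert x (q i))) : x ∈ W := by
  simp only [hG] at hW
  have hagree : avgOn (fun i => t (q i)) (pat q x) = avgOn (fun i => t (insert x (q i))) (pat q x) :=
    avgOn_congr fun i hi => by rw [insert_eq_of_mem (mem_pat.1 hi)]
  refine hW.mem_of_card_lt ?_
  have h1 : (univ.filter fun z => avgOn (fun i => t (q i)) (pat q z) ≤
      avgOn (fun i => t (q i)) (pat q x)) ⊆
      L ∪ univ.filter fun z => z ∉ L ∧ pat q z ∈ lowPat θ fun i => t (q i) := by
    intro z hz
    rw [mem_filter] at hz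
    rw [mem_union, mem_filter]
    by_cases hzL : z ∈ L
    · exact Or.inl hzL
    · refine Or.inr ⟨mem_univ _, hzL, ?_⟩
      rw [lowPat, mem_filter] at hx ⊢
      refine ⟨mem_univ _, lt_of_le_of_lt ?_ hx.2⟩
      have hsub : (univ.filter fun P' => avgOn (fun i => t (q i)) P' ≤
          avgOn (fun i => t (q i)) (pat q z)) ⊆ univ.filter fun P' =>
            avgOn (fun i => t (insert x (q i))) P' ≤ avgOn (fun i => t (insert x (q i))) (pat q x) := by
        intro P hP
        rw [mem_filter] at hP ⊢
        refine ⟨mem_univ _, ?_⟩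
        rw [← hagree]
        exact (avgOn_mono (fun i => hanti (q i)) P).trans (hP.2.trans hz.2)
      exact_mod_cast card_le_card hsub
  have h2 : ((univ.filter fun z => avgOn (fun i => t (q i)) (pat q z) ≤
      avgOn (fun i => t (q i)) (pat q x)).card : ℝ) ≤ L.card +
      (univ.filter fun z => z ∉ L ∧ pat q z ∈ lowPat θ fun i => t (q i)).card := by
    exact_mod_cast (card_le_card h1).trans (card_union_le _ _)
  have h3 := Nat.le_ceil (α * (n : ℝ))
  have h4 : ((univ.filter fun z => avgOn (fun i => t (q i)) (pat q z) ≤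
      avgOn (fun i => t (q i)) (pat q x)).card : ℝ) < ⌈α * (n : ℝ)⌉₊ := by linarith
  exact_mod_cast h4

/-- The key `w` is in at least a quarter of the queries, and out of at least a quarter. -/
def IsBalanced (q : Fin r → Finset (Fin n)) (w : Fin n) : Prop :=
  (r : ℝ) / 4 ≤ (pat q w).card ∧ ((pat q w).card : ℝ) ≤ 3 / 4 * r

/-- Chebyshev's inequality for the number of queries that contain `w`. -/
lemma freq_not_isBalanced_le (hr : 0 < r) (w : Fin n) :
    freq (fun q : Fin r → Finset (Fin n) => ¬ IsBalanced q w) ≤ 4 / r := by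
  have hr' : (0 : ℝ) < r := by exact_mod_cast hr
  set f : Finset (Fin n) → ℝ := fun U => if w ∈ U then 1 else 0 with hf
  have hm : 𝔼 U, f U = 1 / 2 := by
    rw [hf, expect_mem_mul w (fun _ => (1 : ℝ)), Fintype.expect_const]; norm_num
  have hv : 𝔼 U, (f U - 𝔼 U, f U) ^ 2 = 1 / 4 := by
    rw [hm]
    have : ∀ U, (f U - 1 / 2) ^ 2 = 1 / 4 := fun U => by
      simp only [hf]; split_ifs <;> norm_num
    simp only [this, Fintype.expect_const]
  have hch := freq_abs_sum_sub_le (ι := Fin r) f (a := r / 4) (by positivity)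
  rw [hv, hm, Fintype.card_fin] at hch
  refine le_trans (freq_mono fun q hq => ?_) (hch.trans (le_of_eq (by field_simp)))
  have hsum : ∑ i, f (q i) = (pat q w).card := by
    simp only [hf, pat]; rw [sum_boole]
  rw [hsum]
  by_contra hlt
  rw [not_le, abs_lt] at hlt
  exact hq ⟨by linarith, by linarith⟩

end LowPatterns

section Miss

variable {n k r : ℕ} {c : ℝ}

/-- A key whose values all exceed the truncation level has no influence. -/
lemma truncStat_insert_of_lt {ρ : Fin k → Fin n → ℝ} {x : Fin n} (hx : ∀ l, c ≤ ρ l x)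
    (U : Finset (Fin n)) : truncStat c ρ (insert x U) = truncStat c ρ U :=
  sum_congr rfl fun l _ => truncMin_insert_of_le (truncMin_le.trans (hx l))

/-- The keys of `X` matter for a single hash function, and then only through the one with the
smallest value. Their patterns are therefore revealed by increasing values, and the minimal key of
another hash function makes the responses spread out. -/
lemma freq_isBalanced_and_forall_notMem_lowPat_le {ρ : Fin k → Fin n → ℝ} {l l' : Fin k}
    (hl : l' ≠ l) (hgen : ∀ (U V : Finset (Fin n)) (l : Fin k) (w : Fin n), w ∈ U → w ∉ V →
      (∀ x, ρ l w ≤ ρ l x) → ρ l w ≤ c → truncStat c ρ U ≠ truncStat c ρ V)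
    (hlow : ∃ x, ρ l' x ≤ c) {p : ℝ} (hp0 : 0 < p) (hp1 : 2 * p ≤ 1) (hr : 8 ≤ p ^ 2 * r)
    {X : Finset (Fin n)} (hX : ∀ x ∈ X, ∀ l'', l'' ≠ l → c < ρ l'' x) :
    freq (fun q : Fin r → Finset (Fin n) =>
      (∃ w, (∀ x, ρ l' w ≤ ρ l' x) ∧ IsBalanced q w) ∧
        ∀ x ∈ X, pat q x ∉ lowPat (2 * p * 2 ^ r) fun i => truncStat c ρ (insert x (q i)))
      ≤ (1 - p) ^ X.card := by
  obtain ⟨x₀, hx₀⟩ := hlow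
  have hwX : ∀ w, (∀ x, ρ l' w ≤ ρ l' x) → w ∉ X := fun w hw hwX => by
    have := hX w hwX l' hl
    linarith [hw x₀]
  refine freq_forall_notMem_le (key := ρ l)
    (S := fun x q => lowPat (2 * p * 2 ^ r) fun i => truncStat c ρ (insert x (q i)))
    (E := fun q => ∃ w, (∀ x, ρ l' w ≤ ρ l' x) ∧ IsBalanced q w) (by linarith) ?_ ?_ ?_
  -- A key `z` with a larger value than `x` does not influence the responses with `x` added.
  · intro x hx z hz hxz q P
    have h1 : ∀ U, truncStat c ρ (insert x (insert z U)) = truncStat c ρ (insert x U) := by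
      intro U
      rw [insert_comm]
      refine sum_congr rfl fun l'' _ => truncMin_insert_of_le ?_
      by_cases hl'' : l'' = l
      · subst hl''
        exact (truncMin_le_of_mem (mem_insert_self x U)).trans hxz
      · exact truncMin_le.trans (hX z hz l'' hl'').le
    simp only [apply_setPat_of_insert (t := fun U => truncStat c ρ (insert x U)) h1]
  · intro z hz q P
    refine exists_congr fun w => and_congr_right fun hw => ?_
    have hne : w ≠ z := fun h => hwX w hw (h ▸ hz)
    rw [IsBalanced, IsBalanced, pat_setPat_of_ne q P hne]
  · rintro x hx q ⟨w, hw, hbal⟩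
    have hne : w ≠ x := fun h => hwX w hw (h ▸ hx)
    have hwc : ρ l' w ≤ c := (hw x₀).trans hx₀
    have hsep : ∀ i j, w ∈ q i → w ∉ q j →
        truncStat c ρ (insert x (q i)) ≠ truncStat c ρ (insert x (q j)) := fun i j hi hj =>
      hgen _ _ l' w (mem_insert_of_mem hi) (by simp [hne, hj]) hw hwc
    -- No response is shared by a query that contains `w` and one that does not, and each of the
    -- two classes has at most three quarters of the queries.
    have hclass : ∀ s, ((univ.filter fun i => truncStat c ρ (insert x (q i)) = s).card : ℝ) ≤
        3 / 4 * r := by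
      intro s
      by_cases hex : ∃ i, truncStat c ρ (insert x (q i)) = s ∧ w ∈ q i
      · obtain ⟨i, his, hi⟩ := hex
        refine le_trans ?_ hbal.2
        refine Nat.cast_le.2 (card_le_card fun j hj => ?_)
        rw [mem_pat]
        by_contra hwj
        exact hsep i j hi hwj (his.trans (mem_filter.1 hj).2.symm)
      · push Not at hex
        have h1 : (univ.filter fun i => truncStat c ρ (insert x (q i)) = s) ⊆ (pat q w)ᶜ :=
          fun j hj => by
            rw [mem_compl, mem_pat]; exact hex j (mem_filter.1 hj).2
        have h2 := card_le_card h1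
        rw [card_compl, Fintype.card_fin] at h2
        have h3 : (pat q w).card ≤ r := (card_le_univ _).trans (by simp)
        have h4 : ((univ.filter fun i => truncStat c ρ (insert x (q i)) = s).card : ℝ) ≤
            r - (pat q w).card := by
          rw [← Nat.cast_sub h3]; exact_mod_cast h2
        linarith [hbal.1]
    -- The averages have atoms of mass at most `p`, so the threshold `2 p` leaves at least `p`.
    have h := le_card_lowPat (θ := 2 * p * 2 ^ r) (p := p * 2 ^ r)
      (v := fun i => truncStat c ρ (insert x (q i)))
      (by nlinarith [pow_pos (two_pos : (0 : ℝ) < 2) r]) (by positivity)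
      fun s => card_avgOn_eq_le hp0 hr (hclass s)
    linarith

/-- A mean is at most `ε` if its conditional mean is, given all coordinates but one. -/
lemma integral_le_of_resample {ι : Type*} [Fintype ι] [DecidableEq ι] {Y : ι → Type*}
    [∀ i, MeasurableSpace (Y i)] {μ : ∀ i, Measure (Y i)} [∀ i, IsProbabilityMeasure (μ i)]
    {F : (∀ i, Y i) → ℝ} (hF : Measurable F) (h0 : ∀ ω, 0 ≤ F ω) (h1 : ∀ ω, F ω ≤ 1) (i : ι) {ε : ℝ}
    (hε : 0 ≤ ε) (h : ∀ ω, ∫ a, F (Function.update ω i a) ∂μ i ≤ ε) :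
    ∫ ω, F ω ∂Measure.pi μ ≤ ε := by
  rw [integral_eq_lintegral_of_nonneg_ae (.of_forall h0) hF.aestronglyMeasurable]
  refine ENNReal.toReal_le_of_le_ofReal hε ?_
  rw [lintegral_resample hF.ennreal_ofReal i]
  calc _ ≤ ∫⁻ _ω, ENNReal.ofReal ε ∂Measure.pi μ := lintegral_mono fun ω => ?_
    _ = ENNReal.ofReal ε := by simp
  have hi : Integrable (fun a => F (Function.update ω i a)) (μ i) :=
    (integrable_const (1 : ℝ)).mono' (hF.comp (measurable_update ω)).aestronglyMeasurable
      (.of_forall fun a => by rw [Real.norm_of_nonneg (h0 _)]; exact h1 _)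
  rw [← ofReal_integral_eq_lintegral_ofReal hi (.of_forall fun a => h0 _)]
  exact ENNReal.ofReal_le_ofReal (h ω)

/-- The generating function of the number of keys of `Y` with a value at most `v`. -/
lemma integral_pow_card_row_le {v p : ℝ} (hv0 : 0 ≤ v) (hv1 : v ≤ 1) (hp0 : 0 ≤ p)
    (hp1 : p ≤ 1) (Y : Finset (Fin n)) :
    ∫ h, (1 - p) ^ (Y.filter fun x => h x ≤ v).card ∂expRow n ≤ Real.exp (-(p * v * Y.card / 2)) := by
  have h1 : ∀ h : Fin n → ℝ, (1 - p) ^ (Y.filter fun x => h x ≤ v).card =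
      ∏ x, (fun x a => if x ∈ Y then (if a ≤ v then 1 - p else 1) else 1) x (h x) := by
    intro h
    simp only
    rw [prod_ite_mem, univ_inter, prod_ite, prod_const_one, mul_one, prod_const]
  simp only [h1]
  rw [expRow, integral_fintype_prod_eq_prod (𝕜 := ℝ) (μ := fun _ : Fin n => expMeasure 1)
    (f := fun x a => if x ∈ Y then (if a ≤ v then 1 - p else (1 : ℝ)) else 1)]
  have h2 : ∀ x : Fin n, ∫ a, (if x ∈ Y then (if a ≤ v then 1 - p else (1 : ℝ)) else 1) ∂expMeasure 1
      ≤ if x ∈ Y then Real.exp (-(p * v / 2)) else 1 := by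
    intro x
    by_cases hx : x ∈ Y
    · simp only [hx, if_true]
      have h3 : ∀ a : ℝ, (if a ≤ v then 1 - p else (1 : ℝ)) = (1 - p) + p * (Set.Ioi v).indicator 1 a := by
        intro a
        by_cases ha : a ≤ v
        · simp [ha]
        · simp [ha, not_le.1 ha]
      have hi : Integrable ((Set.Ioi v).indicator (1 : ℝ → ℝ)) (expMeasure 1) :=
        (integrable_const (1 : ℝ)).indicator measurableSet_Ioi
      simp only [h3]
      rw [integral_add (integrable_const _) (hi.const_mul _), integral_const_mul,
        integral_indicator_one measurableSet_Ioi, expMeasure_real_Ioi hv0]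
      simp only [integral_const, probReal_univ, one_smul]
      have h4 : Real.exp (-v) ≤ 1 - v / 2 := by
        have h5 := Real.add_one_le_exp v
        rw [Real.exp_neg, inv_le_comm₀ (Real.exp_pos v) (by linarith)]
        refine le_trans ?_ h5
        rw [inv_le_iff_one_le_mul₀ (by linarith)]
        nlinarith
      have h6 := Real.add_one_le_exp (-(p * v / 2))
      nlinarith
    · simp [hx]
  have h3 : ∀ x : Fin n, 0 ≤ ∫ a, (if x ∈ Y then (if a ≤ v then 1 - p else (1 : ℝ)) else 1) ∂expMeasure 1 :=
    fun x => integral_nonneg fun a => by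
      simp only [Pi.zero_apply]
      split_ifs <;> linarith
  refine (prod_le_prod (fun x _ => h3 x) fun x _ => h2 x).trans (le_of_eq ?_)
  rw [prod_ite_mem, univ_inter, prod_const, ← Real.exp_nat_mul]
  congr 1; ring

lemma measurableSet_forall_ne_lt (c : ℝ) (l : Fin k) (x : Fin n) :
    MeasurableSet {ρ : Fin k → Fin n → ℝ | ∀ l'', l'' ≠ l → c < ρ l'' x} := by
  have : {ρ : Fin k → Fin n → ℝ | ∀ l'', l'' ≠ l → c < ρ l'' x} =
      ⋂ l'' ∈ univ.erase l, {ρ | c < ρ l'' x} := by ext; simp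
  rw [this]
  exact Finset.measurableSet_biInter _ fun l'' _ => measurableSet_lt measurable_const
    ((measurable_pi_apply x).comp (measurable_pi_apply l''))

lemma measurableSet_apply_le (l : Fin k) (x : Fin n) (v : ℝ) :
    MeasurableSet {ρ : Fin k → Fin n → ℝ | ρ l x ≤ v} :=
  measurableSet_le ((measurable_pi_apply x).comp (measurable_pi_apply l)) measurable_const

lemma measurable_ite_pow_card (c v p : ℝ) (l : Fin k) : Measurable fun ρ : Fin k → Fin n → ℝ =>
    if (n : ℝ) / 2 ≤ (univ.filter fun x => ∀ l'', l'' ≠ l → c < ρ l'' x).card then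
      (1 - p) ^ (univ.filter fun x => (∀ l'', l'' ≠ l → c < ρ l'' x) ∧ ρ l x ≤ v).card else 0 := by
  refine Measurable.ite (measurableSet_le measurable_const
    (measurable_card_filter univ fun x _ => measurableSet_forall_ne_lt c l x)) ?_ measurable_const
  have h1 : ∀ ρ : Fin k → Fin n → ℝ,
      (1 - p) ^ (univ.filter fun x => (∀ l'', l'' ≠ l → c < ρ l'' x) ∧ ρ l x ≤ v).card =
      ∏ x, if ρ ∈ {ρ : Fin k → Fin n → ℝ | ∀ l'', l'' ≠ l → c < ρ l'' x} ∩ {ρ | ρ l x ≤ v}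
        then 1 - p else 1 := by
    intro ρ
    rw [prod_ite, prod_const_one, mul_one, prod_const]
    congr
  simp only [h1]
  exact Finset.measurable_prod _ fun x _ => Measurable.ite
    ((measurableSet_forall_ne_lt c l x).inter (measurableSet_apply_le l x v)) measurable_const
    measurable_const

lemma ite_pow_card_mem_Icc {c v p : ℝ} (hp0 : 0 ≤ p) (hp1 : p ≤ 1) (l : Fin k)
    (ρ : Fin k → Fin n → ℝ) :
    (if (n : ℝ) / 2 ≤ (univ.filter fun x => ∀ l'', l'' ≠ l → c < ρ l'' x).card then
      (1 - p) ^ (univ.filter fun x => (∀ l'', l'' ≠ l → c < ρ l'' x) ∧ ρ l x ≤ v).card else 0)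
      ∈ Set.Icc (0 : ℝ) 1 := by
  split_ifs
  · exact ⟨pow_nonneg (by linarith) _, pow_le_one₀ (by linarith) (by linarith)⟩
  · exact ⟨le_rfl, zero_le_one⟩

/-- The mean of `(1 - p) ^ m`, where `m` is the number of the keys with a value at most `v` of the
hash function `l` among the keys that have large values of all the other hash functions. The other
hash functions determine the latter keys, and are required to leave at least `n / 2` of them. -/
lemma integral_pow_card_le (l : Fin k) {v p : ℝ} (hv0 : 0 ≤ v) (hv1 : v ≤ 1) (hp0 : 0 ≤ p)
    (hp1 : p ≤ 1) :
    ∫ ρ : Fin k → Fin n → ℝ,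
      (if (n : ℝ) / 2 ≤ (univ.filter fun x => ∀ l'', l'' ≠ l → c < ρ l'' x).card then
        (1 - p) ^ (univ.filter fun x => (∀ l'', l'' ≠ l → c < ρ l'' x) ∧ ρ l x ≤ v).card else 0)
      ∂expRows k n ≤ Real.exp (-(p * v * n / 4)) := by
  refine integral_le_of_resample (μ := fun _ : Fin k => expRow n) (measurable_ite_pow_card c v p l)
    (fun ρ => (ite_pow_card_mem_Icc hp0 hp1 l ρ).1) (fun ρ => (ite_pow_card_mem_Icc hp0 hp1 l ρ).2) l
    (Real.exp_pos _).le fun ρ => ?_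
  set Y := univ.filter fun x => ∀ l'', l'' ≠ l → c < ρ l'' x with hY
  have e1 : ∀ h x, (∀ l'', l'' ≠ l → c < Function.update ρ l h l'' x) ↔
      ∀ l'', l'' ≠ l → c < ρ l'' x := fun h x =>
    forall_congr' fun l'' => imp_congr_right fun hl => by rw [Function.update_of_ne hl]
  simp only [e1, Function.update_self, ← filter_filter]
  rw [← hY]
  split_ifs with hcase
  · refine (integral_pow_card_row_le hv0 hv1 hp0 hp1 Y).trans (Real.exp_le_exp.2 ?_)
    have : p * v * (n / 2) ≤ p * v * Y.card := by gcongr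
    linarith
  · simp only [integral_zero]; exact (Real.exp_pos _).le

end Miss

/-! ### The two ways to catch a key with a small hash value -/

section Catch

variable {n k r : ℕ} {c : ℝ}

lemma measurableSet_isMin (l : Fin k) (y : Fin n) :
    MeasurableSet {ρ : Fin k → Fin n → ℝ | ∀ x, ρ l y ≤ ρ l x} := by
  have e : {ρ : Fin k → Fin n → ℝ | ∀ x, ρ l y ≤ ρ l x} = ⋂ x, {ρ | ρ l y ≤ ρ l x} := by ext; simp
  rw [e]
  exact MeasurableSet.iInter fun x => measurableSet_le
    ((measurable_pi_apply y).comp (measurable_pi_apply l))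
    ((measurable_pi_apply x).comp (measurable_pi_apply l))

lemma measurableSet_exists_apply_le (l : Fin k) (v : ℝ) :
    MeasurableSet {ρ : Fin k → Fin n → ℝ | ∃ x, ρ l x ≤ v} := by
  have e : {ρ : Fin k → Fin n → ℝ | ∃ x, ρ l x ≤ v} = ⋃ x, {ρ | ρ l x ≤ v} := by ext; simp
  rw [e]
  exact MeasurableSet.iUnion fun x => measurableSet_apply_le l x v

/-- The variance of the truncated statistic over the queries. -/
def truncVar (c : ℝ) (ρ : Fin k → Fin n → ℝ) : ℝ :=
  𝔼 U, (truncStat c ρ U - 𝔼 U, truncStat c ρ U) ^ 2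

lemma measurable_truncVar (c : ℝ) : Measurable fun ρ : Fin k → Fin n → ℝ => truncVar c ρ :=
  measurable_expect fun U => ((measurable_truncStat c U).sub
    (measurable_expect (measurable_truncStat c))).pow_const 2

lemma measurable_sum_pat_truncStat (c δ : ℝ) (q : Fin r → Finset (Fin n)) (x : Fin n) :
    Measurable fun ρ : Fin k → Fin n → ℝ =>
      ∑ i ∈ pat q x, (truncStat c ρ (q i) - (𝔼 U, truncStat c ρ U - δ)) :=
  Finset.measurable_sum _ fun _ _ => (measurable_truncStat c _).sub
    ((measurable_expect (measurable_truncStat c)).sub_const _)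

/-- The variance is small, but the average of the statistic over the queries with the minimal key
of the hash function `l` is not lower by `δ` than the mean. -/
def HighMin (c K δ : ℝ) (l : Fin k) (ρ : Fin k → Fin n → ℝ) (q : Fin r → Finset (Fin n)) : Prop :=
  truncVar c ρ < K ∧ (∃ x, ρ l x ≤ c / 2) ∧ ∀ y, (∀ x, ρ l y ≤ ρ l x) →
    0 ≤ ∑ i ∈ pat q y, (truncStat c ρ (q i) - (𝔼 U, truncStat c ρ U - δ))

lemma measurableSet_highMin (c K δ : ℝ) (l : Fin k) (q : Fin r → Finset (Fin n)) :
    MeasurableSet {ρ | HighMin c K δ l ρ q} := by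
  have e : {ρ | HighMin c K δ l ρ q} = {ρ | truncVar c ρ < K} ∩ ({ρ | ∃ x, ρ l x ≤ c / 2} ∩
      ⋂ y, ({ρ : Fin k → Fin n → ℝ | ∀ x, ρ l y ≤ ρ l x}ᶜ ∪
        {ρ | 0 ≤ ∑ i ∈ pat q y, (truncStat c ρ (q i) - (𝔼 U, truncStat c ρ U - δ))})) := by
    ext ρ
    simp only [HighMin, Set.mem_ofPred_eq, Set.mem_inter_iff, Set.mem_iInter, Set.mem_union,
      Set.mem_compl_iff, imp_iff_not_or]
  rw [e]
  exact (measurableSet_lt (measurable_truncVar c) measurable_const).inter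
    ((measurableSet_exists_apply_le l _).inter (MeasurableSet.iInter fun y =>
      (measurableSet_isMin l y).compl.union
        (measurableSet_le measurable_const (measurable_sum_pat_truncStat c δ q y))))

lemma measurableSet_six_near_min (η : ℝ) : MeasurableSet {h : Fin n → ℝ | ∃ y, (∀ x, h y ≤ h x) ∧
    6 ≤ (univ.filter fun x => x ≠ y ∧ h x < h y + η).card} := by
  have e : {h : Fin n → ℝ | ∃ y, (∀ x, h y ≤ h x) ∧
      6 ≤ (univ.filter fun x => x ≠ y ∧ h x < h y + η).card} =
      ⋃ y, ((⋂ x, {h : Fin n → ℝ | h y ≤ h x}) ∩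
        {h | (6 : ℝ) ≤ ((univ.filter fun x => x ≠ y ∧ h x < h y + η).card : ℝ)}) := by
    ext h
    simp only [Set.mem_ofPred_eq, Set.mem_iUnion, Set.mem_inter_iff, Set.mem_iInter,
      Nat.ofNat_le_cast]
  have hxy : ∀ x y : Fin n, MeasurableSet {h : Fin n → ℝ | x ≠ y ∧ h x < h y + η} := by
    intro x y
    have e2 : {h : Fin n → ℝ | x ≠ y ∧ h x < h y + η} =
        {_h | x ≠ y} ∩ {h | h x < h y + η} := rfl
    rw [e2]
    have hm : Measurable fun h : Fin n → ℝ => h y + η := by fun_prop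
    exact (MeasurableSet.const _).inter (measurableSet_lt (measurable_pi_apply x) hm)
  have hc : ∀ y : Fin n, MeasurableSet {h : Fin n → ℝ |
      (6 : ℝ) ≤ ((univ.filter fun x => x ≠ y ∧ h x < h y + η).card : ℝ)} := fun y =>
    measurableSet_le measurable_const (measurable_card_filter
      (p := fun x (h : Fin n → ℝ) => x ≠ y ∧ h x < h y + η) univ fun x _ => hxy x y)
  rw [e]
  exact MeasurableSet.iUnion fun y => (MeasurableSet.iInter fun x =>
    measurableSet_le (measurable_pi_apply y) (measurable_pi_apply x)).inter (hc y)

/-- The minimal key of a hash function lowers the statistic by a visible amount, unless several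
other keys have values that are close to the smallest one. -/
lemma jprob_highMin_le {K δ η ε : ℝ} (l : Fin k) (hr : 0 < r) (hδ : 0 < δ)
    (hδη : 128 * δ ≤ η) (hηc : η ≤ c / 2) (hε0 : 0 ≤ ε)
    (hε : 64 * (K + δ ^ 2) / (r * (η / 32) ^ 2) ≤ ε) :
    jprob (r := r) (expRows k n) (HighMin c K δ l) ≤ (n * η) ^ 6 + ε := by
  have hη : 0 < η := by linarith
  -- Either six other values are close to the minimum, or the minimal key has influence at least
  -- `η / 32`.
  set near : (Fin n → ℝ) → Prop := fun h => ∃ y, (∀ x, h y ≤ h x) ∧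
      6 ≤ (univ.filter fun x => x ≠ y ∧ h x < h y + η).card
  have hnm : MeasurableSet {h | near h} := measurableSet_six_near_min η
  have hnp : (expRow n).real {h | near h} ≤ (n * η) ^ 6 := real_six_near_min_le hη.le
  have hnn : ∀ ρ : Fin k → Fin n → ℝ, ¬ near (ρ l) → ∀ y, (∀ x, ρ l y ≤ ρ l x) →
      (univ.filter fun x => x ≠ y ∧ ρ l x < ρ l y + η).card < 6 := fun ρ hN y hy =>
    not_le.1 fun hle => hN ⟨y, hy, hle⟩
  clear_value near
  have h1 : jprob (r := r) (expRows k n) (HighMin c K δ l) ≤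
      jprob (r := r) (expRows k n) (fun ρ q => near (ρ l) ∨ (¬ near (ρ l) ∧ HighMin c K δ l ρ q)) :=
    jprob_mono fun ρ q h => by
      by_cases hN : near (ρ l)
      · exact Or.inl hN
      · exact Or.inr ⟨hN, h⟩
  have h2 : jprob (r := r) (expRows k n) (fun ρ (_ : Fin r → Finset (Fin n)) => near (ρ l)) ≤ (n * η) ^ 6 := by
    rw [jprob_const, expRows_real_row l hnm]
    exact hnp
  have h3 : jprob (r := r) (expRows k n) (fun ρ q => ¬ near (ρ l) ∧ HighMin c K δ l ρ q) ≤ ε := by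
    refine jprob_le_of_freq (fun q => ?_) (.of_forall fun ρ => ?_)
    · have e : {ρ | ¬ near (ρ l) ∧ HighMin c K δ l ρ q} =
          {ρ : Fin k → Fin n → ℝ | near (ρ l)}ᶜ ∩ {ρ | HighMin c K δ l ρ q} := rfl
      rw [e]
      have hm : MeasurableSet ((fun ρ : Fin k → Fin n → ℝ => ρ l) ⁻¹' {h | near h}) :=
        (measurable_pi_apply l) hnm
      exact hm.compl.inter (measurableSet_highMin c K δ l q)
    · by_cases hgood : ¬ near (ρ l) ∧ truncVar c ρ < K ∧ ∃ x, ρ l x ≤ c / 2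
      · obtain ⟨hN, hV, x, hx⟩ := hgood
        obtain ⟨y, -, hy⟩ := exists_min_image univ (ρ l) ⟨x, mem_univ x⟩
        have hy' : ∀ x, ρ l y ≤ ρ l x := fun x => hy x (mem_univ x)
        have hcard : (univ.filter fun x => x ≠ y ∧ ρ l x < ρ l y + η).card < 6 :=
          hnn ρ hN y hy'
        have h2 := freq_sum_nonneg_le (t := truncStat c ρ) hδ
            (le_expect_truncStat_erase_sub (c := c) hη.le (by linarith [hy' x]) hcard) (by linarith) hr
        refine (freq_mono (q := fun q : Fin r → Finset (Fin n) =>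
          0 ≤ ∑ i ∈ pat q y, (truncStat c ρ (q i) - (𝔼 U, truncStat c ρ U - δ)))
            fun q hq => hq.2.2.2 y hy').trans (h2.trans (le_trans ?_ hε))
        have h3 : 64 * (truncVar c ρ + δ ^ 2) / (r * (η / 32) ^ 2) ≤
          64 * (K + δ ^ 2) / (r * (η / 32) ^ 2) := by gcongr
        exact h3
      · refine le_trans (freq_mono (q := fun _ => False) fun q hq =>
          hgood ⟨hq.1, hq.2.1, hq.2.2.1⟩) ?_
        rw [freq_false]; exact hε0
  have h4 := jprob_or_le (μ := expRows k n) (fun ρ (_ : Fin r → Finset (Fin n)) => near (ρ l))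
    (fun ρ q => ¬ near (ρ l) ∧ HighMin c K δ l ρ q)
  exact h1.trans (h4.trans (add_le_add h2 h3))

lemma measurableSet_mem_lowPat {X : Type*} [MeasurableSpace X] {f : X → Fin r → ℝ}
    (hf : ∀ i, Measurable fun x => f x i) (θ : ℝ) (P : Finset (Fin r)) :
    MeasurableSet {x | P ∈ lowPat θ (f x)} := by
  have hm : ∀ P, Measurable fun x => avgOn (f x) P := fun P =>
    (Finset.measurable_sum P fun i _ => hf i).div_const _
  have e : {x | P ∈ lowPat θ (f x)} =
      {x | ∑ P', (if avgOn (f x) P' ≤ avgOn (f x) P then (1 : ℝ) else 0) < θ} := by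
    ext x
    simp only [lowPat, Set.mem_ofPred_eq, mem_filter, mem_univ, true_and, sum_boole]
  rw [e]
  exact measurableSet_lt (Finset.measurable_sum _ fun P' _ =>
    Measurable.ite (measurableSet_le (hm P') (hm P)) measurable_const measurable_const)
    measurable_const

/-- Many keys have large values of all the hash functions but `l`, and the minimal key of `l'` is in
a balanced number of queries, but no key with a value at most `v` of `l` has an exceptionally low
pattern. -/
def NoLowPat (c p v : ℝ) (l l' : Fin k) (ρ : Fin k → Fin n → ℝ) (q : Fin r → Finset (Fin n)) :
    Prop :=
  ((n : ℝ) / 2 ≤ (univ.filter fun x => ∀ l'', l'' ≠ l → c < ρ l'' x).card ∧ ∃ x, ρ l' x ≤ c) ∧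
    (∃ w, (∀ x, ρ l' w ≤ ρ l' x) ∧ IsBalanced q w) ∧
    ∀ x ∈ univ.filter fun x => (∀ l'', l'' ≠ l → c < ρ l'' x) ∧ ρ l x ≤ v,
      pat q x ∉ lowPat (2 * p * 2 ^ r) fun i => truncStat c ρ (insert x (q i))

lemma measurableSet_noLowPat (c p v : ℝ) (l l' : Fin k) (q : Fin r → Finset (Fin n)) :
    MeasurableSet {ρ | NoLowPat c p v l l' ρ q} := by
  have e : {ρ | NoLowPat c p v l l' ρ q} =
      ({ρ | (n : ℝ) / 2 ≤ (univ.filter fun x => ∀ l'', l'' ≠ l → c < ρ l'' x).card} ∩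
        {ρ | ∃ x, ρ l' x ≤ c}) ∩ ((⋃ w, ({ρ | ∀ x, ρ l' w ≤ ρ l' x} ∩ {_ρ | IsBalanced q w})) ∩
        ⋂ x, (({ρ : Fin k → Fin n → ℝ | ∀ l'', l'' ≠ l → c < ρ l'' x} ∩ {ρ | ρ l x ≤ v})ᶜ ∪
          {ρ | pat q x ∈ lowPat (2 * p * 2 ^ r) fun i => truncStat c ρ (insert x (q i))}ᶜ)) := by
    ext ρ
    simp only [NoLowPat, Set.mem_ofPred_eq, Set.mem_inter_iff, Set.mem_iInter, Set.mem_union,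
      Set.mem_iUnion, Set.mem_compl_iff, mem_filter, mem_univ, true_and, imp_iff_not_or]
  rw [e]
  refine ((measurableSet_le measurable_const (measurable_card_filter univ fun x _ =>
    measurableSet_forall_ne_lt c l x)).inter (measurableSet_exists_apply_le l' c)).inter
      ((MeasurableSet.iUnion fun w => (measurableSet_isMin l' w).inter (MeasurableSet.const _)).inter
        (MeasurableSet.iInter fun x => MeasurableSet.union ?_ ?_))
  · exact ((measurableSet_forall_ne_lt c l x).inter (measurableSet_apply_le l x v)).compl
  · exact (measurableSet_mem_lowPat (fun i => measurable_truncStat c _) _ _).compl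

/-- Each key with a value at most `v` has a fresh chance of at least `p` to get an exceptionally
low pattern, and there are about `v n / 2` or more such keys. -/
lemma jprob_noLowPat_le {p v : ℝ} {l l' : Fin k} (hl : l' ≠ l) (hp0 : 0 < p) (hp1 : 2 * p ≤ 1)
    (hr : 8 ≤ p ^ 2 * r) (hv0 : 0 ≤ v) (hv1 : v ≤ 1) :
    jprob (r := r) (expRows k n) (NoLowPat c p v l l') ≤ Real.exp (-(p * v * n / 4)) := by
  rw [jprob_eq_integral_freq fun q => measurableSet_noLowPat c p v l l' q]
  refine le_trans (integral_mono_of_nonneg (.of_forall fun ρ => freq_nonneg _) ?_ ?_)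
    (integral_pow_card_le (c := c) l hv0 hv1 hp0.le (by linarith))
  · refine (integrable_const (1 : ℝ)).mono' (measurable_ite_pow_card c v p l).aestronglyMeasurable
      (.of_forall fun ρ => ?_)
    have h := ite_pow_card_mem_Icc (c := c) (v := v) hp0.le (by linarith) l ρ
    rw [Real.norm_of_nonneg h.1]
    exact h.2
  · filter_upwards [ae_truncStat_ne (k := k) (n := n) c] with ρ hgen
    by_cases hgood : (n : ℝ) / 2 ≤ (univ.filter fun x => ∀ l'', l'' ≠ l → c < ρ l'' x).card ∧
        ∃ x, ρ l' x ≤ c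
    · rw [if_pos hgood.1]
      exact (freq_mono fun q hq => hq.2).trans (freq_isBalanced_and_forall_notMem_lowPat_le hl hgen
        hgood.2 hp0 hp1 hr fun x hx => (mem_filter.1 hx).2.1)
    · refine le_trans (freq_mono (q := fun _ => False) fun q hq => hgood hq.1) ?_
      rw [freq_false]
      exact (ite_pow_card_mem_Icc hp0.le (by linarith) l ρ).1

lemma sum_range_exp_neg_mul_le {b : ℝ} (hb0 : 0 < b) (hb1 : b ≤ 1) (n : ℕ) :
    ∑ s ∈ range n, Real.exp (-(b * s)) ≤ 2 / b := by
  have h1 : Real.exp (-b) ≤ 1 - b / 2 := by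
    have h5 := Real.add_one_le_exp b
    rw [Real.exp_neg, inv_le_comm₀ (Real.exp_pos b) (by linarith)]
    refine le_trans ?_ h5
    rw [inv_le_iff_one_le_mul₀ (by linarith)]
    nlinarith
  have h2 : ∀ s : ℕ, Real.exp (-(b * s)) = Real.exp (-b) ^ s := fun s => by
    rw [← Real.exp_nat_mul]; congr 1; ring
  simp only [h2]
  have h3 := geom_sum_mul (Real.exp (-b)) n
  rw [le_div_iff₀ hb0]
  have h4 : 0 < Real.exp (-b) ^ n := by positivity
  have h5 : 0 ≤ ∑ s ∈ range n, Real.exp (-b) ^ s := sum_nonneg fun s _ => by positivity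
  nlinarith

/-- The geometric mean of a bound by `γ ^ 6` and of a bound with the exponential decay rate `γ ^ 4`
has a bounded sum. -/
lemma le_of_le_pow_six_of_le_exp {v γ x : ℝ} (h1 : v ≤ 2 * γ ^ 6)
    (h2 : v ≤ Real.exp (-(3 * x))) : v ≤ 2 * γ ^ 4 * Real.exp (-x) := by
  rcases le_or_gt v 0 with hv | hv
  · exact hv.trans (by positivity)
  · refine le_of_pow_le_pow_left₀ (n := 3) (by norm_num) (by positivity) ?_
    have h3 : Real.exp (-(3 * x)) = Real.exp (-x) ^ 3 := by
      rw [← Real.exp_nat_mul]; congr 1; push_cast; ring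
    rw [h3] at h2
    -- The first bound is used twice and the second one once: `v³ ≤ (2 γ⁶)² e^{-3x}`.
    calc v ^ 3 = v * v * v := by ring
      _ ≤ 2 * γ ^ 6 * (2 * γ ^ 6) * Real.exp (-x) ^ 3 := by gcongr
      _ ≤ 8 * γ ^ 12 * Real.exp (-x) ^ 3 := by
        have : 0 ≤ γ ^ 12 * Real.exp (-x) ^ 3 := by positivity
        nlinarith
      _ = _ := by ring

end Catch

/-! ### The attack on `k`-mins sketches -/

section KMinsAttack

variable {n k r : ℕ} {c : ℝ}

/-- The two ways to catch a key whose value of the hash function `l` is at most `s / n` both fail.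
The second way uses the minimal key of another hash function `l'`. -/
def NotCaught (c K δ p : ℝ) (l l' : Fin k) (s : ℕ) (ρ : Fin k → Fin n → ℝ)
    (q : Fin r → Finset (Fin n)) : Prop :=
  (∀ x ∈ univ, (s : ℝ) / n < ρ l x) ∨
    (HighMin c K δ l ρ q ∧ NoLowPat c p (s / n) l l' ρ q)

lemma measurableSet_forall_lt_apply (l : Fin k) (v : ℝ) :
    MeasurableSet {ρ : Fin k → Fin n → ℝ | ∀ x ∈ univ, v < ρ l x} := by
  have e : {ρ : Fin k → Fin n → ℝ | ∀ x ∈ univ, v < ρ l x} = {ρ | ∃ x, ρ l x ≤ v}ᶜ := by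
    ext ρ; simp
  rw [e]
  exact (measurableSet_exists_apply_le l v).compl

lemma measurableSet_notCaught (c K δ p : ℝ) (l l' : Fin k) (s : ℕ) (q : Fin r → Finset (Fin n)) :
    MeasurableSet {ρ | NotCaught c K δ p l l' s ρ q} := by
  have e : {ρ | NotCaught c K δ p l l' s ρ q} =
      {ρ : Fin k → Fin n → ℝ | ∀ x ∈ univ, (s : ℝ) / n < ρ l x} ∪
      ({ρ | HighMin c K δ l ρ q} ∩ {ρ | NoLowPat c p (s / n) l l' ρ q}) := rfl
  rw [e]
  exact (measurableSet_forall_lt_apply l _).union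
    ((measurableSet_highMin c K δ l q).inter (measurableSet_noLowPat c p _ l l' q))

lemma expRows_real_forall_lt (l : Fin k) {v : ℝ} (hv : 0 ≤ v) :
    (expRows k n).real {ρ | ∀ x ∈ univ, v < ρ l x} = Real.exp (-(n * v)) := by
  have hm : MeasurableSet {h : Fin n → ℝ | ∀ x ∈ univ, v < h x} := by
    have e : {h : Fin n → ℝ | ∀ x ∈ univ, v < h x} = ⋂ x ∈ univ, {h | v < h x} := by
      ext h; simp
    rw [e]
    exact Finset.measurableSet_biInter _ fun x _ =>
      measurableSet_lt measurable_const (measurable_pi_apply x)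
  rw [expRows_real_row l hm, expRow_real_forall_lt univ hv, card_univ, Fintype.card_fin]

/-- The expected number of levels `s` at which no key with a small value of the hash function `l`
is caught is bounded. There is no key with a value at most `s / n` with probability `e^{-s}`, and
otherwise both ways fail with probability at most `min (2 γ⁶) (e^{-α s / 16000})`, whose sum over
`s` is of order `γ⁴ / α = 1`. -/
lemma sum_jprob_notCaught_le {α γ K : ℝ} {l l' : Fin k} (hl : l' ≠ l) (hα : 0 < α)
    (hα1 : α ≤ 1) (hγ0 : 0 < γ) (hγ4 : γ ^ 4 = α) (hn : 0 < n) (hr0 : 0 < r)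
    (hc : γ / n ≤ c / 2) (hr : 8 ≤ (α / 4000) ^ 2 * r)
    (hK : 64 * (K + (γ ^ 2 / (256 * n)) ^ 2) / (r * (γ / n / 32) ^ 2) ≤ γ ^ 6) :
    ∑ s ∈ range n, jprob (r := r) (expRows k n)
      (NotCaught c K (γ ^ 2 / (256 * n)) (α / 4000) l l' s) ≤ 192002 := by
  have hn0 : (0 : ℝ) < n := by exact_mod_cast hn
  have hγ1 : γ ≤ 1 := by
    by_contra h
    have := one_lt_pow₀ (not_le.1 h) (n := 4) (by norm_num)
    linarith
  -- A third of the decay rate `p / 4 = α / 16000` of the second way, as the cube root is taken.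
  set b : ℝ := α / 48000 with hb
  have hb0 : 0 < b := by positivity
  have h1 : ∀ s ∈ range n, jprob (r := r) (expRows k n)
      (NotCaught c K (γ ^ 2 / (256 * n)) (α / 4000) l l' s) ≤
      Real.exp (-(1 * s)) + 2 * γ ^ 4 * Real.exp (-(b * s)) := by
    intro s hs
    have hsn : (s : ℝ) / n ≤ 1 := by
      rw [div_le_one hn0]; exact_mod_cast (mem_range.1 hs).le
    have h2 : jprob (r := r) (expRows k n) (fun ρ (_ : Fin r → Finset (Fin n)) =>
        ∀ x ∈ (univ : Finset (Fin n)),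
        (s : ℝ) / n < ρ l x) = Real.exp (-(1 * s)) := by
      rw [jprob_const, expRows_real_forall_lt l (by positivity), mul_div_cancel₀ _ hn0.ne', one_mul]
    have h3 : jprob (r := r) (expRows k n) (fun ρ q =>
        HighMin c K (γ ^ 2 / (256 * n)) l ρ q ∧ NoLowPat c (α / 4000) (s / n) l l' ρ q) ≤
        2 * γ ^ 4 * Real.exp (-(b * s)) := by
      refine le_of_le_pow_six_of_le_exp ?_ ?_
      · refine (jprob_mono fun ρ q h => h.1).trans ((jprob_highMin_le (η := γ / n) l hr0
          (by positivity) ?_ hc (by positivity) hK).trans (le_of_eq ?_))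
        · have e : 128 * (γ ^ 2 / (256 * n)) = γ / n * (γ / 2) := by field_simp; norm_num
          rw [e]
          exact mul_le_of_le_one_right (by positivity) (by linarith)
        · rw [mul_div_cancel₀ _ hn0.ne']; ring
      · refine (jprob_mono fun ρ q h => h.2).trans ((jprob_noLowPat_le hl (by positivity)
          (by linarith) hr (by positivity) hsn).trans (le_of_eq ?_))
        congr 2
        rw [hb]; field_simp; ring
    have h4 := jprob_or_le (μ := expRows k n)
      (fun ρ (_ : Fin r → Finset (Fin n)) => ∀ x ∈ (univ : Finset (Fin n)), (s : ℝ) / n < ρ l x)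
      (fun ρ q => HighMin c K (γ ^ 2 / (256 * n)) l ρ q ∧ NoLowPat c (α / 4000) (s / n) l l' ρ q)
    exact h4.trans (add_le_add h2.le h3)
  refine (sum_le_sum h1).trans ?_
  rw [sum_add_distrib, ← mul_sum]
  have h5 := sum_range_exp_neg_mul_le one_pos le_rfl n
  have h6 := sum_range_exp_neg_mul_le hb0 (by linarith) n
  have h7 : 2 * γ ^ 4 * ∑ s ∈ range n, Real.exp (-(b * s)) ≤ 2 * γ ^ 4 * (2 / b) := by gcongr
  have h8 : 2 * γ ^ 4 * (2 / b) = 192000 := by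
    rw [hγ4, hb]; field_simp; norm_num
  linarith

/-- The hash values of the lowest keys are small if the keys with small hash values are mostly
caught. -/
lemma sum_minHash_le_of_sum_notCaught_lt {ρ : Fin k → Fin n → ℝ} {q : Fin r → Finset (Fin n)}
    {W : Finset (Fin n)} {α K δ p N : ℝ} {other : Fin k → Fin k} (hα1 : α ≤ 1)
    (hαn : 0 < α * n) (hNn : N ≤ n)
    (hG : ∀ i, ∀ l, ∃ x ∈ q i, ρ l x ≤ c) (h0 : ∀ l x, 0 < ρ l x) (hV : truncVar c ρ < K)
    (hL : ((univ.filter fun x => ∃ l, ρ l x ≤ c).card : ℝ) < α * n / 4)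
    (hmin : ∀ l, ∃ x, ρ l x ≤ c / 2)
    (hA : ((univ.filter fun x => x ∉ (univ.filter fun x => ∃ l, ρ l x ≤ c) ∧
      ∑ i ∈ pat q x, (truncStat c ρ (q i) - (𝔼 U, truncStat c ρ U - δ)) ≤ 0).card : ℝ) < α * n / 2)
    (hP : ((univ.filter fun x => x ∉ (univ.filter fun x => ∃ l, ρ l x ≤ c) ∧
      pat q x ∈ lowPat (2 * p * 2 ^ r) fun i => truncStat c ρ (q i)).card : ℝ) < α * n / 2)
    (hbal : ∀ l, ∃ w, (∀ x, ρ l w ≤ ρ l x) ∧ IsBalanced q w)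
    (hN : ∑ i ∈ univ ×ˢ range n,
      (if NotCaught c K δ p i.1 (other i.1) i.2 ρ q then (1 : ℝ) else 0) < N)
    (hW : IsLowest (fun x => avgOn (fun i => ∑ l, |minHash (ρ l) (q i)|) (pat q x))
      ⌈α * (n : ℝ)⌉₊ W) :
    ∑ l, |minHash (ρ l) W| ≤ N / n := by
  have hn0 : (0 : ℝ) < n := by nlinarith [(Nat.cast_nonneg n : (0 : ℝ) ≤ n)]
  have hT : ∀ i, ∑ l, |minHash (ρ l) (q i)| = truncStat c ρ (q i) := fun i =>
    sum_congr rfl fun l _ => by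
      obtain ⟨x, hx, _⟩ := hG i l
      rw [truncMin_eq_minHash (hG i l), abs_of_pos (minHash_pos (h0 l) ⟨x, hx⟩)]
  have hc0 : ∀ l : Fin k, 0 < c := fun l => by
    obtain ⟨x, hx⟩ := hmin l
    linarith [h0 l x]
  -- At most `α n / 4` keys have a small value of some hash function.
  have hhigh : ∀ l, (n : ℝ) / 2 ≤ (univ.filter fun x => ∀ l'', l'' ≠ l → c < ρ l'' x).card := by
    intro l
    have h1 : (univ.filter fun x => ∃ l, ρ l x ≤ c)ᶜ ⊆
        univ.filter fun x => ∀ l'', l'' ≠ l → c < ρ l'' x := by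
      intro x hx
      simp only [mem_compl, mem_filter, mem_univ, true_and, not_exists, not_le] at hx ⊢
      exact fun l'' _ => hx l''
    have h2 := card_le_card h1
    rw [card_compl, Fintype.card_fin] at h2
    have h3 : n ≤ (univ.filter fun x => ∃ l, ρ l x ≤ c).card +
        (univ.filter fun x => ∀ l'', l'' ≠ l → c < ρ l'' x).card := by omega
    have h4 : (n : ℝ) ≤ (univ.filter fun x => ∃ l, ρ l x ≤ c).card +
        (univ.filter fun x => ∀ l'', l'' ≠ l → c < ρ l'' x).card := by exact_mod_cast h3
    nlinarith
  -- If the level `s` is caught, then `W` has a key with value at most `s / n`: one with an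
  -- exceptionally low pattern, or the minimal key.
  have hcatch : ∀ l s, ¬ NotCaught c K δ p l (other l) s ρ q → ∃ x ∈ W, ρ l x ≤ s / n := by
    intro l s hnot
    rw [NotCaught, not_or, not_and] at hnot
    obtain ⟨hlow, himp⟩ := hnot
    push Not at hlow
    obtain ⟨x, -, hx⟩ := hlow
    by_cases hH : HighMin c K δ l ρ q
    · have hM := himp hH
      have hex : ∃ x ∈ univ.filter fun x => (∀ l'', l'' ≠ l → c < ρ l'' x) ∧ ρ l x ≤ s / n,
          pat q x ∈ lowPat (2 * p * 2 ^ r) fun i => truncStat c ρ (insert x (q i)) := by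
        by_contra hcon
        push Not at hcon
        obtain ⟨z, hz⟩ := hmin (other l)
        exact hM ⟨⟨hhigh l, z, by linarith [hc0 l]⟩, hbal (other l), hcon⟩
      obtain ⟨z, hz, hzP⟩ := hex
      exact ⟨z, mem_of_pat_mem_lowPat (T := fun U => ∑ l, |minHash (ρ l) U|) (t := truncStat c ρ)
        hαn hT (fun U => truncStat_anti (subset_insert z U)) hL.le hP hW hzP,
        (mem_filter.1 hz).2.2⟩
    · rw [HighMin] at hH
      push Not at hH
      obtain ⟨y, hy, hlt⟩ := hH hV (hmin l)
      refine ⟨y, ?_, (hy x).trans hx⟩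
      by_contra hyW
      exact absurd (nonneg_sum_of_notMem (T := fun U => ∑ l, |minHash (ρ l) U|)
        (t := truncStat c ρ) hαn hT hL.le hA hW hyW) (not_le.2 hlt)
  rw [sum_product] at hN
  -- The minimum over `W` is at most `s / n` for the least level `s` that is caught, and all the
  -- `s` smaller levels are counted in `S l`.
  set S : Fin k → ℝ := fun l => ∑ s ∈ range n,
    if NotCaught c K δ p l (other l) s ρ q then (1 : ℝ) else 0 with hS
  have hSnn : ∀ l, 0 ≤ S l := fun l => sum_nonneg fun s _ => by split_ifs <;> norm_num
  have hle : ∀ l, |minHash (ρ l) W| ≤ S l / n := by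
    intro l
    -- Some level is caught, since `S l < N ≤ n`.
    have hex : ∃ s, s < n ∧ ¬ NotCaught c K δ p l (other l) s ρ q := by
      by_contra hcon
      push Not at hcon
      have h1 : S l = n := by
        simp only [hS]
        rw [sum_congr rfl fun s hs => if_pos (hcon s (mem_range.1 hs))]
        simp
      have h2 := single_le_sum (f := S) (fun l _ => hSnn l) (mem_univ l)
      linarith
    obtain ⟨x, hxW, hx⟩ := hcatch l _ (Nat.find_spec hex).2
    rw [abs_of_pos (minHash_pos (h0 l) ⟨x, hxW⟩)]
    refine (minHash_le hxW).trans (hx.trans ?_)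
    gcongr
    have h1 : ((Nat.find hex : ℕ) : ℝ) = ∑ s ∈ range (Nat.find hex),
        if NotCaught c K δ p l (other l) s ρ q then (1 : ℝ) else 0 := by
      rw [sum_congr rfl fun s hs => if_pos ?_]
      · simp
      · have h2 := mem_range.1 hs
        have h3 := Nat.find_min hex h2
        push Not at h3
        exact h3 (h2.trans (Nat.find_spec hex).1)
    rw [h1]
    exact sum_le_sum_of_subset_of_nonneg (range_subset_range.2 (Nat.find_spec hex).1.le)
      fun s _ _ => by split_ifs <;> norm_num
  refine (sum_le_sum fun l _ => hle l).trans ?_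
  rw [← sum_div]
  gcongr

end KMinsAttack

section KMinsMain

variable {n k r : ℕ}

lemma exp_neg_mul_log_le {X : ℝ} (hX : 10 ^ 6 ≤ X) {j : ℕ} (hj : 2 ≤ j) :
    X * Real.exp (-(j * Real.log X)) ≤ 1 / 10 ^ 6 := by
  have hX0 : 0 < X := by linarith
  rw [Real.exp_neg, Real.exp_nat_mul, Real.exp_log hX0, ← div_eq_mul_inv, div_le_div_iff₀
    (by positivity) (by norm_num), one_mul]
  calc X * 10 ^ 6 ≤ X * X := by gcongr
    _ = X ^ 2 := (sq X).symm
    _ ≤ X ^ j := pow_le_pow_right₀ (by linarith) hj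

/-- The variance of the truncated statistic over the queries is mostly of order `k / n²`. -/
lemma expRows_real_truncVar_ge_le {Λ : ℝ} (hk : 1 ≤ k) (hΛ1 : 1 ≤ Λ) (hkΛ : Real.log k ≤ Λ)
    (hn : 512 * (k * Λ) ≤ n) :
    (expRows k n).real {ρ | 10 ^ 5 * k / (n : ℝ) ^ 2 ≤ truncVar (16 * Λ / n) ρ} ≤ 97 / 10 ^ 5 := by
  have hk1 : (1 : ℝ) ≤ k := by exact_mod_cast hk
  have hkΛ' : (k : ℝ) ≤ k * Λ := le_mul_of_one_le_right (by positivity) hΛ1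
  have hn0 : (0 : ℝ) < n := by linarith
  have hc0 : 0 < 16 * Λ / n := by positivity
  have hK0 : 0 < 10 ^ 5 * k / (n : ℝ) ^ 2 := by positivity
  refine (real_le_variance_le (t := truncStat (k := k) (16 * Λ / n)) (a := 2 * k / n)
    (v := fun U => 64 * k / (n : ℝ) ^ 2 + 32 * ((k : ℝ) ^ 2 / n ^ 4) * ((n : ℝ) - 2 * U.card) ^ 2
      + if (U.card : ℝ) < n / 4 then (16 * k * Λ / n) ^ 2 else 0) (fun U => ?_)
    (fun U => integral_truncStat_sub_sq_le hk hΛ1 hkΛ hn U) hK0).trans ?_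
  · refine (integrable_const (1 : ℝ)).mono'
      (((measurable_truncStat _ U).sub_const _).pow_const 2).aestronglyMeasurable ?_
    filter_upwards [ae_expRows] with ρ hρ
    have h2 : truncStat (16 * Λ / n) ρ U ≤ k * (16 * Λ / n) := truncStat_le
    have h3 : 0 ≤ truncStat (16 * Λ / n) ρ U := truncStat_nonneg hc0 hρ
    have h4 : 0 < 2 * k / (n : ℝ) := by positivity
    have h5 : 2 * k / (n : ℝ) < 1 := by rw [div_lt_one hn0]; linarith
    have h6 : k * (16 * Λ / n) < 1 := by
      rw [mul_div_assoc', div_lt_one hn0]; linarith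
    rw [Real.norm_of_nonneg (sq_nonneg _), sq_le_one_iff_abs_le_one, abs_le]
    constructor <;> linarith
  · have := expect_size_le (n := n) (k := k) (Λ := Λ) hk1 (by linarith) hn
      (by linarith) (A := 64) (B := 32) (by norm_num)
    rw [div_le_iff₀ hK0]
    refine this.trans (le_of_eq ?_)
    field_simp; norm_num

/-- The minimal keys of all the hash functions are mostly in a balanced number of queries. -/
lemma jprob_exists_forall_not_isBalanced_le (hn : 0 < n) (hr : 0 < r) :
    jprob (r := r) (expRows k n) (fun ρ q => ∃ l ∈ univ, ∀ w, (∀ x, ρ l w ≤ ρ l x) →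
      ¬ IsBalanced q w) ≤ k * (4 / r) := by
  refine (jprob_exists_le (μ := expRows k n) univ fun (l : Fin k) ρ
    (q : Fin r → Finset (Fin n)) => ∀ w, (∀ x, ρ l w ≤ ρ l x) → ¬ IsBalanced q w).trans ?_
  calc _ ≤ ∑ _l : Fin k, (4 / r : ℝ) := sum_le_sum fun l _ => ?_
    _ = _ := by simp
  refine jprob_le_of_freq (fun q => ?_) (.of_forall fun ρ => ?_)
  · have e : {ρ : Fin k → Fin n → ℝ | ∀ w, (∀ x, ρ l w ≤ ρ l x) → ¬ IsBalanced q w} =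
        ⋂ w, ({ρ : Fin k → Fin n → ℝ | ∀ x, ρ l w ≤ ρ l x}ᶜ ∪ {_ρ | ¬ IsBalanced q w}) := by
      ext ρ
      simp only [Set.mem_ofPred_eq, Set.mem_iInter, Set.mem_union, Set.mem_compl_iff,
        imp_iff_not_or]
    rw [e]
    exact MeasurableSet.iInter fun w => (measurableSet_isMin l w).compl.union (MeasurableSet.const _)
  · obtain ⟨w, -, hw⟩ := exists_min_image univ (ρ l) ⟨⟨0, hn⟩, mem_univ _⟩
    exact (freq_mono fun q hq => hq w fun x => hw x (mem_univ x)).trans (freq_not_isBalanced_le hr w)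

lemma truncStat_insert_of_notMem {c : ℝ} {ρ : Fin k → Fin n → ℝ} {x : Fin n}
    (hx : x ∉ univ.filter fun x => ∃ l, ρ l x ≤ c) (U : Finset (Fin n)) :
    truncStat c ρ (insert x U) = truncStat c ρ U := by
  simp only [mem_filter, mem_univ, true_and, not_exists, not_le] at hx
  exact truncStat_insert_of_lt (fun l => (hx l).le) U

/-- Few keys with large hash values have averages below the mean by `δ`. -/
lemma jprob_truncVar_lt_and_card_low_ge_le {c K δ ε a : ℝ} (hr : 0 < r) (hδ : 0 < δ) (ha : 0 < a)
    (hε0 : 0 ≤ ε) (hε : n * (4 * (K + δ ^ 2) / (r * δ ^ 2)) / a ≤ ε) :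
    jprob (r := r) (expRows k n) (fun ρ q => truncVar c ρ < K ∧
      a ≤ ((univ.filter fun x => x ∉ (univ.filter fun x => ∃ l, ρ l x ≤ c) ∧
        ∑ i ∈ pat q x, (truncStat c ρ (q i) - (𝔼 U, truncStat c ρ U - δ)) ≤ 0).card : ℝ)) ≤ ε := by
  refine jprob_le_of_freq (fun q => ?_) (.of_forall fun ρ => ?_)
  · have e : {ρ : Fin k → Fin n → ℝ | truncVar c ρ < K ∧
        a ≤ ((univ.filter fun x => x ∉ (univ.filter fun x => ∃ l, ρ l x ≤ c) ∧
        ∑ i ∈ pat q x, (truncStat c ρ (q i) - (𝔼 U, truncStat c ρ U - δ)) ≤ 0).card : ℝ)} =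
        {ρ | truncVar c ρ < K} ∩
        {ρ | a ≤ ((univ.filter fun x => x ∉ (univ.filter fun x => ∃ l, ρ l x ≤ c) ∧
        ∑ i ∈ pat q x, (truncStat c ρ (q i) - (𝔼 U, truncStat c ρ U - δ)) ≤ 0).card : ℝ)} := rfl
    rw [e]
    refine (measurableSet_lt (measurable_truncVar c) measurable_const).inter
      (measurableSet_le measurable_const (measurable_card_filter
        (p := fun x (ρ : Fin k → Fin n → ℝ) => x ∉ (univ.filter fun x => ∃ l, ρ l x ≤ c) ∧
        ∑ i ∈ pat q x, (truncStat c ρ (q i) - (𝔼 U, truncStat c ρ U - δ)) ≤ 0) univ fun x _ => ?_))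
    have e2 : {ρ : Fin k → Fin n → ℝ | x ∉ (univ.filter fun x => ∃ l, ρ l x ≤ c) ∧
        ∑ i ∈ pat q x, (truncStat c ρ (q i) - (𝔼 U, truncStat c ρ U - δ)) ≤ 0} =
        (⋃ l, {ρ : Fin k → Fin n → ℝ | ρ l x ≤ c})ᶜ ∩
        {ρ | ∑ i ∈ pat q x, (truncStat c ρ (q i) - (𝔼 U, truncStat c ρ U - δ)) ≤ 0} := by
      ext ρ; simp
    rw [e2]
    exact (MeasurableSet.iUnion fun l => measurableSet_apply_le l x c).compl.inter
      (measurableSet_le (measurable_sum_pat_truncStat c δ q x) measurable_const)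
  · by_cases hV : truncVar c ρ < K
    · refine (freq_mono fun q hq => hq.2).trans ((freq_card_low_ge_le (t := truncStat c ρ)
        (fun x hx U => truncStat_insert_of_notMem hx U) hδ hr ha).trans (le_trans ?_ hε))
      have h3 : n * (4 * (truncVar c ρ + δ ^ 2) / (r * δ ^ 2)) / a ≤
          n * (4 * (K + δ ^ 2) / (r * δ ^ 2)) / a := by gcongr
      exact h3
    · refine le_trans (freq_mono (q := fun _ => False) fun q hq => hV hq.1) ?_
      rw [freq_false]; exact hε0

/-- Few keys with large hash values have exceptionally low patterns. -/
lemma jprob_card_pat_mem_lowPat_ge_le {c ε a : ℝ} (hε : 0 ≤ ε) (ha : 0 < a) :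
    jprob (r := r) (expRows k n) (fun ρ q =>
      a ≤ ((univ.filter fun x => x ∉ (univ.filter fun x => ∃ l, ρ l x ≤ c) ∧
        pat q x ∈ lowPat (ε * 2 ^ r) fun i => truncStat c ρ (q i)).card : ℝ)) ≤ n * ε / a := by
  refine jprob_le_of_freq (fun q => ?_) (.of_forall fun ρ => ?_)
  · refine measurableSet_le measurable_const (measurable_card_filter
      (p := fun x (ρ : Fin k → Fin n → ℝ) => x ∉ (univ.filter fun x => ∃ l, ρ l x ≤ c) ∧
        pat q x ∈ lowPat (ε * 2 ^ r) fun i => truncStat c ρ (q i)) univ fun x _ => ?_)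
    have e2 : {ρ : Fin k → Fin n → ℝ | x ∉ (univ.filter fun x => ∃ l, ρ l x ≤ c) ∧
        pat q x ∈ lowPat (ε * 2 ^ r) fun i => truncStat c ρ (q i)} =
        (⋃ l, {ρ : Fin k → Fin n → ℝ | ρ l x ≤ c})ᶜ ∩
        {ρ | pat q x ∈ lowPat (ε * 2 ^ r) fun i => truncStat c ρ (q i)} := by
      ext ρ; simp
    rw [e2]
    exact (MeasurableSet.iUnion fun l => measurableSet_apply_le l x c).compl.inter
      (measurableSet_mem_lowPat (fun i => measurable_truncStat c _) _ _)
  · exact freq_card_pat_mem_lowPat_ge_le (fun x hx U => truncStat_insert_of_notMem hx U) hε ha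

/-- Chebyshev's bound for the error on a key of influence `γ / (32 n)` is at most `γ ^ 6`: it is of
order `k / (r γ²)`, and `r γ ^ 8 = r α²` exceeds a large multiple of `k`. -/
lemma influence_error_le {α γ : ℝ} (hk : 2 ≤ (k : ℝ)) (hα1 : α ≤ 1) (hγ0 : 0 < γ)
    (hγ4 : γ ^ 4 = α) (hn : (0 : ℝ) < n) (hr0 : (0 : ℝ) < r) (hr : 10 ^ 22 * (k : ℝ) ≤ α ^ 2 * r) :
    64 * (10 ^ 5 * k / (n : ℝ) ^ 2 + (γ ^ 2 / (256 * n)) ^ 2) / (r * (γ / n / 32) ^ 2) ≤ γ ^ 6 := by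
  have h1 : (γ ^ 2 / (256 * n)) ^ 2 = α / (65536 * (n : ℝ) ^ 2) := by
    rw [← hγ4, div_pow]; congr 1 <;> ring
  have h2 : 10 ^ 5 * k / (n : ℝ) ^ 2 + (γ ^ 2 / (256 * n)) ^ 2 ≤ 2 * 10 ^ 5 * k / (n : ℝ) ^ 2 := by
    have h3 : α / (65536 * (n : ℝ) ^ 2) ≤ 10 ^ 5 * k / (n : ℝ) ^ 2 := by
      rw [← div_div]
      gcongr
      linarith
    rw [h1, mul_assoc 2, mul_div_assoc 2]
    linarith
  calc _ ≤ 64 * (2 * 10 ^ 5 * k / (n : ℝ) ^ 2) / (r * (γ / n / 32) ^ 2) := by gcongr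
    _ = 13107200000 * k / (r * γ ^ 2) := by field_simp; norm_num
    _ ≤ _ := by
      rw [div_le_iff₀ (by positivity)]
      have h4 : γ ^ 6 * (r * γ ^ 2) = α ^ 2 * r := by rw [← hγ4]; ring
      rw [h4]; linarith

set_option maxHeartbeats 800000 in
/-- The attack on `k`-mins sketches: outside an unlikely event, the lowest keys have statistic at
most of the order `k / n`. -/
theorem exists_bad_kMins {α : ℝ} (hk : 2 ≤ k) (hα : 0 < α) (hα1 : α ≤ 1)
    (hr : 10 ^ 22 * (k : ℝ) / α ^ 2 ≤ r)
    (hn : 10 ^ 9 * ((k : ℝ) * Real.log (k * r) / α) ≤ n) :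
    ∃ Bad : Hashes .kMins k n → (Fin r → Finset (Fin n)) → Prop,
      jprob (hashMeasure .kMins k n) Bad ≤ 0.009 ∧
      ∀ᵐ ρ ∂hashMeasure .kMins k n, ∀ q W,
        IsLowest (fun x => avgOn (fun i => stat .kMins k (sketch .kMins k ρ (q i))) (pat q x))
          ⌈α * (n : ℝ)⌉₊ W → ¬ Bad ρ q → stat .kMins k (sketch .kMins k ρ W) ≤ 10 ^ 8 * k / n := by
  have hk2 : (2 : ℝ) ≤ k := by exact_mod_cast hk
  have hk0 : 0 < k := by omega
  have hr1 : 10 ^ 22 * (k : ℝ) ≤ α ^ 2 * r := by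
    rwa [div_le_iff₀ (by positivity), mul_comm (r : ℝ)] at hr
  have hα2 : α ^ 2 ≤ α := by nlinarith
  have hrα : 10 ^ 22 * (k : ℝ) ≤ α * r := hr1.trans (by gcongr)
  have hr2 : 10 ^ 22 * (k : ℝ) ≤ r := hrα.trans (by nlinarith [(Nat.cast_nonneg r : (0 : ℝ) ≤ r)])
  have hr0 : (0 : ℝ) < r := by linarith
  have hr0' : 0 < r := by exact_mod_cast hr0
  set X : ℝ := k * r with hX
  have hXr : (r : ℝ) ≤ X := by rw [hX]; nlinarith
  have hXk : (k : ℝ) ≤ X := by rw [hX]; nlinarith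
  set Λ := Real.log X with hΛdef
  have hΛ1 : 1 ≤ Λ := by
    rw [hΛdef, Real.le_log_iff_exp_le (by linarith)]
    linarith [Real.exp_one_lt_d9]
  have hkΛ : Real.log k ≤ Λ := Real.log_le_log (by linarith) hXk
  have hnα : 10 ^ 9 * (k * Λ) ≤ α * n := by
    rw [mul_div_assoc', div_le_iff₀ hα, mul_comm (n : ℝ)] at hn; exact hn
  have hkΛ' : (k : ℝ) ≤ k * Λ := le_mul_of_one_le_right (by positivity) hΛ1
  have hΛk : Λ ≤ k * Λ := le_mul_of_one_le_left (by linarith) (by linarith)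
  have hαn : α * n ≤ n := by nlinarith [(Nat.cast_nonneg n : (0 : ℝ) ≤ n)]
  have hn1 : 10 ^ 9 * (k * Λ) ≤ n := hnα.trans hαn
  have hn0 : (0 : ℝ) < n := by linarith
  have hn0' : 0 < n := by exact_mod_cast hn0
  have hαn0 : 0 < α * n := by linarith
  -- Values within `γ / n` of a minimum count as close. The exponent makes the sum over the levels
  -- of the geometric mean of the two failure probabilities bounded.
  obtain ⟨γ, hγ0, hγ4⟩ : ∃ γ : ℝ, 0 < γ ∧ γ ^ 4 = α := by
    refine ⟨√(√α), by positivity, ?_⟩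
    rw [show (4 : ℕ) = 2 * 2 from rfl, pow_mul, Real.sq_sqrt (by positivity), Real.sq_sqrt hα.le]
  have hγ1 : γ ≤ 1 := by
    by_contra h
    have := one_lt_pow₀ (not_le.1 h) (n := 4) (by norm_num)
    linarith
  -- Each minimum is truncated at a level below which every query has values of every hash
  -- function.
  set c : ℝ := 16 * Λ / n with hc
  have hc0 : 0 < c := by positivity
  have hc1 : c ≤ 1 := by rw [hc, div_le_one hn0]; linarith
  set K : ℝ := 10 ^ 5 * k / n ^ 2 with hK
  -- `δ` is at most an eighth of the influence `γ / (32 n)` of a minimal key, and `δ² n²` is of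
  -- order `α`, so that `r ≥ C k / α²` queries leave few keys without influence below the
  -- threshold.
  set δ : ℝ := γ ^ 2 / (256 * n) with hδ
  have hδ0 : 0 < δ := by positivity
  -- At the threshold `2 p`, the expected number of keys with low patterns is `α n / 2000`.
  set p : ℝ := α / 4000 with hp
  have hδ2 : δ ^ 2 = α / (65536 * n ^ 2) := by rw [hδ, ← hγ4]; field_simp; norm_num
  obtain ⟨other, hother⟩ : ∃ other : Fin k → Fin k, ∀ l, other l ≠ l := by
    have : Nontrivial (Fin k) := Fin.nontrivial_iff_two_le.2 hk
    exact ⟨fun l => (exists_ne l).choose, fun l => (exists_ne l).choose_spec⟩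
  -- The unlikely events: a large minimum; a large variance; many keys with influence; a truncated
  -- query; an unbalanced minimal key; many keys of low score without influence; many keys with
  -- exceptionally low patterns; many levels that are not caught.
  set BMin : (Fin k → Fin n → ℝ) → (Fin r → Finset (Fin n)) → Prop :=
    fun ρ _ => ∃ l ∈ univ, ∀ x ∈ univ, c / 2 < ρ l x
  set BVar : (Fin k → Fin n → ℝ) → (Fin r → Finset (Fin n)) → Prop := fun ρ _ => K ≤ truncVar c ρ
  set BLow : (Fin k → Fin n → ℝ) → (Fin r → Finset (Fin n)) → Prop :=
    fun ρ _ => α * n / 4 ≤ ((univ.filter fun x => ∃ l, ρ l x ≤ c).card : ℝ)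
  set BTrunc : (Fin k → Fin n → ℝ) → (Fin r → Finset (Fin n)) → Prop :=
    fun ρ q => ∃ i ∈ univ, ∃ l, ∀ x ∈ q i, c < ρ l x
  set BBal : (Fin k → Fin n → ℝ) → (Fin r → Finset (Fin n)) → Prop := fun ρ q =>
    ∃ l ∈ univ, ∀ w, (∀ x, ρ l w ≤ ρ l x) → ¬ IsBalanced q w
  set BScore : (Fin k → Fin n → ℝ) → (Fin r → Finset (Fin n)) → Prop := fun ρ q => truncVar c ρ < K ∧
    α * n / 2 ≤ ((univ.filter fun x => x ∉ (univ.filter fun x => ∃ l, ρ l x ≤ c) ∧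
      ∑ i ∈ pat q x, (truncStat c ρ (q i) - (𝔼 U, truncStat c ρ U - δ)) ≤ 0).card : ℝ)
  set BPat : (Fin k → Fin n → ℝ) → (Fin r → Finset (Fin n)) → Prop := fun ρ q =>
    α * n / 2 ≤ ((univ.filter fun x => x ∉ (univ.filter fun x => ∃ l, ρ l x ≤ c) ∧
      pat q x ∈ lowPat (2 * p * 2 ^ r) fun i => truncStat c ρ (q i)).card : ℝ)
  set BMiss : (Fin k → Fin n → ℝ) → (Fin r → Finset (Fin n)) → Prop := fun ρ q =>
    10 ^ 8 * (k : ℝ) ≤ ∑ i ∈ univ ×ˢ range n,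
      if NotCaught c K δ p i.1 (other i.1) i.2 ρ q then (1 : ℝ) else 0
  have hBMin : jprob (expRows k n) BMin ≤ 1 / 10 ^ 6 := by
    refine (jprob_exists_le (μ := expRows k n) univ fun (l : Fin k) ρ
      (_ : Fin r → Finset (Fin n)) => ∀ x ∈ (univ : Finset (Fin n)), c / 2 < ρ l x).trans ?_
    refine le_trans ?_ (exp_neg_mul_log_le (X := X) (j := 8) (by linarith) (by norm_num))
    have h1 : ∀ l : Fin k, jprob (expRows k n) (fun ρ (_ : Fin r → Finset (Fin n)) =>
        ∀ x ∈ (univ : Finset (Fin n)), c / 2 < ρ l x) = Real.exp (-((8 : ℕ) * Real.log X)) := by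
      intro l
      rw [jprob_const, expRows_real_forall_lt l (by positivity)]
      congr 2
      rw [hc, ← hΛdef]; push_cast; field_simp; norm_num
    rw [sum_congr rfl fun l _ => h1 l, sum_const, card_univ, Fintype.card_fin, nsmul_eq_mul]
    gcongr
  have hBVar : jprob (expRows k n) BVar ≤ 97 / 10 ^ 5 := by
    rw [jprob_const]
    exact expRows_real_truncVar_ge_le (by omega) hΛ1 hkΛ (by linarith)
  have hBLow : jprob (expRows k n) BLow ≤ 64 / 10 ^ 9 := by
    rw [jprob_const]
    have h := real_card_low_ge_le .kMins k n hc0.le (a := α * n / 4) (by positivity)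
    refine le_trans h ?_
    rw [div_le_iff₀ (by positivity), hc, mul_div_assoc', show SketchType.numHashes .kMins k = k from rfl,
      div_le_iff₀ hn0]
    nlinarith
  have hBTrunc : jprob (expRows k n) BTrunc ≤ 1 / 10 ^ 6 := by
    refine (jprob_exists_query_le fun (ρ : Fin k → Fin n → ℝ) U => ∃ l, ∀ x ∈ U, c < ρ l x).trans ?_
    refine le_trans ?_ (exp_neg_mul_log_le (X := X) (j := 4) (by linarith) (by norm_num))
    have h1 := expect_real_exists_forall_lt_le (k := k) (n := n) hc0.le hc1
    have h2 : (n * c / 4 : ℝ) = (4 : ℕ) * Real.log X := by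
      rw [hc, ← hΛdef]; push_cast; field_simp; norm_num
    rw [h2] at h1
    calc _ ≤ (r : ℝ) * (k * Real.exp (-((4 : ℕ) * Real.log X))) := by gcongr
      _ = _ := by rw [hX]; ring
  have hBBal : jprob (expRows k n) BBal ≤ 1 / 10 ^ 6 := by
    refine (jprob_exists_forall_not_isBalanced_le hn0' hr0').trans ?_
    rw [mul_div_assoc', div_le_div_iff₀ hr0 (by norm_num)]
    linarith
  have hBScore : jprob (expRows k n) BScore ≤ 1 / 10 ^ 6 := by
    refine jprob_truncVar_lt_and_card_low_ge_le hr0' hδ0 (by positivity) (by norm_num) ?_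
    have h1 : K + δ ^ 2 ≤ 10 ^ 10 * k / α * δ ^ 2 := by
      have h2 : K = 6553600000 * k / α * δ ^ 2 := by rw [hK, hδ2]; field_simp; norm_num
      have h3 : (1 : ℝ) ≤ k / α := by rw [le_div_iff₀ hα]; linarith
      have h4 : δ ^ 2 ≤ k / α * δ ^ 2 := le_mul_of_one_le_left (by positivity) h3
      have h5 : 10 ^ 10 * k / α * δ ^ 2 = 10 ^ 10 * (k / α * δ ^ 2) := by ring
      have h6 : 6553600000 * k / α * δ ^ 2 = 6553600000 * (k / α * δ ^ 2) := by ring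
      have h7 : 0 < δ ^ 2 := by positivity
      rw [h2, h5, h6]; linarith
    calc _ ≤ (n : ℝ) * (4 * (10 ^ 10 * k / α * δ ^ 2) / (r * δ ^ 2)) / (α * n / 2) := by gcongr
      _ = 8 * 10 ^ 10 * k / (α ^ 2 * r) := by field_simp; norm_num
      _ ≤ _ := by
        rw [div_le_div_iff₀ (by positivity) (by norm_num)]; linarith
  have hBPat : jprob (expRows k n) BPat ≤ 1 / 1000 := by
    refine (jprob_card_pat_mem_lowPat_ge_le (by positivity) (by positivity)).trans (le_of_eq ?_)
    rw [hp]; field_simp; norm_num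
  have hBMiss : jprob (expRows k n) BMiss ≤ 192002 / 10 ^ 8 := by
    refine (jprob_le_sum_ite_le (univ ×ˢ range n) (fun i _ q =>
      measurableSet_notCaught c K δ p i.1 (other i.1) i.2 q) (by positivity)).trans ?_
    rw [sum_product, div_le_div_iff₀ (by positivity) (by norm_num)]
    have h1 : ∀ l : Fin k, ∑ s ∈ range n, jprob (r := r) (expRows k n)
        (NotCaught c K δ p l (other l) s) ≤ 192002 := fun l => by
      refine sum_jprob_notCaught_le (hother l) hα hα1 hγ0 hγ4 hn0' hr0' ?_ ?_ ?_
      · rw [hc, div_div, div_le_div_iff₀ hn0 (by positivity)]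
        nlinarith
      · have h2 : (α / 4000) ^ 2 * r = α ^ 2 * r / 16000000 := by ring
        rw [h2]; linarith
      · exact influence_error_le hk2 hα1 hγ0 hγ4 hn0 hr0 hr1
    have h2 := sum_le_sum fun (l : Fin k) (_ : l ∈ univ) => h1 l
    rw [sum_const, card_univ, Fintype.card_fin, nsmul_eq_mul] at h2
    linarith
  set Bad : (Fin k → Fin n → ℝ) → (Fin r → Finset (Fin n)) → Prop := fun ρ q =>
    BMin ρ q ∨ BVar ρ q ∨ BLow ρ q ∨ BTrunc ρ q ∨ BBal ρ q ∨ BScore ρ q ∨ BPat ρ q ∨ BMiss ρ q with hBad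
  have hBadP : jprob (expRows k n) Bad ≤ 0.009 := by
    refine (jprob_or_le _ _).trans ?_
    have h1 := jprob_or_le (μ := expRows k n) BVar
      (fun ρ q => BLow ρ q ∨ BTrunc ρ q ∨ BBal ρ q ∨ BScore ρ q ∨ BPat ρ q ∨ BMiss ρ q)
    have h3 := jprob_or_le (μ := expRows k n) BLow
      (fun ρ q => BTrunc ρ q ∨ BBal ρ q ∨ BScore ρ q ∨ BPat ρ q ∨ BMiss ρ q)
    have h4 := jprob_or_le (μ := expRows k n) BTrunc (fun ρ q => BBal ρ q ∨ BScore ρ q ∨ BPat ρ q ∨ BMiss ρ q)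
    have h5 := jprob_or_le (μ := expRows k n) BBal (fun ρ q => BScore ρ q ∨ BPat ρ q ∨ BMiss ρ q)
    have h6 := jprob_or_le (μ := expRows k n) BScore (fun ρ q => BPat ρ q ∨ BMiss ρ q)
    have h7 := jprob_or_le (μ := expRows k n) BPat BMiss
    linarith
  have hmain : ∀ᵐ ρ ∂expRows k n, ∀ (q : Fin r → Finset (Fin n)) W,
      IsLowest (fun x => avgOn (fun i => ∑ l, |minHash (ρ l) (q i)|) (pat q x)) ⌈α * (n : ℝ)⌉₊ W →
      ¬ Bad ρ q → ∑ l, |minHash (ρ l) W| ≤ 10 ^ 8 * k / n := by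
    filter_upwards [ae_expRows] with ρ hρ q W hW hnot
    simp only [hBad, not_or] at hnot
    obtain ⟨nMin, nVar, nLow, nTrunc, nBal, nScore, nPat, nMiss⟩ := hnot
    have nVar : truncVar c ρ < K := not_le.1 nVar
    refine sum_minHash_le_of_sum_notCaught_lt (K := K) (δ := δ) (p := p) (other := other) hα1 hαn0
      (by linarith) (fun i l => ?_) hρ nVar (not_le.1 nLow) (fun l => ?_)
      (not_le.1 fun hle => nScore ⟨nVar, hle⟩) (not_le.1 nPat) (fun l => ?_) (not_le.1 nMiss) hW
    · by_contra hcon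
      push Not at hcon
      exact nTrunc ⟨i, mem_univ i, l, hcon⟩
    · by_contra hcon
      push Not at hcon
      exact nMin ⟨l, mem_univ l, fun x _ => hcon x⟩
    · by_contra hcon
      push Not at hcon
      exact nBal ⟨l, mem_univ l, hcon⟩
  refine ⟨Bad, hBadP, ?_⟩
  have hmain' : ∀ᵐ ρ ∂hashMeasure .kMins k n, ∀ (q : Fin r → Finset (Fin n)) W,
      IsLowest (fun x => avgOn (fun i => ∑ l, |minHash (ρ l) (q i)|) (pat q x)) ⌈α * (n : ℝ)⌉₊ W →
      ¬ Bad ρ q → ∑ l, |minHash (ρ l) W| ≤ 10 ^ 8 * k / n := hmain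
  filter_upwards [hmain'] with ρ hρ q W hW hnot
  have hst : ∀ U, stat .kMins k (sketch .kMins k ρ U) = ∑ l, |minHash (ρ l) U| := fun U =>
    stat_kMins ρ U
  simp only [hst] at hW ⊢
  exact hρ q W hW hnot

end KMinsMain

end CardSketch

end

open CardSketch in
theorem theorem4p1 :
    ∃ Cn Cr c c₁ c₂ : ℝ, 0 < Cn ∧ 0 < Cr ∧ 0 < c ∧ 0 < c₁ ∧ 0 < c₂ ∧
      ∀ (s : SketchType) (k : ℕ) (α : ℝ), 2 ≤ k → 0 < α → α ≤ 1 →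
      ∀ r : ℕ, Cr * (k : ℝ) / α ^ 2 ≤ (r : ℝ) →
      ∀ n : ℕ, Cn * ((k : ℝ) * Real.log ((k : ℝ) * (r : ℝ)) / α) ≤ (n : ℝ) →
      -- `W` is the set of the `α n` lowest-scoring keys, chosen with any measurable tie-breaking
      ∀ W : Run s k n r → Finset (Fin n),
        (∀ V : Finset (Fin n), MeasurableSet (W ⁻¹' {V})) →
        (∀ ω, IsLowest (score s k ω) ⌈α * (n : ℝ)⌉₊ (W ω)) →
        (0.99 : ℝ) ≤ (runLaw s k n r).real
            {ω | IsBiasedUp s k (sketch s k ω.1 (W ω)) (W ω).card (c / α) ∧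
              c₁ * (n : ℝ) ≤ estimate s k (sketch s k ω.1 (W ω)) ∧
              estimate s k (sketch s k ω.1 (W ω)) ≤ c₂ * (n : ℝ)} ∧
        Integrable (fun ω => estimate s k (sketch s k ω.1 (W ω))) (runLaw s k n r) ∧
        c₁ * (n : ℝ) ≤ ∫ ω, estimate s k (sketch s k ω.1 (W ω)) ∂(runLaw s k n r) ∧
        ∫ ω, estimate s k (sketch s k ω.1 (W ω)) ∂(runLaw s k n r) ≤ c₂ * (n : ℝ) := by
  -- With `B = 10 ^ 8` and `C = 9` in `conclusion_of_stat_le`: `c = 1 / (2 B)`, `c₁ = 1 / (4 B)` and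
  -- `c₂ = 1000 C`.
  refine ⟨10 ^ 9, 10 ^ 22, 1 / (2 * 10 ^ 8), 1 / (4 * 10 ^ 8), 9000, by norm_num, by norm_num,
    by norm_num, by norm_num, by norm_num, fun s k α hk hα hα1 r hr n hn W hWm hW => ?_⟩
  have hk2 : (2 : ℝ) ≤ k := by exact_mod_cast hk
  have hΛ : 1 ≤ Real.log ((k : ℝ) * r) := by
    have h1 : 10 ^ 22 * (k : ℝ) ≤ r := by
      refine le_trans ?_ hr
      rw [le_div_iff₀ (by positivity)]
      exact mul_le_of_le_one_right (by positivity) (pow_le_one₀ hα.le hα1)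
    have h2 : (r : ℝ) ≤ k * r := le_mul_of_one_le_left (by positivity) (by linarith)
    rw [Real.le_log_iff_exp_le (by linarith)]
    linarith [Real.exp_one_lt_d9]
  have hkΛ : (k : ℝ) ≤ k * Real.log ((k : ℝ) * r) := le_mul_of_one_le_right (by positivity) hΛ
  have hnα : 10 ^ 9 * (k * Real.log ((k : ℝ) * r)) ≤ α * n := by
    have h := hn
    rwa [mul_div_assoc', div_le_iff₀ hα, mul_comm (n : ℝ)] at h
  have hαn : α * n ≤ n := mul_le_of_le_one_left (by positivity) hα1
  have hn1 : 1 ≤ α * n := by linarith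
  have hkn : (k : ℝ) ≤ n := by linarith
  have hkn' : k ≤ n := by exact_mod_cast hkn
  cases s
  · obtain ⟨Bad, hBad, hgood⟩ := exists_bad_kMins hk hα hα1 hr hn
    have h := conclusion_of_stat_le .kMins (C := 9) hk hα hn1 (by norm_num) (by norm_num) hBad hgood
      (lintegral_estimate_univ_kMins_le hk (by omega)) W hWm hW
    norm_num at h ⊢
    exact h
  · have hn' : 10 ^ 8 * ((k : ℝ) * Real.log (k * r) / α) ≤ n := by
      exact (mul_le_mul_of_nonneg_right (by norm_num) (by positivity)).trans hn
    obtain ⟨Bad, hBad, hgood⟩ := exists_bad_bottomK hk hα hα1 hr hn'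
    have hgood' : ∀ᵐ ρ ∂hashMeasure .bottomK k n, ∀ q W,
        IsLowest (fun x => avgOn (fun i => stat .bottomK k (sketch .bottomK k ρ (q i))) (pat q x))
          ⌈α * (n : ℝ)⌉₊ W → ¬ Bad ρ q →
          stat .bottomK k (sketch .bottomK k ρ W) ≤ 10 ^ 8 * k / n := by
      filter_upwards [hgood] with ρ hρ q W hW hq
      refine (hρ q W hW hq).trans ?_
      gcongr
      norm_num
    have hE : ∫⁻ ρ, ENNReal.ofReal (estimate .bottomK k (sketch .bottomK k ρ Finset.univ))
        ∂hashMeasure .bottomK k n ≤ ENNReal.ofReal (9 * n) := by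
      refine (lintegral_estimate_univ_bottomK_le hk hkn').trans (ENNReal.ofReal_le_ofReal ?_)
      gcongr
      norm_num
    have h := conclusion_of_stat_le .bottomK (C := 9) hk hα hn1 (by norm_num) (by norm_num) hBad
      hgood' hE W hWm hW
    norm_num at h ⊢
    exact h
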